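/- Let $k$ be a field of characteristic $0$, $\mathrm{pt}=\operatorname{Spec}k$, and let $X$ be a $k$-scheme and $Y$ a presheaf of sets on $k$-schemes. *Correspondences.* An explicit framed correspondence of level $n$ from $X$ to $Y$ is a tuple $(Z,W,\phi,g)$, where $Z\subseteq\mathbb A^n_X$ is a closed subset finite over $X$ (with its reduced structure), $W\to\mathbb A^n_X$ is an étale neighbourhood of $Z$ (an étale morphism with $W\times_{\mathbb A^n_X}Z\cong Z$), $\phi\colon W\to\mathbb A^n$ is a morphism with $\phi^{-1}(0)=Z$ as sets, and $g\in Y(W)$. An explicit cobordism-framed correspondence of level $(n,N)$, $n,N\ge 0$, is defined in the same way, except that $\phi\colon W\to\tau_{n,n+N}$ is a morphism to the total space of the tautological bundle over the Grassmannian of rank $n$ quotients of $\mathcal O^{n+N}$, i.e. $\phi$ is an epimorphism $p\colon\mathcal O_W^{n+N}\twoheadrightarrow E$ with $E$ locally free of rank $n$, together with a section $s$ of $E$ (up to isomorphism of $E$), and $Z$ is the zero set of $s$. Two tuples of the same level with the same $Z$ are equivalent if $\phi$ and $g$ agree on a common refinement of the neighbourhoods. Stabilise by $(Z,W,\phi,g)\mapsto(0\times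 Z,\mathbb A^1\times W,\phi',g\circ\mathrm{pr}_W)$, where $\phi'=(x,\phi)$ in the framed case, $\phi'=(\mathcal O\oplus\mathcal O^{n+N}\twoheadrightarrow\mathcal O\oplus E,\,(x,s))$ in the cobordism case, and $x$ is the coordinate on $\mathbb A^1$; in the cobordism case stabilise also along $N$, extending $p$ by zero to an added last summand $\mathcal O$. Let $\mathbb ZF(X,Y)$, respectively $\mathbb ZF^{cob}(X,Y)$, be the free abelian group on the colimit of the sets of equivalence classes modulo the relations $[c\amalg c']=[c]+[c']$ for $c,c'$ of the same level with disjoint supports. *Homology.* For $F\in\{\mathbb ZF,\mathbb ZF^{cob}\}$ let $H^0(F(X,Y))$ be the $0$-th homology of the complex $F(\Delta^\bullet_k\times X,Y)$, i.e. the quotient of $F(X,Y)$ by all $i_0^*c-i_1^*c$ with $c\in F(\mathbb A^1\times X,Y)$. Let $e_i$ be the endomorphism of $\mathbb G_m^m$ replacing the $i$-th coordinate by $1$, and let $H^0(F(\mathrm{pt},\mathbb G_m^{\wedge m}))$ be the direct summand $\prod_{i=1}^m(1-e_i)\,H^0(F(\mathrm{pt},\mathbb G_m^m))$. *Products and comparison.*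 The external product of correspondences with source $\mathrm{pt}$ is $(Z,W,\phi,g)\times(Z',W',\phi',g')=(Z\times Z',W\times W',\phi\oplus\phi',g\times g')$, where in the framed case $\phi\oplus\phi'=(\phi,\phi')$, and in the cobordism case it is the epimorphism $p\oplus p'$ onto $E\oplus E'$, precomposed with the identification $\mathcal O^{(n+n')+(N+N')}\cong\mathcal O^{n+N}\oplus\mathcal O^{n'+N'}$ that interchanges the summands $\mathcal O^N$ and $\mathcal O^{n'}$, with the section $(s,s')$. Let $\mathrm{Hcob}\colon H^0(\mathbb ZF(\mathrm{pt},\mathbb G_m^{\wedge m}))\to H^0(\mathbb ZF^{cob}(\mathrm{pt},\mathbb G_m^{\wedge m}))$ be the homomorphism induced by $(Z,W,\phi,g)\mapsto(Z,W,i\circ\phi,g)$, where $i\colon\mathbb A^n\hookrightarrow\tau_{n,n+N}$ is the fibre over the projection of $\mathcal O^{n+N}$ to its first $n$ coordinates. **Corollary.** In the framed and in the cobordism-framed case, the external product (with $\mathbb G_m^m\times\mathbb G_m^{m'}=\mathbb G_m^{m+m'}$) induces well-defined biadditive maps $H^0(F(\mathrm{pt},\mathbb G_m^m))\times H^0(F(\mathrm{pt},\mathbb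 G_m^{m'}))\to H^0(F(\mathrm{pt},\mathbb G_m^{m+m'}))$. They restrict to the summands and make $\bigoplus_{m\ge0}H^0(\mathbb ZF(\mathrm{pt},\mathbb G_m^{\wedge m}))$ and $\bigoplus_{m\ge0}H^0(\mathbb ZF^{cob}(\mathrm{pt},\mathbb G_m^{\wedge m}))$ associative graded rings with unit, the unit being the class of the level $0$ correspondence $\mathrm{id}\colon\mathrm{pt}\to\mathrm{pt}=\mathbb G_m^0$. The maps $\mathrm{Hcob}$ form a homomorphism of graded rings with unit $$\bigoplus_{m\ge0}H^0(\mathbb ZF(\mathrm{pt},\mathbb G_m^{\wedge m}))\to\bigoplus_{m\ge0}H^0(\mathbb ZF^{cob}(\mathrm{pt},\mathbb G_m^{\wedge m})).$$ -/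

import Mathlib

open CategoryTheory CategoryTheory.Limits AlgebraicGeometry Opposite TopologicalSpace
universe u
noncomputable section
namespace CobFr
set_option linter.unusedSectionVars false

/-- The target of a framing, through its functor of points: the set `sec W` of morphisms from a scheme
`W` to it, and for each of them the preimage in `W` of the origin (or of the zero section). -/
structure FramingSpace : Type (u + 1) where
  sec : Scheme.{u}ᵒᵖ ⥤ Type u
  zero : ∀ {W : Scheme.{u}}, sec.obj (op W) → Set W
  zero_map : ∀ {W W' : Scheme.{u}} (f : W' ⟶ W) (φ : sec.obj (op W)),
    zero (sec.map f.op φ) = f ⁻¹' zero φ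

/-- Morphisms of framing spaces under which the zero section is the preimage of the zero section. -/
structure FramingSpace.Hom (𝓕 𝓖 : FramingSpace.{u}) : Type (u + 1) where
  hom : 𝓕.sec ⟶ 𝓖.sec
  zero_hom : ∀ {W : Scheme.{u}} (φ : 𝓕.sec.obj (op W)), 𝓖.zero (hom.app _ φ) = 𝓕.zero φ

/-- Morphisms from a product of framing spaces under which the product of the zero sections is the
preimage of the zero section. -/
structure FramingSpace.Pairing (𝓕 𝓖 𝓗 : FramingSpace.{u}) : Type (u + 1) where
  hom : FunctorToTypes.prod 𝓕.sec 𝓖.sec ⟶ 𝓗.sec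
  zero_hom : ∀ {W : Scheme.{u}} (φ : 𝓕.sec.obj (op W)) (ψ : 𝓖.sec.obj (op W)),
    𝓗.zero (hom.app (op W) (φ, ψ)) = 𝓕.zero φ ∩ 𝓖.zero ψ

def FramingSpace.Hom.id (𝓕 : FramingSpace.{u}) : 𝓕.Hom 𝓕 where
  hom := 𝟙 _
  zero_hom _ := rfl

def FramingSpace.Hom.comp {𝓕 𝓖 𝓗 : FramingSpace.{u}} (α : 𝓕.Hom 𝓖) (β : 𝓖.Hom 𝓗) : 𝓕.Hom 𝓗 where
  hom := α.hom ≫ β.hom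
  zero_hom φ := (β.zero_hom _).trans (α.zero_hom φ)

/-- Precomposition of a pairing with a morphism in the first variable. -/
def FramingSpace.Pairing.compLeft {𝓕 𝓕' 𝓖 𝓗 : FramingSpace.{u}} (μ : FramingSpace.Pairing 𝓕 𝓖 𝓗)
    (α : 𝓕'.Hom 𝓕) : FramingSpace.Pairing 𝓕' 𝓖 𝓗 where
  hom := FunctorToTypes.prod.lift (FunctorToTypes.prod.fst ≫ α.hom) FunctorToTypes.prod.snd ≫ μ.hom
  zero_hom φ ψ := (μ.zero_hom (α.hom.app _ φ) ψ).trans (by rw [α.zero_hom])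

/-- The affine space with coordinates indexed by `r`, and its origin: a morphism `W ⟶ 𝔸ʳ` is a family
of functions on `W`, and a point of `W` goes to the origin iff all of them vanish in its residue
field. -/
def affineSpace (r : Type) : FramingSpace.{u} where
  sec :=
    { obj := fun W => r → Γ(W.unop, ⊤)
      map := fun f => TypeCat.ofHom fun φ i => f.unop.appTop (φ i)
      map_id := fun W => by ext φ i; simp
      map_comp := fun f g => by ext φ i; rfl }
  zero {W} φ := {w | ∀ i, w ∉ W.basicOpen (φ i)}
  zero_map {W W'} f φ := by
    ext w
    refine forall_congr' fun i => not_congr ?_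
    change _ ↔ w ∈ f ⁻¹ᵁ (W.basicOpen (φ i))
    rw [Scheme.preimage_basicOpen]; rfl

/-! ### Points of the total space of the tautological bundle

A morphism from `W` to the total space of the tautological bundle over the Grassmannian of rank `r`
quotients of `𝒪ᶜ` is an epimorphism `𝒪ᶜ ⟶ E` with `E` locally free of rank `r`, up to isomorphism of
`E`, together with a section of `E`. It is given by local trivialisations of `E`: over an open
neighbourhood of each point, an `r × c` matrix with a right inverse and a column of `r` functions,
glued along invertible transition matrices. These transition matrices are unique, since the matrices
are epimorphisms, so they satisfy the cocycle condition automatically. -/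

section Tau

variable {r c r' c' r'' c'' : Type} [Fintype c] [Fintype c'] [Fintype c''] [Fintype r] [DecidableEq r] [Fintype r'] [DecidableEq r']
  [Fintype r''] [DecidableEq r'']

/-- `(A, v)` and `(A', v')` define the same quotient of a free module with the same element. -/
def SameQuot {R : Type u} [CommRing R] (A A' : Matrix r c R) (v v' : r → R) : Prop :=
  ∃ g : Matrix.GeneralLinearGroup r R, g.1 * A = A' ∧ g.1.mulVec v = v'

lemma SameQuot.refl {R : Type u} [CommRing R] (A : Matrix r c R) (v : r → R) :
    SameQuot A A v v := ⟨1, by simp, by simp⟩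

lemma SameQuot.map {R S : Type u} [CommRing R] [CommRing S] (f : R →+* S)
    {A A' : Matrix r c R} {v v' : r → R} (h : SameQuot A A' v v') :
    SameQuot (A.map f) (A'.map f) (f ∘ v) (f ∘ v') := by
  obtain ⟨g, rfl, rfl⟩ := h
  refine ⟨Matrix.GeneralLinearGroup.map f g, ?_, ?_⟩
  · rw [Matrix.map_mul]; rfl
  · funext i
    exact (RingHom.map_mulVec f g.1 v i).symm

abbrev blockSum {R : Type u} [CommRing R] (er : r ⊕ r' ≃ r'') (ec : c ⊕ c' ≃ c'')
    (A : Matrix r c R) (B : Matrix r' c' R) : Matrix r'' c'' R :=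
  Matrix.reindex er ec (Matrix.fromBlocks A 0 0 B)

abbrev vecSum {R : Type u} (er : r ⊕ r' ≃ r'') (v : r → R) (w : r' → R) : r'' → R :=
  Sum.elim v w ∘ er.symm

abbrev zeroCols {R : Type u} [CommRing R] (ec : c ⊕ c' ≃ c'')
    (A : Matrix r c R) : Matrix r c'' R :=
  Matrix.reindex (Equiv.refl r) ec (Matrix.fromCols A 0)

lemma zeroCols_map {R S : Type u} [CommRing R] [CommRing S] (f : R →+* S) (ec : c ⊕ c' ≃ c'')
    (A : Matrix r c R) : (zeroCols ec A).map f = zeroCols ec (A.map f) := by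
  ext i j
  obtain ⟨j, rfl⟩ := ec.surjective j
  cases j <;> simp

lemma blockSum_map {R S : Type u} [CommRing R] [CommRing S] (f : R →+* S) (er : r ⊕ r' ≃ r'')
    (ec : c ⊕ c' ≃ c'') (A : Matrix r c R) (B : Matrix r' c' R) :
    (blockSum er ec A B).map f = blockSum er ec (A.map f) (B.map f) := by
  ext i j
  obtain ⟨i, rfl⟩ := er.surjective i
  obtain ⟨j, rfl⟩ := ec.surjective j
  cases i <;> cases j <;> simp

lemma vecSum_map {R S : Type u} [CommRing R] [CommRing S] (f : R →+* S) (er : r ⊕ r' ≃ r'')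
    (v : r → R) (w : r' → R) : f ∘ vecSum er v w = vecSum er (f ∘ v) (f ∘ w) := by
  funext i
  obtain ⟨i, rfl⟩ := er.surjective i
  cases i <;> simp

lemma SameQuot.zeroCols {R : Type u} [CommRing R] (ec : c ⊕ c' ≃ c'')
    {A A' : Matrix r c R} {v v' : r → R} (h : SameQuot A A' v v') :
    SameQuot (zeroCols ec A) (zeroCols ec A') v v' := by
  obtain ⟨g, rfl, rfl⟩ := h
  refine ⟨g, ?_, rfl⟩
  ext i j
  obtain ⟨j, rfl⟩ := ec.surjective j
  cases j <;> simp [Matrix.mul_apply, CobFr.zeroCols]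

lemma SameQuot.sum {R : Type u} [CommRing R] (er : r ⊕ r' ≃ r'') (ec : c ⊕ c' ≃ c'')
    {A A' : Matrix r c R} {v v' : r → R} (h : SameQuot A A' v v')
    {B B' : Matrix r' c' R} {w w' : r' → R} (h' : SameQuot B B' w w') :
    SameQuot (blockSum er ec A B) (blockSum er ec A' B') (vecSum er v w) (vecSum er v' w') := by
  obtain ⟨g, rfl, rfl⟩ := h
  obtain ⟨g', rfl, rfl⟩ := h'
  have e1 : Matrix.fromBlocks g.1 0 0 g'.1 * Matrix.fromBlocks g⁻¹.1 0 0 g'⁻¹.1 = 1 := by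
    rw [Matrix.fromBlocks_multiply]
    simp only [← Units.val_mul]; simp
  have e2 : Matrix.fromBlocks g⁻¹.1 0 0 g'⁻¹.1 * Matrix.fromBlocks g.1 0 0 g'.1 = 1 := by
    rw [Matrix.fromBlocks_multiply]
    simp only [← Units.val_mul]; simp
  refine ⟨⟨Matrix.reindex er er (Matrix.fromBlocks g.1 0 0 g'.1),
    Matrix.reindex er er (Matrix.fromBlocks g⁻¹.1 0 0 g'⁻¹.1), ?_, ?_⟩, ?_, ?_⟩
  · simp only [Matrix.reindex_apply, Matrix.submatrix_mul_equiv, e1, Matrix.submatrix_one_equiv]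
  · simp only [Matrix.reindex_apply, Matrix.submatrix_mul_equiv, e2, Matrix.submatrix_one_equiv]
  · simp only [Matrix.reindex_apply, Matrix.submatrix_mul_equiv, Matrix.fromBlocks_multiply]
    simp
  · simp only [Matrix.reindex_apply, vecSum, Matrix.submatrix_mulVec_equiv]
    rw [Function.comp_assoc]
    simp [Matrix.fromBlocks_mulVec]

def resHom (W : Scheme.{u}) {U V : W.Opens} (h : V ≤ U) : Γ(W, U) →+* Γ(W, V) :=
  (W.presheaf.map (homOfLE h).op).hom

lemma resHom_resHom {W : Scheme.{u}} {U V V' : W.Opens} (h : V ≤ U) (h' : V' ≤ V) (s : Γ(W, U)) :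
    resHom W h' (resHom W h s) = resHom W (h'.trans h) s := by
  change (W.presheaf.map (homOfLE h).op ≫ W.presheaf.map (homOfLE h').op) s = _
  rw [← Functor.map_comp]; rfl

lemma appLE_resHom {W W' : Scheme.{u}} (f : W' ⟶ W) {U U₁ : W.Opens} {V : W'.Opens} (h₁ : U₁ ≤ U)
    (hV : V ≤ f ⁻¹ᵁ U₁) (s : Γ(W, U)) :
    (f.appLE U₁ V hV).hom (resHom W h₁ s) =
      resHom W' (hV.trans (fun _ hz => h₁ hz)) ((f.app U).hom s) := by
  change (W.presheaf.map (homOfLE h₁).op ≫ f.appLE U₁ V hV) s =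
    (f.app U ≫ W'.presheaf.map _) s
  rw [Scheme.Hom.map_appLE]; rfl

lemma app_resHom {W W' : Scheme.{u}} (f : W' ⟶ W) {U U₁ : W.Opens} (h₁ : U₁ ≤ U) (s : Γ(W, U)) :
    (f.app U₁).hom (resHom W h₁ s) =
      resHom W' (fun _ hz => h₁ hz : f ⁻¹ᵁ U₁ ≤ f ⁻¹ᵁ U) ((f.app U).hom s) := by
  rw [← appLE_resHom f h₁ le_rfl, Scheme.Hom.appLE_eq_app]

lemma matrix_appLE_resHom {W W' : Scheme.{u}} (f : W' ⟶ W) {U U₁ : W.Opens} {V : W'.Opens}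
    (h₁ : U₁ ≤ U) (hV : V ≤ f ⁻¹ᵁ U₁) (h : V ≤ f ⁻¹ᵁ U) (A : Matrix r c Γ(W, U)) :
    (A.map (f.app U).hom).map (resHom W' h) =
      (A.map (resHom W h₁)).map (f.appLE U₁ V hV).hom := by
  ext i j; simp [appLE_resHom]

lemma vec_appLE_resHom {W W' : Scheme.{u}} (f : W' ⟶ W) {U U₁ : W.Opens} {V : W'.Opens}
    (h₁ : U₁ ≤ U) (hV : V ≤ f ⁻¹ᵁ U₁) (h : V ≤ f ⁻¹ᵁ U) (v : r → Γ(W, U)) :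
    resHom W' h ∘ (f.app U).hom ∘ v = (f.appLE U₁ V hV).hom ∘ resHom W h₁ ∘ v := by
  funext i; simp [appLE_resHom]

lemma matrix_app_resHom {W W' : Scheme.{u}} (f : W' ⟶ W) {U U₁ : W.Opens} (h₁ : U₁ ≤ U)
    (A : Matrix r c Γ(W, U)) :
    (A.map (resHom W h₁)).map (f.app U₁).hom =
      (A.map (f.app U).hom).map (resHom W' (fun _ hz => h₁ hz : f ⁻¹ᵁ U₁ ≤ f ⁻¹ᵁ U)) := by
  ext i j; simp [app_resHom]

lemma vec_app_resHom {W W' : Scheme.{u}} (f : W' ⟶ W) {U U₁ : W.Opens} (h₁ : U₁ ≤ U)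
    (v : r → Γ(W, U)) :
    (f.app U₁).hom ∘ resHom W h₁ ∘ v =
      resHom W' (fun _ hz => h₁ hz : f ⁻¹ᵁ U₁ ≤ f ⁻¹ᵁ U) ∘ (f.app U).hom ∘ v := by
  funext i; simp [app_resHom]

lemma resHom_self {W : Scheme.{u}} {U : W.Opens} (h : U ≤ U) (s : Γ(W, U)) :
    resHom W h s = s := by
  change (W.presheaf.map (𝟙 _)) s = s
  simp

lemma matrix_resHom_self {W : Scheme.{u}} {U : W.Opens} (h : U ≤ U) (A : Matrix r c Γ(W, U)) :
    A.map (resHom W h) = A := by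
  ext i j; exact resHom_self h _

lemma vec_resHom_self {W : Scheme.{u}} {U : W.Opens} (h : U ≤ U) (v : r → Γ(W, U)) :
    resHom W h ∘ v = v := by
  funext i; exact resHom_self h _

variable (r c) in
/-- A locally trivialised quotient of rank `r` of `𝒪ᶜ` on `W`, with a section. -/
structure TauDatum (W : Scheme.{u}) : Type u where
  U : W → W.Opens
  mem : ∀ x, x ∈ U x
  A : ∀ x, Matrix r c Γ(W, U x)
  v : ∀ x, r → Γ(W, U x)
  epi : ∀ x, ∃ B : Matrix c r Γ(W, U x), A x * B = 1
  glue : ∀ (x y : W) (V : W.Opens) (hx : V ≤ U x) (hy : V ≤ U y),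
    SameQuot ((A x).map (resHom W hx)) ((A y).map (resHom W hy))
      (resHom W hx ∘ v x) (resHom W hy ∘ v y)

/-- Isomorphism of quotients that respects the sections, in terms of local trivialisations. -/
def TauDatum.Equiv {W : Scheme.{u}} (d d' : TauDatum r c W) : Prop :=
  ∀ (x y : W) (V : W.Opens) (hx : V ≤ d.U x) (hy : V ≤ d'.U y),
    SameQuot ((d.A x).map (resHom W hx)) ((d'.A y).map (resHom W hy))
      (resHom W hx ∘ d.v x) (resHom W hy ∘ d'.v y)

lemma TauDatum.Equiv.of_res {W : Scheme.{u}} {d d' : TauDatum r c W} (hU : ∀ y, d'.U y ≤ d.U y)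
    (hA : ∀ y, (d.A y).map (resHom W (hU y)) = d'.A y)
    (hv : ∀ y, resHom W (hU y) ∘ d.v y = d'.v y) : d.Equiv d' := by
  intro x y V hx hy
  have := d.glue x y V hx (hy.trans (hU y))
  rw [← hA, ← hv]
  convert this using 1
  · ext i j; simp [resHom_resHom]
  · funext i; simp [resHom_resHom]

/-- The set of zeros of the section. -/
def TauDatum.zero {W : Scheme.{u}} (d : TauDatum r c W) : Set W :=
  {x | ∀ i, x ∉ W.basicOpen (d.v x i)}

lemma TauDatum.zero_subset {W : Scheme.{u}} {d d' : TauDatum r c W}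
    (h : ∀ x : W, SameQuot ((d.A x).map (resHom W (inf_le_left : d.U x ⊓ d'.U x ≤ _)))
      ((d'.A x).map (resHom W (inf_le_right : d.U x ⊓ d'.U x ≤ _)))
      (resHom W inf_le_left ∘ d.v x) (resHom W inf_le_right ∘ d'.v x)) :
    d.zero ⊆ d'.zero := by
  intro x hx i
  obtain ⟨g, -, hg⟩ := h x
  have hm : x ∈ d.U x ⊓ d'.U x := ⟨d.mem x, d'.mem x⟩
  have key : ∀ {U : W.Opens} (hU : x ∈ U) (V : W.Opens) (hV : V ≤ U) (hm : x ∈ V) (s : Γ(W, U)),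
      x ∉ W.basicOpen s ↔ (W.evaluation V x hm).hom (resHom W hV s) = 0 := by
    intro U hU V hV hm s
    rw [Scheme.evaluation_eq_zero_iff_notMem_basicOpen]
    change _ ↔ x ∉ W.basicOpen ((W.presheaf.map (homOfLE hV).op) s)
    rw [Scheme.basicOpen_res]
    simp [hm]
  have hx' : ∀ j, (W.evaluation _ x hm).hom (resHom W inf_le_left (d.v x j)) = 0 :=
    fun j => (key (d.mem x) _ _ hm _).1 (hx j)
  rw [key (d'.mem x) _ inf_le_right hm]
  have := congrFun hg i
  simp only [Function.comp_apply] at this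
  rw [← this]
  simp only [Matrix.mulVec, dotProduct, map_sum, map_mul, Function.comp_apply, hx', mul_zero,
    Finset.sum_const_zero]

lemma SameQuot.symm {R : Type u} [CommRing R] {A A' : Matrix r c R} {v v' : r → R}
    (h : SameQuot A A' v v') : SameQuot A' A v' v := by
  obtain ⟨g, rfl, rfl⟩ := h
  refine ⟨g⁻¹, ?_, ?_⟩
  · rw [← Matrix.mul_assoc, ← Units.val_mul]; simp
  · rw [Matrix.mulVec_mulVec, ← Units.val_mul]; simp

lemma TauDatum.Equiv.zero_eq {W : Scheme.{u}} {d d' : TauDatum r c W} (h : d.Equiv d') :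
    d.zero = d'.zero :=
  Set.Subset.antisymm (TauDatum.zero_subset fun x => h x x _ _ _)
    (TauDatum.zero_subset fun x => (h x x _ _ _).symm)

variable (r c) in
/-- The set of morphisms from `W` to the total space of the tautological bundle. -/
def TauPt (W : Scheme.{u}) : Type u := Quot (TauDatum.Equiv (r := r) (c := c) (W := W))

/-- Pullback along a morphism of schemes. -/
def TauDatum.pull {W W' : Scheme.{u}} (f : W' ⟶ W) (d : TauDatum r c W) : TauDatum r c W' where
  U y := f ⁻¹ᵁ d.U (f y)
  mem y := d.mem (f y)
  A y := (d.A (f y)).map (f.app (d.U (f y))).hom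
  v y := (f.app (d.U (f y))).hom ∘ d.v (f y)
  epi y := by
    obtain ⟨B, hB⟩ := d.epi (f y)
    refine ⟨B.map (f.app (d.U (f y))).hom, ?_⟩
    rw [← Matrix.map_mul, hB]; simp
  glue x y V hx hy := by
    have h := (d.glue (f x) (f y) (d.U (f x) ⊓ d.U (f y)) inf_le_left inf_le_right).map
      (f.appLE (d.U (f x) ⊓ d.U (f y)) V (fun z hz => ⟨hx hz, hy hz⟩)).hom
    convert h using 1
    · exact matrix_appLE_resHom f _ _ _ _
    · exact matrix_appLE_resHom f _ _ _ _
    · exact vec_appLE_resHom f _ _ _ _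
    · exact vec_appLE_resHom f _ _ _ _

lemma TauDatum.Equiv.pull {W W' : Scheme.{u}} (f : W' ⟶ W) {d d' : TauDatum r c W}
    (h : d.Equiv d') : (d.pull f).Equiv (d'.pull f) := by
  intro x y V hx hy
  have h := (h (f x) (f y) (d.U (f x) ⊓ d'.U (f y)) inf_le_left inf_le_right).map
    (f.appLE (d.U (f x) ⊓ d'.U (f y)) V (fun z hz => ⟨hx hz, hy hz⟩)).hom
  convert h using 1
  · exact matrix_appLE_resHom f _ _ _ _
  · exact matrix_appLE_resHom f _ _ _ _
  · exact vec_appLE_resHom f _ _ _ _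
  · exact vec_appLE_resHom f _ _ _ _

lemma TauDatum.zero_pull {W W' : Scheme.{u}} (f : W' ⟶ W) (d : TauDatum r c W) :
    (d.pull f).zero = f ⁻¹' d.zero := by
  ext w
  refine forall_congr' fun i => not_congr ?_
  change _ ↔ w ∈ f ⁻¹ᵁ (W.basicOpen (d.v (f w) i))
  rw [Scheme.preimage_basicOpen]; rfl

variable (r c) in
/-- The total space of the tautological bundle of rank `r` over the Grassmannian of quotients of `𝒪ᶜ`,
with its zero section. -/
def tauSpace : FramingSpace.{u} where
  sec :=
    { obj := fun W => TauPt r c W.unop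
      map := fun f => TypeCat.ofHom (Quot.map (TauDatum.pull f.unop) fun _ _ h => h.pull f.unop)
      map_id := fun W => by
        ext φ
        obtain ⟨d, rfl⟩ := Quot.exists_rep φ
        refine Quot.sound (TauDatum.Equiv.of_res (fun y => le_rfl) ?_ ?_)
        · intro y; ext i j; exact (resHom_self _ _).trans rfl
        · intro y; funext i; exact (resHom_self _ _).trans rfl
      map_comp := fun f g => by
        ext φ
        obtain ⟨d, rfl⟩ := Quot.exists_rep φ
        refine Quot.sound (TauDatum.Equiv.of_res (fun y => le_rfl) ?_ ?_)
        · intro y; ext i j; exact resHom_self _ _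
        · intro y; funext i; exact resHom_self _ _ }
  zero {W} φ := Quot.lift (fun d : TauDatum r c W => d.zero) (fun _ _ h => h.zero_eq) φ
  zero_map f φ := by
    obtain ⟨d, rfl⟩ := Quot.exists_rep φ
    exact d.zero_pull f


lemma blockSum_res {W : Scheme.{u}} (er : r ⊕ r' ≃ r'') (ec : c ⊕ c' ≃ c'') {U U' O V : W.Opens}
    (A : Matrix r c Γ(W, U)) (B : Matrix r' c' Γ(W, U')) (h : O ≤ U) (h' : O ≤ U')
    (hV : V ≤ O) :
    (blockSum er ec (A.map (resHom W h)) (B.map (resHom W h'))).map (resHom W hV) =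
      blockSum er ec (A.map (resHom W (hV.trans h))) (B.map (resHom W (hV.trans h'))) := by
  ext i j
  obtain ⟨i, rfl⟩ := er.surjective i
  obtain ⟨j, rfl⟩ := ec.surjective j
  cases i <;> cases j <;> simp [resHom_resHom]

lemma vecSum_res {W : Scheme.{u}} (er : r ⊕ r' ≃ r'') {U U' O V : W.Opens}
    (v : r → Γ(W, U)) (w : r' → Γ(W, U')) (h : O ≤ U) (h' : O ≤ U') (hV : V ≤ O) :
    resHom W hV ∘ vecSum er (resHom W h ∘ v) (resHom W h' ∘ w) =
      vecSum er (resHom W (hV.trans h) ∘ v) (resHom W (hV.trans h') ∘ w) := by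
  funext i
  obtain ⟨i, rfl⟩ := er.surjective i
  cases i <;> simp [resHom_resHom]

/-- The trivial bundle with a tuple of functions as section. -/
def TauDatum.triv {W : Scheme.{u}} (φ : r → Γ(W, ⊤)) : TauDatum r r W where
  U _ := ⊤
  mem _ := trivial
  A _ := 1
  v _ := φ
  epi _ := ⟨1, by simp⟩
  glue _ _ _ _ _ := SameQuot.refl _ _

/-- Extension of the epimorphism by zero on additional coordinates. -/
def TauDatum.zeroCols {W : Scheme.{u}} (ec : c ⊕ c' ≃ c'') (d : TauDatum r c W) :
    TauDatum r c'' W where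
  U := d.U
  mem := d.mem
  A x := CobFr.zeroCols ec (d.A x)
  v := d.v
  epi x := by
    obtain ⟨B, hB⟩ := d.epi x
    refine ⟨Matrix.reindex ec (Equiv.refl r) (Matrix.fromRows B 0), ?_⟩
    simp only [CobFr.zeroCols, Matrix.reindex_apply, Matrix.submatrix_mul_equiv,
      Matrix.fromCols_mul_fromRows, hB]
    simp
  glue x y V hx hy := by
    convert (d.glue x y V hx hy).zeroCols ec using 1
    · ext i j
      obtain ⟨j, rfl⟩ := ec.surjective j
      cases j <;> simp
    · ext i j
      obtain ⟨j, rfl⟩ := ec.surjective j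
      cases j <;> simp

/-- Direct sum. -/
def TauDatum.sum {W : Scheme.{u}} (er : r ⊕ r' ≃ r'') (ec : c ⊕ c' ≃ c'')
    (d : TauDatum r c W) (d' : TauDatum r' c' W) : TauDatum r'' c'' W where
  U x := d.U x ⊓ d'.U x
  mem x := ⟨d.mem x, d'.mem x⟩
  A x := blockSum er ec ((d.A x).map (resHom W inf_le_left)) ((d'.A x).map (resHom W inf_le_right))
  v x := vecSum er (resHom W inf_le_left ∘ d.v x) (resHom W inf_le_right ∘ d'.v x)
  epi x := by
    obtain ⟨B, hB⟩ := d.epi x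
    obtain ⟨B', hB'⟩ := d'.epi x
    refine ⟨blockSum ec er (B.map (resHom W inf_le_left)) (B'.map (resHom W inf_le_right)), ?_⟩
    simp only [Matrix.reindex_apply, Matrix.submatrix_mul_equiv, Matrix.fromBlocks_multiply,
      ← Matrix.map_mul, hB, hB']
    simp
  glue x y V hx hy := by
    convert (d.glue x y V (hx.trans inf_le_left) (hy.trans inf_le_left)).sum er ec
      (d'.glue x y V (hx.trans inf_le_right) (hy.trans inf_le_right)) using 1
    · exact blockSum_res er ec _ _ _ _ _
    · exact blockSum_res er ec _ _ _ _ _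
    · exact vecSum_res er _ _ _ _ _
    · exact vecSum_res er _ _ _ _ _

lemma TauDatum.Equiv.zeroCols {W : Scheme.{u}} (ec : c ⊕ c' ≃ c'') {d e : TauDatum r c W}
    (h : d.Equiv e) : (d.zeroCols ec).Equiv (e.zeroCols ec) := by
  intro x y V hx hy
  have := (h x y V hx hy).zeroCols ec
  rw [← zeroCols_map, ← zeroCols_map] at this
  exact this

lemma TauDatum.Equiv.sum {W : Scheme.{u}} (er : r ⊕ r' ≃ r'') (ec : c ⊕ c' ≃ c'')
    {d e : TauDatum r c W} {d' e' : TauDatum r' c' W} (h : d.Equiv e) (h' : d'.Equiv e') :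
    (d.sum er ec d').Equiv (e.sum er ec e') := by
  intro x y V hx hy
  convert (h x y V (hx.trans inf_le_left) (hy.trans inf_le_left)).sum er ec
    (h' x y V (hx.trans inf_le_right) (hy.trans inf_le_right)) using 1
  · exact blockSum_res er ec _ _ _ _ _
  · exact blockSum_res er ec _ _ _ _ _
  · exact vecSum_res er _ _ _ _ _
  · exact vecSum_res er _ _ _ _ _

lemma TauDatum.Equiv.refl {W : Scheme.{u}} (d : TauDatum r c W) : d.Equiv d := d.glue

lemma not_mem_basicOpen_res {W : Scheme.{u}} {U V : W.Opens} (hV : V ≤ U) {x : W} (hx : x ∈ V)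
    (s : Γ(W, U)) : x ∉ W.basicOpen (resHom W hV s) ↔ x ∉ W.basicOpen s := by
  change x ∉ W.basicOpen ((W.presheaf.map (homOfLE hV).op) s) ↔ _
  rw [Scheme.basicOpen_res]
  simp [hx]

lemma TauDatum.zero_sum {W : Scheme.{u}} (er : r ⊕ r' ≃ r'') (ec : c ⊕ c' ≃ c'')
    (d : TauDatum r c W) (d' : TauDatum r' c' W) :
    (d.sum er ec d').zero = d.zero ∩ d'.zero := by
  ext x
  constructor
  · intro h
    refine ⟨fun i => ?_, fun i => ?_⟩
    · have := h (er (Sum.inl i))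
      simp only [TauDatum.sum, vecSum, Function.comp_apply, Equiv.symm_apply_apply,
        Sum.elim_inl] at this
      exact (not_mem_basicOpen_res _ (show x ∈ d.U x ⊓ d'.U x from ⟨d.mem x, d'.mem x⟩) _).1 this
    · have := h (er (Sum.inr i))
      simp only [TauDatum.sum, vecSum, Function.comp_apply, Equiv.symm_apply_apply,
        Sum.elim_inr] at this
      exact (not_mem_basicOpen_res _ (show x ∈ d.U x ⊓ d'.U x from ⟨d.mem x, d'.mem x⟩) _).1 this
  · rintro ⟨h, h'⟩ i
    obtain ⟨i, rfl⟩ := er.surjective i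
    cases i with
    | inl i =>
      simp only [TauDatum.sum, vecSum, Function.comp_apply, Equiv.symm_apply_apply, Sum.elim_inl]
      exact (not_mem_basicOpen_res _ (show x ∈ d.U x ⊓ d'.U x from ⟨d.mem x, d'.mem x⟩) _).2 (h i)
    | inr i =>
      simp only [TauDatum.sum, vecSum, Function.comp_apply, Equiv.symm_apply_apply, Sum.elim_inr]
      exact (not_mem_basicOpen_res _ (show x ∈ d.U x ⊓ d'.U x from ⟨d.mem x, d'.mem x⟩) _).2 (h' i)

/-- The isomorphism from `𝔸ʳ` to the total space of the tautological bundle over the Grassmannian of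
rank `r` quotients of `𝒪ʳ`, which is a point. -/
def tauTriv (r : Type) [Fintype r] [DecidableEq r] :
    FramingSpace.Hom.{u} (affineSpace r) (tauSpace r r) where
  hom :=
    { app := fun W => TypeCat.ofHom fun φ => Quot.mk _ (TauDatum.triv (W := W.unop) φ)
      naturality := fun W W' f => by
        ext φ
        refine Quot.sound (TauDatum.Equiv.of_res (fun y => le_rfl) ?_ ?_)
        · intro y
          refine (matrix_resHom_self _ _).trans ?_
          exact (Matrix.map_one (f.unop.app ⊤).hom (map_zero _) (map_one _)).symm
        · intro y; exact vec_resHom_self _ _ }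
  zero_hom _ := rfl

/-- `(𝒪ᶜ ↠ E, s) ↦ (𝒪ᶜ ⊕ 𝒪ᶜ' ↠ E, s)`, the epimorphism being zero on the added coordinates. -/
def tauZeroCols (r : Type) [Fintype r] [DecidableEq r] (ec : c ⊕ c' ≃ c'') :
    FramingSpace.Hom.{u} (tauSpace r c) (tauSpace r c'') where
  hom :=
    { app := fun W => TypeCat.ofHom (Quot.map (TauDatum.zeroCols ec) fun _ _ h => h.zeroCols ec)
      naturality := fun W W' f => by
        ext φ
        obtain ⟨d, rfl⟩ := Quot.exists_rep φ
        refine Quot.sound (TauDatum.Equiv.of_res (fun y => le_rfl) ?_ ?_)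
        · intro y
          refine (matrix_resHom_self _ _).trans ?_
          exact (zeroCols_map (f.unop.app (d.U (f.unop y))).hom ec (d.A (f.unop y))).symm
        · intro y; exact vec_resHom_self _ _ }
  zero_hom φ := by
    obtain ⟨d, rfl⟩ := Quot.exists_rep φ
    rfl

/-- `((p : 𝒪ᶜ ↠ E, s), (p' : 𝒪ᶜ' ↠ E', s')) ↦ (p ⊕ p', (s, s'))`, the coordinates of the sum being
reindexed along `er` and `ec`. -/
def tauSum (er : r ⊕ r' ≃ r'') (ec : c ⊕ c' ≃ c'') :
    FramingSpace.Pairing.{u} (tauSpace r c) (tauSpace r' c') (tauSpace r'' c'') where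
  hom :=
    { app := fun W => TypeCat.ofHom fun p =>
        Quot.map₂ (TauDatum.sum er ec) (fun _ _ _ h => (TauDatum.Equiv.refl _).sum er ec h)
          (fun _ _ _ h => h.sum er ec (TauDatum.Equiv.refl _)) p.1 p.2
      naturality := fun W W' f => by
        ext ⟨φ, ψ⟩
        obtain ⟨d, rfl⟩ := Quot.exists_rep φ
        obtain ⟨e, rfl⟩ := Quot.exists_rep ψ
        refine Quot.sound (TauDatum.Equiv.of_res (fun y => le_rfl) ?_ ?_)
        · intro y
          refine (matrix_resHom_self _ _).trans (Eq.symm ?_)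
          refine (blockSum_map (f.unop.app (d.U (f.unop y) ⊓ e.U (f.unop y))).hom er ec _ _).trans ?_
          rw [matrix_app_resHom, matrix_app_resHom]
          rfl
        · intro y
          refine (vec_resHom_self _ _).trans (Eq.symm ?_)
          refine (vecSum_map (f.unop.app (d.U (f.unop y) ⊓ e.U (f.unop y))).hom er _ _).trans ?_
          rw [vec_app_resHom, vec_app_resHom]
          rfl }
  zero_hom φ ψ := by
    obtain ⟨d, rfl⟩ := Quot.exists_rep φ
    obtain ⟨e, rfl⟩ := Quot.exists_rep ψ
    exact d.zero_sum er ec e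

/-- Concatenation of coordinates. -/
def affineSum (er : r ⊕ r' ≃ r'') :
    FramingSpace.Pairing.{u} (affineSpace r) (affineSpace r') (affineSpace r'') where
  hom :=
    { app := fun W => TypeCat.ofHom fun p => vecSum er p.1 p.2
      naturality := fun W W' f => by
        ext ⟨φ, ψ⟩
        exact (vecSum_map f.unop.appTop.hom er φ ψ).symm }
  zero_hom {W} φ ψ := by
    change {w | ∀ i, w ∉ W.basicOpen (vecSum er φ ψ i)} = {w | ∀ i, w ∉ W.basicOpen (φ i)} ∩
      {w | ∀ i, w ∉ W.basicOpen (ψ i)}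
    have h1 : ∀ i, vecSum er φ ψ (er (Sum.inl i)) = φ i := fun i => by
      simp only [vecSum, Function.comp_apply, Equiv.symm_apply_apply]
      rfl
    have h2 : ∀ i, vecSum er φ ψ (er (Sum.inr i)) = ψ i := fun i => by
      simp only [vecSum, Function.comp_apply, Equiv.symm_apply_apply]
      rfl
    ext x
    constructor
    · intro h
      exact ⟨fun i => h1 i ▸ h (er (Sum.inl i)), fun i => h2 i ▸ h (er (Sum.inr i))⟩
    · rintro ⟨h, h'⟩ i
      obtain ⟨i, rfl⟩ := er.surjective i
      cases i with
      | inl i => exact (h1 i).symm ▸ h i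
      | inr i => exact (h2 i).symm ▸ h' i

end Tau
/-- Schemes over a field `k`. -/
abbrev Sch (k : Type u) [Field k] : Type (u + 1) := Over (Spec (CommRingCat.of k))

/-- The affine space `𝔸ⁿ_X`. -/
abbrev Aff (n : ℕ) (X : Scheme.{u}) : Scheme.{u} := AffineSpace (ULift.{u} (Fin n)) X

/-- The projection `𝔸ⁿ_X ⟶ X`. -/
abbrev Aff.str (n : ℕ) (X : Scheme.{u}) : Aff n X ⟶ X := Aff n X ↘ X

/-- The `i`-th coordinate function on `𝔸ⁿ_X`. -/
abbrev Aff.coord {n : ℕ} (X : Scheme.{u}) (i : Fin n) : Γ(Aff n X, ⊤) :=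
  AffineSpace.coord X (ULift.up i)

/-- The morphism `T ⟶ 𝔸ⁿ_X` with prescribed base component and coordinates. -/
abbrev Aff.lift {n : ℕ} {X T : Scheme.{u}} (f : T ⟶ X) (v : Fin n → Γ(T, ⊤)) : T ⟶ Aff n X :=
  AffineSpace.homOfVector f (fun i => v i.down)

/-- A closed subset with its reduced induced subscheme structure. -/
abbrev redSub {A : Scheme.{u}} (Z : Closeds A) : Scheme.{u} :=
  (Scheme.IdealSheafData.vanishingIdeal Z).subscheme

abbrev redι {A : Scheme.{u}} (Z : Closeds A) : redSub Z ⟶ A :=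
  (Scheme.IdealSheafData.vanishingIdeal Z).subschemeι

/-- `e : W ⟶ A` is an étale neighbourhood of the closed subset `Z` of `A`. -/
structure IsEtaleNbhd {W A : Scheme.{u}} (e : W ⟶ A) (Z : Closeds A) : Prop where
  etale : Etale e
  iso : IsIso (pullback.snd e (redι Z))

lemma exists_redMap {A A' : Scheme.{u}} (p : A' ⟶ A) (Z : Closeds A) (Z' : Closeds A')
    (h : ∀ x ∈ Z', p x ∈ Z) : ∃ r : redSub Z' ⟶ redSub Z, r ≫ redι Z = redι Z' ≫ p := by
  have H : Scheme.IdealSheafData.vanishingIdeal Z ≤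
      (Scheme.IdealSheafData.vanishingIdeal Z').map p := by
    rw [Scheme.IdealSheafData.map_vanishingIdeal]
    apply Scheme.IdealSheafData.vanishingIdeal_antimono
    rw [TopologicalSpace.Closeds.closure_le]
    rintro _ ⟨x, hx, rfl⟩
    exact h x hx
  exact ⟨_, Scheme.IdealSheafData.subschemeMap_subschemeι _ _ p H⟩

lemma IsEtaleNbhd.pullback {W A A' : Scheme.{u}} {e : W ⟶ A} {Z : Closeds A}
    (he : IsEtaleNbhd e Z) (p : A' ⟶ A) (Z' : Closeds A') (h : ∀ x ∈ Z', p x ∈ Z) :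
    IsEtaleNbhd (pullback.snd e p) Z' := by
  obtain ⟨r, hr⟩ := exists_redMap p Z Z' h
  have := he.etale
  have := he.iso
  refine ⟨inferInstance, ?_⟩
  have s1 := (IsPullback.of_hasPullback (pullback.snd e p) (redι Z')).flip.paste_vert
    (IsPullback.of_hasPullback e p).flip
  have s2 := IsPullback.of_hasPullback e (redι Z)
  have s1' := s1.flip
  rw [← hr] at s1'
  exact (s1'.of_right' s2).isIso_snd_of_isIso this

lemma IsEtaleNbhd.inter {W₁ W₂ A : Scheme.{u}} {e₁ : W₁ ⟶ A} {e₂ : W₂ ⟶ A} {Z : Closeds A}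
    (h₁ : IsEtaleNbhd e₁ Z) (h₂ : IsEtaleNbhd e₂ Z) :
    IsEtaleNbhd (pullback.snd e₁ e₂ ≫ e₂) Z := by
  have := h₁.etale
  have := h₂.etale
  have i₁ := h₁.iso
  have i₂ := h₂.iso
  refine ⟨inferInstance, ?_⟩
  have a := IsPullback.of_hasPullback (pullback.snd e₁ e₂) (pullback.fst e₂ (redι Z))
  have b := (a.flip.paste_vert (IsPullback.of_hasPullback e₁ e₂).flip).flip
  rw [pullback.condition] at b
  have hs : IsIso (pullback.snd (pullback.snd e₁ e₂) (pullback.fst e₂ (redι Z))) :=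
    (b.of_right' (IsPullback.of_hasPullback e₁ (redι Z))).isIso_snd_of_isIso i₁
  have d := a.paste_vert (IsPullback.of_hasPullback e₂ (redι Z))
  have e : CategoryTheory.Limits.pullback.snd (CategoryTheory.Limits.pullback.snd e₁ e₂ ≫ e₂)
      (redι Z) = (IsPullback.isoIsPullback _ _ (IsPullback.of_hasPullback _ _) d).hom ≫
      (CategoryTheory.Limits.pullback.snd (CategoryTheory.Limits.pullback.snd e₁ e₂)
        (CategoryTheory.Limits.pullback.fst e₂ (redι Z)) ≫
        CategoryTheory.Limits.pullback.snd e₂ (redι Z)) := by simp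
  rw [e]
  infer_instance

lemma isFinite_of_coords {n : ℕ} {T Q : Scheme.{u}} (Z : Closeds (Aff n T)) (q : Q ⟶ T)
    [IsFinite q] (r : redSub Z ⟶ Q) (hr : r ≫ q = redι Z ≫ Aff.str n T)
    (y : Fin n → Γ(Q, ⊤)) (hy : ∀ i, r.appTop (y i) = (redι Z).appTop (Aff.coord T i)) :
    IsFinite (redι Z ≫ Aff.str n T) := by
  have hs : r ≫ Aff.lift q y = redι Z := by
    refine AffineSpace.hom_ext ?_ fun i => ?_
    · simpa using hr
    · rw [Scheme.Hom.comp_appTop, CommRingCat.comp_apply, AffineSpace.homOfVector_appTop_coord]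
      exact hy i.down
  have : IsSeparated (Aff.lift q y ≫ Aff.str n T) := by
    rw [AffineSpace.homOfVector_over]; infer_instance
  have : IsSeparated (Aff.lift q y) := IsSeparated.of_comp _ (Aff.str n T)
  have : IsClosedImmersion (r ≫ Aff.lift q y) := by rw [hs]; infer_instance
  have : IsClosedImmersion r := IsClosedImmersion.of_comp r (Aff.lift q y)
  rw [← hr]
  infer_instance

lemma redι_appTop_eq_zero {A : Scheme.{u}} (Z : Closeds A) (f : Γ(A, ⊤))
    (h : ∀ x ∈ Z, x ∉ A.basicOpen f) : (redι Z).appTop f = 0 := by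
  have key : ∀ U : A.affineOpens, (redι Z).app U.1 (A.presheaf.map (homOfLE le_top).op f) = 0 := by
    intro U
    have := (Scheme.IdealSheafData.vanishingIdeal Z).ker_subschemeι_app U
    rw [← RingHom.mem_ker, this]
    refine (PrimeSpectrum.mem_vanishingIdeal _ _).2 fun p hp => ?_
    have h1 := h _ hp
    by_contra h2
    apply h1
    have h3 : p ∈ U.2.fromSpec ⁻¹ᵁ A.basicOpen (A.presheaf.map (homOfLE le_top : U.1 ⟶ ⊤).op f) := by
      rw [U.2.fromSpec_preimage_basicOpen]
      exact h2
    rw [Scheme.basicOpen_res] at h3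
    exact h3.2
  refine TopCat.Sheaf.eq_of_locally_eq' (redSub Z).sheaf (fun U : A.affineOpens => redι Z ⁻¹ᵁ U.1) ⊤
    (fun U => homOfLE le_top) ?_ _ _ ?_
  · rw [← Scheme.Hom.preimage_iSup, iSup_affineOpens_eq_top]; rfl
  · intro U
    refine Eq.trans ?_ (map_zero ((redSub Z).presheaf.map
      (homOfLE le_top : redι Z ⁻¹ᵁ U.1 ⟶ ⊤).op).hom).symm
    refine Eq.trans ?_ (key U)
    exact (congr($((redι Z).naturality (homOfLE le_top : U.1 ⟶ ⊤).op) f)).symm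

variable {k : Type u} [Field k]

/-- An explicit correspondence of level `n` from `X` to the presheaf `Y`, framed by sections of `𝓕`. -/
structure ExplicitCorr (n : ℕ) (𝓕 : FramingSpace.{u}) (X : Sch k) (Y : (Sch k)ᵒᵖ ⥤ Type u) :
    Type (u + 1) where
  /-- The support. -/
  Z : Closeds (Aff n X.left)
  finite : IsFinite (redι Z ≫ Aff.str n X.left)
  W : Scheme.{u}
  e : W ⟶ Aff n X.left
  nbhd : IsEtaleNbhd e Z
  φ : 𝓕.sec.obj (op W)
  zero_eq : 𝓕.zero φ = e ⁻¹' Z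
  g : Y.obj (op (Over.mk (e ≫ Aff.str n X.left ≫ X.hom)))

namespace ExplicitCorr

variable {n n' : ℕ} {𝓕 𝓖 𝓗 : FramingSpace.{u}} {X T : Sch k} {Y Y' : (Sch k)ᵒᵖ ⥤ Type u}

/-- `W`, viewed as a scheme over `k`. -/
abbrev dom (c : ExplicitCorr n 𝓕 X Y) : Sch k := Over.mk (c.e ≫ Aff.str n X.left ≫ X.hom)

/-- Equivalence through a common refinement. -/
def Rel (c c' : ExplicitCorr n 𝓕 X Y) : Prop :=
  c.Z = c'.Z ∧ ∃ (V : Scheme.{u}) (i : V ⟶ c.W) (i' : V ⟶ c'.W) (h : i' ≫ c'.e = i ≫ c.e),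
    IsEtaleNbhd (i ≫ c.e) c.Z ∧
    𝓕.sec.map i.op c.φ = 𝓕.sec.map i'.op c'.φ ∧
    Y.map (Over.homMk i : Over.mk ((i ≫ c.e) ≫ Aff.str n X.left ≫ X.hom) ⟶ c.dom).op c.g =
      Y.map (Over.homMk i' (by simp [reassoc_of% h]) :
        Over.mk ((i ≫ c.e) ≫ Aff.str n X.left ≫ X.hom) ⟶ c'.dom).op c'.g

/-- Postcomposition with a morphism of presheaves. -/
def push (c : ExplicitCorr n 𝓕 X Y) (h : Y ⟶ Y') : ExplicitCorr n 𝓕 X Y' :=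
  { c with g := h.app _ c.g }

/-- Composition of the framing with a morphism of framing spaces. -/
def reframe (c : ExplicitCorr n 𝓕 X Y) (η : 𝓕.Hom 𝓖) : ExplicitCorr n 𝓖 X Y :=
  { c with
    φ := η.hom.app _ c.φ
    zero_eq := (η.zero_hom _).trans c.zero_eq }

/-- Pullback along a morphism of `k`-schemes in the first variable. -/
def pull (c : ExplicitCorr n 𝓕 X Y) (a : T ⟶ X) : ExplicitCorr n 𝓕 T Y where
  Z := c.Z.preimage (AffineSpace.map (ULift.{u} (Fin n)) a.left).continuous
  finite := by
    set p := AffineSpace.map (ULift.{u} (Fin n)) a.left with hp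
    set Z' := c.Z.preimage p.continuous
    obtain ⟨r, hr⟩ := exists_redMap p c.Z Z' (fun x hx => hx)
    have := c.finite
    refine isFinite_of_coords Z' (pullback.snd (redι c.Z ≫ Aff.str n X.left) a.left)
      (pullback.lift r (redι Z' ≫ Aff.str n T.left) ?_) (pullback.lift_snd _ _ _)
      (fun i => (pullback.fst (redι c.Z ≫ Aff.str n X.left) a.left).appTop
        ((redι c.Z).appTop (Aff.coord _ i))) ?_
    · rw [reassoc_of% hr, hp, AffineSpace.map_over, Category.assoc]
    · intro i
      rw [← CommRingCat.comp_apply, ← CommRingCat.comp_apply, ← Scheme.Hom.comp_appTop,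
        ← Scheme.Hom.comp_appTop, pullback.lift_fst, hr, Scheme.Hom.comp_appTop,
        CommRingCat.comp_apply, hp, AffineSpace.map_appTop_coord]
  W := pullback c.e (AffineSpace.map (ULift.{u} (Fin n)) a.left)
  e := pullback.snd c.e (AffineSpace.map (ULift.{u} (Fin n)) a.left)
  nbhd := c.nbhd.pullback _ _ (fun x hx => hx)
  φ := 𝓕.sec.map (pullback.fst c.e (AffineSpace.map (ULift.{u} (Fin n)) a.left)).op c.φ
  zero_eq := by
    rw [𝓕.zero_map, c.zero_eq]
    change (pullback.fst c.e _ ≫ c.e) ⁻¹' _ = (pullback.snd c.e _ ≫ AffineSpace.map _ a.left) ⁻¹' _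
    rw [pullback.condition]
    rfl
  g := Y.map (Over.homMk (U := Over.mk (pullback.snd c.e (AffineSpace.map (ULift.{u} (Fin n)) a.left)
      ≫ Aff.str n T.left ≫ T.hom)) (V := c.dom)
    (pullback.fst c.e (AffineSpace.map (ULift.{u} (Fin n)) a.left)) (by
      simp [pullback.condition_assoc])).op c.g

/-- The projection of `𝔸ⁿ⁺ⁿ'` to the first `n` coordinates. -/
abbrev projL (n n' : ℕ) (B : Scheme.{u}) : Aff (n + n') B ⟶ Aff n B :=
  AffineSpace.reindex (fun i => ULift.up (Fin.castAdd n' i.down)) B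

/-- The projection of `𝔸ⁿ⁺ⁿ'` to the last `n'` coordinates. -/
abbrev projR (n n' : ℕ) (B : Scheme.{u}) : Aff (n + n') B ⟶ Aff n' B :=
  AffineSpace.reindex (fun i => ULift.up (Fin.natAdd n i.down)) B

/-- The product `(Z × Z', W × W', μ(φ, φ'), g × g')`, all products being formed over the base `X`.
For `X = Spec k` this is the external product. -/
def prod (c : ExplicitCorr n 𝓕 X Y) (c' : ExplicitCorr n' 𝓖 X Y') (μ : 𝓕.Pairing 𝓖 𝓗) :
    ExplicitCorr (n + n') 𝓗 X (FunctorToTypes.prod Y Y') where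
  Z := c.Z.preimage (projL n n' X.left).continuous ⊓ c'.Z.preimage (projR n n' X.left).continuous
  finite := by
    set p := projL n n' X.left with hp
    set q := projR n n' X.left with hq
    set Z' := c.Z.preimage p.continuous ⊓ c'.Z.preimage q.continuous
    obtain ⟨r, hr⟩ := exists_redMap p c.Z Z' (fun x hx => hx.1)
    obtain ⟨s, hs⟩ := exists_redMap q c'.Z Z' (fun x hx => hx.2)
    have := c.finite
    have := c'.finite
    have hpr : p ≫ Aff.str n X.left = Aff.str (n + n') X.left := AffineSpace.reindex_over _ _
    have hqr : q ≫ Aff.str n' X.left = Aff.str (n + n') X.left := AffineSpace.reindex_over _ _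
    refine isFinite_of_coords Z'
      (pullback.fst (redι c.Z ≫ Aff.str n X.left) (redι c'.Z ≫ Aff.str n' X.left) ≫
        (redι c.Z ≫ Aff.str n X.left))
      (pullback.lift r s ?_) ?_
      (Fin.addCases
        (fun i => (pullback.fst (redι c.Z ≫ Aff.str n X.left)
          (redι c'.Z ≫ Aff.str n' X.left)).appTop ((redι c.Z).appTop (Aff.coord _ i)))
        (fun i => (pullback.snd (redι c.Z ≫ Aff.str n X.left)
          (redι c'.Z ≫ Aff.str n' X.left)).appTop ((redι c'.Z).appTop (Aff.coord _ i)))) ?_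
    · rw [reassoc_of% hr, reassoc_of% hs, hpr, hqr]
    · rw [pullback.lift_fst_assoc, reassoc_of% hr, hpr]
    · intro i
      refine Fin.addCases (fun i => ?_) (fun i => ?_) i
      · rw [Fin.addCases_left, ← CommRingCat.comp_apply, ← CommRingCat.comp_apply,
          ← Scheme.Hom.comp_appTop, ← Scheme.Hom.comp_appTop, pullback.lift_fst, hr,
          Scheme.Hom.comp_appTop, CommRingCat.comp_apply, hp, AffineSpace.reindex_appTop_coord]
      · rw [Fin.addCases_right, ← CommRingCat.comp_apply, ← CommRingCat.comp_apply,
          ← Scheme.Hom.comp_appTop, ← Scheme.Hom.comp_appTop, pullback.lift_snd, hs,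
          Scheme.Hom.comp_appTop, CommRingCat.comp_apply, hq, AffineSpace.reindex_appTop_coord]
  W := pullback (pullback.snd c.e (projL n n' X.left)) (pullback.snd c'.e (projR n n' X.left))
  e := pullback.snd (pullback.snd c.e (projL n n' X.left)) (pullback.snd c'.e (projR n n' X.left)) ≫
    pullback.snd c'.e (projR n n' X.left)
  nbhd := by
    refine (c.nbhd.pullback _ _ ?_).inter (c'.nbhd.pullback _ _ ?_)
    · exact fun _ hx => hx.1
    · exact fun _ hx => hx.2
  φ := μ.hom.app _
    (𝓕.sec.map (pullback.fst _ _ ≫ pullback.fst c.e (projL n n' X.left)).op c.φ,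
      𝓖.sec.map (pullback.snd _ _ ≫ pullback.fst c'.e (projR n n' X.left)).op c'.φ)
  zero_eq := by
    rw [μ.zero_hom, 𝓕.zero_map, 𝓖.zero_map, c.zero_eq, c'.zero_eq]
    change ((pullback.fst _ _ ≫ pullback.fst c.e _) ≫ c.e) ⁻¹' _ ∩
      ((pullback.snd _ _ ≫ pullback.fst c'.e _) ≫ c'.e) ⁻¹' _ = _
    rw [Category.assoc, Category.assoc, pullback.condition, pullback.condition,
      pullback.condition_assoc]
    rfl
  g := (Y.map (Over.homMk (U := Over.mk ((pullback.snd (pullback.snd c.e (projL n n' X.left))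
        (pullback.snd c'.e (projR n n' X.left)) ≫ pullback.snd c'.e (projR n n' X.left)) ≫
        Aff.str (n + n') X.left ≫ X.hom)) (V := c.dom)
      (pullback.fst _ _ ≫ pullback.fst c.e (projL n n' X.left))
      (by
        have := AffineSpace.reindex_over (S := X.left)
          (fun i : ULift.{u} (Fin n) => ULift.up.{u} (Fin.castAdd n' i.down))
        simp only [Over.mk_hom, Category.assoc]
        rw [pullback.condition_assoc, reassoc_of% this, pullback.condition_assoc])).op c.g,
    Y'.map (Over.homMk (U := Over.mk ((pullback.snd (pullback.snd c.e (projL n n' X.left))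
        (pullback.snd c'.e (projR n n' X.left)) ≫ pullback.snd c'.e (projR n n' X.left)) ≫
        Aff.str (n + n') X.left ≫ X.hom)) (V := c'.dom)
      (pullback.snd _ _ ≫ pullback.fst c'.e (projR n n' X.left))
      (by
        have := AffineSpace.reindex_over (S := X.left)
          (fun i : ULift.{u} (Fin n') => ULift.up.{u} (Fin.natAdd n i.down))
        simp only [Over.mk_hom, Category.assoc]
        rw [pullback.condition_assoc, reassoc_of% this])).op c'.g)

/-- Stabilisation: `(0 × Z, 𝔸¹ × W, σ(x, φ), g)`, where `x` is the coordinate on `𝔸¹`. -/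
def susp (c : ExplicitCorr n 𝓕 X Y) (σ : (affineSpace (Fin 1)).Pairing 𝓕 𝓖) :
    ExplicitCorr (1 + n) 𝓖 X Y where
  Z := ⟨{x | x ∉ (Aff (1 + n) X.left).basicOpen (Aff.coord X.left (Fin.castAdd n 0))},
      ((Aff (1 + n) X.left).basicOpen _).isOpen.isClosed_compl⟩ ⊓
    c.Z.preimage (projR 1 n X.left).continuous
  finite := by
    set q := projR 1 n X.left with hq
    set Z' : Closeds (Aff (1 + n) X.left) :=
      ⟨{x | x ∉ (Aff (1 + n) X.left).basicOpen (Aff.coord X.left (Fin.castAdd n 0))},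
        ((Aff (1 + n) X.left).basicOpen _).isOpen.isClosed_compl⟩ ⊓
      c.Z.preimage q.continuous
    obtain ⟨s, hs⟩ := exists_redMap q c.Z Z' (fun x hx => hx.2)
    have := c.finite
    have hqr : q ≫ Aff.str n X.left = Aff.str (1 + n) X.left := AffineSpace.reindex_over _ _
    refine isFinite_of_coords Z' (redι c.Z ≫ Aff.str n X.left) s ?_
      (Fin.addCases (fun _ => 0) (fun i => (redι c.Z).appTop (Aff.coord _ i))) ?_
    · rw [reassoc_of% hs, hqr]
    · intro i
      refine Fin.addCases (fun i => ?_) (fun i => ?_) i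
      · rw [Fin.addCases_left, map_zero, redι_appTop_eq_zero]
        intro x hx
        rw [Subsingleton.elim i 0]
        exact hx.1
      · rw [Fin.addCases_right, ← CommRingCat.comp_apply,
          ← Scheme.Hom.comp_appTop, hs,
          Scheme.Hom.comp_appTop, CommRingCat.comp_apply, hq, AffineSpace.reindex_appTop_coord]
  W := pullback c.e (projR 1 n X.left)
  e := pullback.snd c.e (projR 1 n X.left)
  nbhd := c.nbhd.pullback _ _ (fun _ hx => hx.2)
  φ := σ.hom.app _
    (fun _ => (pullback.snd c.e (projR 1 n X.left)).appTop (Aff.coord X.left (Fin.castAdd n 0)),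
      𝓕.sec.map (pullback.fst c.e (projR 1 n X.left)).op c.φ)
  zero_eq := by
    refine (σ.zero_hom _ _).trans ?_
    rw [𝓕.zero_map, c.zero_eq]
    change _ ∩ (pullback.fst c.e _ ≫ c.e) ⁻¹' _ = _
    rw [pullback.condition]
    refine congrArg₂ (· ∩ ·) ?_ rfl
    ext w
    change (∀ _ : Fin 1, w ∉ _) ↔ w ∉ (pullback.snd c.e (projR 1 n X.left)) ⁻¹ᵁ
      ((Aff (1 + n) X.left).basicOpen (Aff.coord X.left (Fin.castAdd n 0)))
    rw [Scheme.preimage_basicOpen]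
    exact ⟨fun h => h 0, fun h _ => h⟩
  g := Y.map (Over.homMk (U := Over.mk (pullback.snd c.e (projR 1 n X.left) ≫
        Aff.str (1 + n) X.left ≫ X.hom)) (V := c.dom) (pullback.fst c.e (projR 1 n X.left))
      (by
        have := AffineSpace.reindex_over (S := X.left)
          (fun i : ULift.{u} (Fin n) => ULift.up.{u} (Fin.natAdd 1 i.down))
        simp only [Over.mk_hom]
        rw [pullback.condition_assoc, reassoc_of% this])).op c.g

/-- The correspondence of level `0` given by a section `s` of `Y` over `X`. -/
def ofSection (s : Y.obj (op X)) (z : 𝓕.sec.obj (op (Aff 0 X.left))) (hz : 𝓕.zero z = Set.univ) :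
    ExplicitCorr 0 𝓕 X Y where
  Z := ⊤
  finite := by
    have : IsIso (Aff.str 0 X.left) := inferInstance
    infer_instance
  W := Aff 0 X.left
  e := 𝟙 _
  nbhd := ⟨inferInstance, inferInstance⟩
  φ := z
  zero_eq := hz
  g := Y.map (Over.homMk (U := Over.mk (𝟙 _ ≫ Aff.str 0 X.left ≫ X.hom)) (V := X)
    (Aff.str 0 X.left)).op s

/-- `c` is the sum of `c₁` and `c₂`: the supports are disjoint with union the support of `c`, and the
data of `c` restrict to those of `c₁` and `c₂` along morphisms of the neighbourhoods. -/
def IsDisjointSum (c c₁ c₂ : ExplicitCorr n 𝓕 X Y) : Prop :=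
  Disjoint c₁.Z c₂.Z ∧ c.Z = c₁.Z ⊔ c₂.Z ∧
    ∀ d ∈ [c₁, c₂], ∃ (i : d.W ⟶ c.W) (h : i ≫ c.e = d.e),
      𝓕.sec.map i.op c.φ = d.φ ∧
      Y.map (Over.homMk i (by simp [reassoc_of% h]) : d.dom ⟶ c.dom).op c.g = d.g

end ExplicitCorr
/-- A system of framing spaces indexed by a rank `n` and an auxiliary index, with the operations on
them that stabilise and multiply correspondences. -/
structure FramingTheory : Type (u + 1) where
  /-- The values of the auxiliary index. -/
  Idx : Type
  space : ℕ → Idx → FramingSpace.{u}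
  next : Idx → Idx
  zeroIdx : Idx
  addIdx : Idx → Idx → Idx
  /-- Stabilisation in the auxiliary index. -/
  incl : ∀ n i, (space n i).Hom (space n (next i))
  /-- Stabilisation in the rank: `(x, φ) ↦ x ⊕ φ`. -/
  susp : ∀ n i, (affineSpace (Fin 1)).Pairing (space n i) (space (1 + n) i)
  /-- The direct sum used for the external product. -/
  sum : ∀ n i n' i', (space n i).Pairing (space n' i') (space (n + n') (addIdx i i'))
  /-- The framing of level `0`. -/
  origin : ∀ W : Scheme.{u}, (space 0 zeroIdx).sec.obj (op W)
  zero_origin : ∀ W : Scheme.{u}, (space 0 zeroIdx).zero (origin W) = Set.univ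

/-- Framings by morphisms to `𝔸ⁿ`. -/
def framed : FramingTheory.{u} where
  Idx := Unit
  space n _ := affineSpace (Fin n)
  next i := i
  zeroIdx := ()
  addIdx _ _ := ()
  incl _ _ := FramingSpace.Hom.id _
  susp _ _ := affineSum finSumFinEquiv
  sum _ _ _ _ := affineSum finSumFinEquiv
  origin W := (Fin.elim0 : Fin 0 → Γ(W, ⊤))
  zero_origin _ := Set.eq_univ_of_forall fun _ i => i.elim0

/-- The total space of the tautological bundle over the Grassmannian of rank `n` quotients of
`𝒪ⁿ⁺ᴺ`. -/
abbrev tau (n N : ℕ) : FramingSpace.{u} := tauSpace (Fin n) (Fin n ⊕ Fin N)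

/-- The inclusion of `𝔸ⁿ` as the fibre over the projection to the first `n` coordinates. -/
def cobMap (n N : ℕ) : FramingSpace.Hom.{u} (affineSpace (Fin n)) (tau n N) :=
  (tauTriv (Fin n)).comp (tauZeroCols (Fin n) (Equiv.refl (Fin n ⊕ Fin N)))

/-- Framings by morphisms to the total spaces of the tautological bundles. -/
def cobordism : FramingTheory.{u} where
  Idx := ℕ
  space n N := tau n N
  next N := N + 1
  zeroIdx := 0
  addIdx N N' := N + N'
  incl n N := tauZeroCols (Fin n) ((Equiv.sumAssoc (Fin n) (Fin N) (Fin 1)).trans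
    (Equiv.sumCongr (Equiv.refl _) finSumFinEquiv))
  susp n N := (tauSum finSumFinEquiv ((Equiv.sumAssoc (Fin 1) (Fin n) (Fin N)).symm.trans
    (Equiv.sumCongr finSumFinEquiv (Equiv.refl _)))).compLeft (tauTriv (Fin 1))
  sum n N n' N' := tauSum finSumFinEquiv
    ((Equiv.sumSumSumComm (Fin n) (Fin N) (Fin n') (Fin N')).trans
      (Equiv.sumCongr finSumFinEquiv finSumFinEquiv))
  origin W := (cobMap 0 0).hom.app (op W) (Fin.elim0 : Fin 0 → Γ(W, ⊤))
  zero_origin _ := ((cobMap 0 0).zero_hom _).trans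
    (Set.eq_univ_of_forall fun _ i => i.elim0)

variable {k : Type u} [Field k] (𝔖 : FramingTheory.{u})

/-- Explicit correspondences of all levels. -/
abbrev AnyLevel (X : Sch k) (Y : (Sch k)ᵒᵖ ⥤ Type u) : Type (u + 1) :=
  Σ l : ℕ × 𝔖.Idx, ExplicitCorr l.1 (𝔖.space l.1 l.2) X Y

/-- The relations defining stable correspondences: equivalence at a fixed level, and the
stabilisations along both indices. -/
inductive Step (X : Sch k) (Y : (Sch k)ᵒᵖ ⥤ Type u) : AnyLevel 𝔖 X Y → AnyLevel 𝔖 X Y → Prop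
  | rel (l : ℕ × 𝔖.Idx) (c c' : ExplicitCorr l.1 (𝔖.space l.1 l.2) X Y) (h : c.Rel c') :
      Step X Y ⟨l, c⟩ ⟨l, c'⟩
  | susp (l : ℕ × 𝔖.Idx) (c : ExplicitCorr l.1 (𝔖.space l.1 l.2) X Y) :
      Step X Y ⟨l, c⟩ ⟨(1 + l.1, l.2), c.susp (𝔖.susp l.1 l.2)⟩
  | incl (l : ℕ × 𝔖.Idx) (c : ExplicitCorr l.1 (𝔖.space l.1 l.2) X Y) :
      Step X Y ⟨l, c⟩ ⟨(l.1, 𝔖.next l.2), c.reframe (𝔖.incl l.1 l.2)⟩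

/-- Stable correspondences. -/
def Stable (X : Sch k) (Y : (Sch k)ᵒᵖ ⥤ Type u) : Type (u + 1) := Quot (Step 𝔖 X Y)

def Stable.mk {X : Sch k} {Y : (Sch k)ᵒᵖ ⥤ Type u} {n : ℕ} {i : 𝔖.Idx}
    (c : ExplicitCorr n (𝔖.space n i) X Y) : Stable 𝔖 X Y := Quot.mk _ ⟨(n, i), c⟩

def Stable.lift {X : Sch k} {Y : (Sch k)ᵒᵖ ⥤ Type u} {A : Type*} (f : AnyLevel 𝔖 X Y → A)
    (h : ∀ c c', Step 𝔖 X Y c c' → f c = f c') : Stable 𝔖 X Y → A := Quot.lift f h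

/-- The additivity relations. -/
def addRel (X : Sch k) (Y : (Sch k)ᵒᵖ ⥤ Type u) : AddSubgroup (FreeAbelianGroup (Stable 𝔖 X Y)) :=
  AddSubgroup.closure {x | ∃ (n : ℕ) (i : 𝔖.Idx) (c c₁ c₂ : ExplicitCorr n (𝔖.space n i) X Y),
    c.IsDisjointSum c₁ c₂ ∧ x = .of (Stable.mk 𝔖 c) - (.of (Stable.mk 𝔖 c₁) + .of (Stable.mk 𝔖 c₂))}

/-- Linear stable correspondences. -/
abbrev ZF (X : Sch k) (Y : (Sch k)ᵒᵖ ⥤ Type u) : Type (u + 1) :=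
  FreeAbelianGroup (Stable 𝔖 X Y) ⧸ addRel 𝔖 X Y

def ZF.mk {X : Sch k} {Y : (Sch k)ᵒᵖ ⥤ Type u} {n : ℕ} {i : 𝔖.Idx}
    (c : ExplicitCorr n (𝔖.space n i) X Y) : ZF 𝔖 X Y :=
  QuotientAddGroup.mk (.of (Stable.mk 𝔖 c))

/-- The product of `X` with the affine line (which is the algebraic simplex of dimension `1`). -/
def line (X : Sch k) : Sch k := Over.mk (Aff.str 1 X.left ≫ X.hom)

/-- The section of `line X` with constant coordinate `t`. -/
def lineAt (X : Sch k) (t : ℤ) : X ⟶ line X :=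
  Over.homMk (Aff.lift (𝟙 X.left) (fun _ => (t : Γ(X.left, ⊤)))) (by
    simp [line])

/-- The image of the differential `ZF(Δ¹ × X, Y) ⟶ ZF(X, Y)`, which is the difference of the
restrictions to the two vertices. -/
def homotopyRel (X : Sch k) (Y : (Sch k)ᵒᵖ ⥤ Type u) : AddSubgroup (ZF 𝔖 X Y) :=
  AddSubgroup.closure {x | ∃ (n : ℕ) (i : 𝔖.Idx) (c : ExplicitCorr n (𝔖.space n i) (line X) Y),
    x = ZF.mk 𝔖 (c.pull (lineAt X 0)) - ZF.mk 𝔖 (c.pull (lineAt X 1))}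

/-- The group `H⁰(C_* ZF(X, Y))`. -/
abbrev H0 (X : Sch k) (Y : (Sch k)ᵒᵖ ⥤ Type u) : Type (u + 1) := ZF 𝔖 X Y ⧸ homotopyRel 𝔖 X Y

namespace H0

variable {X : Sch k} {Y Y' : (Sch k)ᵒᵖ ⥤ Type u}

/-- The class of an explicit correspondence. -/
def mk {n : ℕ} {i : 𝔖.Idx} (c : ExplicitCorr n (𝔖.space n i) X Y) : H0 𝔖 X Y :=
  QuotientAddGroup.mk (ZF.mk 𝔖 c)

variable {𝔖}

lemma mk_rel {n : ℕ} {i : 𝔖.Idx} {c c' : ExplicitCorr n (𝔖.space n i) X Y} (h : c.Rel c') :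
    mk 𝔖 c = mk 𝔖 c' :=
  congrArg (fun s => (QuotientAddGroup.mk (QuotientAddGroup.mk (.of s) : ZF 𝔖 X Y) : H0 𝔖 X Y))
    (Quot.sound (Step.rel (n, i) c c' h))

lemma mk_susp {n : ℕ} {i : 𝔖.Idx} (c : ExplicitCorr n (𝔖.space n i) X Y) :
    mk 𝔖 (c.susp (𝔖.susp n i)) = mk 𝔖 c :=
  congrArg (fun s => (QuotientAddGroup.mk (QuotientAddGroup.mk (.of s) : ZF 𝔖 X Y) : H0 𝔖 X Y))
    (Quot.sound (Step.susp (n, i) c)).symm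

lemma mk_incl {n : ℕ} {i : 𝔖.Idx} (c : ExplicitCorr n (𝔖.space n i) X Y) :
    mk 𝔖 (c.reframe (𝔖.incl n i)) = mk 𝔖 c :=
  congrArg (fun s => (QuotientAddGroup.mk (QuotientAddGroup.mk (.of s) : ZF 𝔖 X Y) : H0 𝔖 X Y))
    (Quot.sound (Step.incl (n, i) c)).symm

lemma mk_sum {n : ℕ} {i : 𝔖.Idx} {c c₁ c₂ : ExplicitCorr n (𝔖.space n i) X Y}
    (h : c.IsDisjointSum c₁ c₂) : mk 𝔖 c = mk 𝔖 c₁ + mk 𝔖 c₂ := by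
  have : ZF.mk 𝔖 c = ZF.mk 𝔖 c₁ + ZF.mk 𝔖 c₂ := by
    rw [← sub_eq_zero]
    exact (QuotientAddGroup.eq_zero_iff _).2 (AddSubgroup.subset_closure ⟨n, i, c, c₁, c₂, h, rfl⟩)
  exact congrArg QuotientAddGroup.mk this

lemma mk_homotopy {n : ℕ} {i : 𝔖.Idx} (c : ExplicitCorr n (𝔖.space n i) (line X) Y) :
    mk 𝔖 (c.pull (lineAt X 0)) = mk 𝔖 (c.pull (lineAt X 1)) := by
  rw [← sub_eq_zero]
  exact (QuotientAddGroup.eq_zero_iff _).2 (AddSubgroup.subset_closure ⟨n, i, c, rfl⟩)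

/-- The universal property of `H0`. -/
def lift {A : Type*} [AddCommGroup A]
    (f : ∀ (n : ℕ) (i : 𝔖.Idx), ExplicitCorr n (𝔖.space n i) X Y → A)
    (hrel : ∀ n i c c', c.Rel c' → f n i c = f n i c')
    (hsusp : ∀ n i c, f (1 + n) i (c.susp (𝔖.susp n i)) = f n i c)
    (hincl : ∀ n i c, f n (𝔖.next i) (c.reframe (𝔖.incl n i)) = f n i c)
    (hsum : ∀ n i (c c₁ c₂ : ExplicitCorr n (𝔖.space n i) X Y), c.IsDisjointSum c₁ c₂ →
      f n i c = f n i c₁ + f n i c₂)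
    (hhom : ∀ n i (c : ExplicitCorr n (𝔖.space n i) (line X) Y),
      f n i (c.pull (lineAt X 0)) = f n i (c.pull (lineAt X 1))) : H0 𝔖 X Y →+ A :=
  QuotientAddGroup.lift (homotopyRel 𝔖 X Y)
    (QuotientAddGroup.lift (addRel 𝔖 X Y)
      (FreeAbelianGroup.lift (Stable.lift 𝔖 (fun c : AnyLevel 𝔖 X Y => f c.1.1 c.1.2 c.2) (by
        rintro _ _ (⟨l, c, c', h⟩ | ⟨l, c⟩ | ⟨l, c⟩)
        · exact hrel _ _ _ _ h
        · exact (hsusp _ _ _).symm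
        · exact (hincl _ _ _).symm)))
      (by
        refine (AddSubgroup.closure_le _).2 ?_
        rintro _ ⟨n, i, c, c₁, c₂, h, rfl⟩
        change FreeAbelianGroup.lift _ _ = 0
        rw [map_sub, map_add]
        simp only [FreeAbelianGroup.lift_apply_of]
        exact sub_eq_zero.2 (hsum n i c c₁ c₂ h)))
    (by
      refine (AddSubgroup.closure_le _).2 ?_
      rintro _ ⟨n, i, c, rfl⟩
      change QuotientAddGroup.lift _ _ _ _ = 0
      rw [map_sub]
      refine sub_eq_zero.2 (Eq.trans ?_ ((hhom n i c).trans ?_))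
      · exact (FreeAbelianGroup.lift_apply_of _ _)
      · exact (FreeAbelianGroup.lift_apply_of _ _).symm)

lemma lift_mk {A : Type*} [AddCommGroup A]
    (f : ∀ (n : ℕ) (i : 𝔖.Idx), ExplicitCorr n (𝔖.space n i) X Y → A) (hrel hsusp hincl hsum hhom)
    {n : ℕ} {i : 𝔖.Idx} (c : ExplicitCorr n (𝔖.space n i) X Y) :
    lift f hrel hsusp hincl hsum hhom (mk 𝔖 c) = f n i c :=
  FreeAbelianGroup.lift_apply_of _ _

end H0

namespace ExplicitCorr

variable {n : ℕ} {𝓕 𝓖 𝓗 : FramingSpace.{u}} {X T : Sch k} {Y Y' : (Sch k)ᵒᵖ ⥤ Type u}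

lemma ext_g (c : ExplicitCorr n 𝓕 X Y) {g g' : Y.obj (op c.dom)} (h : g = g') :
    ({ c with g := g } : ExplicitCorr n 𝓕 X Y) = { c with g := g' } := by
  rw [h]

lemma ext_φ (c : ExplicitCorr n 𝓕 X Y) {φ φ' : 𝓖.sec.obj (op c.W)} (h : φ = φ') (h' h'') :
    (⟨c.Z, c.finite, c.W, c.e, c.nbhd, φ, h', c.g⟩ : ExplicitCorr n 𝓖 X Y) =
      ⟨c.Z, c.finite, c.W, c.e, c.nbhd, φ', h'', c.g⟩ := by
  subst h; rfl

lemma naturality' (h : Y ⟶ Y') {S S' : Sch k} (f : S' ⟶ S) (y : Y.obj (op S)) :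
    Y'.map f.op (h.app _ y) = h.app _ (Y.map f.op y) :=
  (NatTrans.naturality_apply h f.op y).symm

lemma Rel.push {c c' : ExplicitCorr n 𝓕 X Y} (r : c.Rel c') (h : Y ⟶ Y') :
    (c.push h).Rel (c'.push h) := by
  obtain ⟨hZ, V, i, i', e, hV, hφ, hg⟩ := r
  refine ⟨hZ, V, i, i', e, hV, hφ, ?_⟩
  exact (naturality' h _ _).trans ((congrArg (h.app _) hg).trans (naturality' h _ _).symm)

lemma IsDisjointSum.push {c c₁ c₂ : ExplicitCorr n 𝓕 X Y} (r : c.IsDisjointSum c₁ c₂)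
    (h : Y ⟶ Y') : (c.push h).IsDisjointSum (c₁.push h) (c₂.push h) := by
  obtain ⟨hd, hZ, hi⟩ := r
  refine ⟨hd, hZ, fun d hd => ?_⟩
  have : ∀ d ∈ [c₁, c₂], ∃ (i : (d.push h).W ⟶ (c.push h).W)
      (e : i ≫ (c.push h).e = (d.push h).e),
      𝓕.sec.map i.op (c.push h).φ = (d.push h).φ ∧
      Y'.map (Over.homMk i (by simp [reassoc_of% e]) : (d.push h).dom ⟶ (c.push h).dom).op
        (c.push h).g = (d.push h).g := by
    intro d hd
    obtain ⟨i, e, hφ, hg⟩ := hi d hd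
    exact ⟨i, e, hφ, (naturality' h _ _).trans (congrArg (h.app _) hg)⟩
  simp only [List.mem_cons, List.not_mem_nil, or_false] at hd this
  rcases hd with rfl | rfl
  · exact this _ (.inl rfl)
  · exact this _ (.inr rfl)

lemma push_susp (c : ExplicitCorr n 𝓕 X Y) (σ : (affineSpace (Fin 1)).Pairing 𝓕 𝓖) (h : Y ⟶ Y') :
    (c.push h).susp σ = (c.susp σ).push h :=
  ext_g ((c.susp σ).push h) (naturality' h _ _)

lemma push_pull (c : ExplicitCorr n 𝓕 X Y) (a : T ⟶ X) (h : Y ⟶ Y') :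
    (c.push h).pull a = (c.pull a).push h :=
  ext_g ((c.pull a).push h) (naturality' h _ _)

lemma naturality_hom (η : 𝓕.Hom 𝓖) {S S' : Scheme.{u}} (f : S' ⟶ S) (y : 𝓕.sec.obj (op S)) :
    𝓖.sec.map f.op (η.hom.app _ y) = η.hom.app _ (𝓕.sec.map f.op y) :=
  (NatTrans.naturality_apply η.hom f.op y).symm

lemma Rel.reframe {c c' : ExplicitCorr n 𝓕 X Y} (r : c.Rel c') (η : 𝓕.Hom 𝓖) :
    (c.reframe η).Rel (c'.reframe η) := by
  obtain ⟨hZ, V, i, i', e, hV, hφ, hg⟩ := r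
  refine ⟨hZ, V, i, i', e, hV, ?_, hg⟩
  exact (naturality_hom η _ _).trans
    ((congrArg (η.hom.app _) hφ).trans (naturality_hom η _ _).symm)

lemma IsDisjointSum.reframe {c c₁ c₂ : ExplicitCorr n 𝓕 X Y} (r : c.IsDisjointSum c₁ c₂)
    (η : 𝓕.Hom 𝓖) : (c.reframe η).IsDisjointSum (c₁.reframe η) (c₂.reframe η) := by
  obtain ⟨hd, hZ, hi⟩ := r
  refine ⟨hd, hZ, fun d hd => ?_⟩
  have : ∀ d ∈ [c₁, c₂], ∃ (i : (d.reframe η).W ⟶ (c.reframe η).W)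
      (e : i ≫ (c.reframe η).e = (d.reframe η).e),
      𝓖.sec.map i.op (c.reframe η).φ = (d.reframe η).φ ∧
      Y.map (Over.homMk i (by simp [reassoc_of% e]) : (d.reframe η).dom ⟶ (c.reframe η).dom).op
        (c.reframe η).g = (d.reframe η).g := by
    intro d hd
    obtain ⟨i, e, hφ, hg⟩ := hi d hd
    exact ⟨i, e, (naturality_hom η _ _).trans (congrArg (η.hom.app _) hφ), hg⟩
  simp only [List.mem_cons, List.not_mem_nil, or_false] at hd this
  rcases hd with rfl | rfl
  · exact this _ (.inl rfl)
  · exact this _ (.inr rfl)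

lemma reframe_pull (c : ExplicitCorr n 𝓕 X Y) (a : T ⟶ X) (η : 𝓕.Hom 𝓖) :
    (c.reframe η).pull a = (c.pull a).reframe η :=
  ext_φ ((c.pull a).reframe η) (naturality_hom η _ _) _ _

lemma reframe_susp {𝓕' 𝓖' : FramingSpace.{u}} (c : ExplicitCorr n 𝓕 X Y)
    (σ : (affineSpace (Fin 1)).Pairing 𝓕 𝓖) (σ' : (affineSpace (Fin 1)).Pairing 𝓕' 𝓖')
    (η : 𝓕.Hom 𝓕') (θ : 𝓖.Hom 𝓖')
    (H : ∀ (W : Scheme.{u}) (x : (affineSpace (Fin 1)).sec.obj (op W)) (φ : 𝓕.sec.obj (op W)),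
      σ'.hom.app (op W) (x, η.hom.app _ φ) = θ.hom.app _ (σ.hom.app (op W) (x, φ))) :
    (c.reframe η).susp σ' = (c.susp σ).reframe θ :=
  ext_φ ((c.susp σ).reframe θ) (by
    refine Eq.trans ?_ (H _ _ _)
    exact congrArg (fun y => σ'.hom.app _ (_, y)) (naturality_hom η _ _)) _ _

end ExplicitCorr

/-- Functoriality of `H⁰(C_* ZF(X, -))`. -/
def H0.push {X : Sch k} {Y Y' : (Sch k)ᵒᵖ ⥤ Type u} (h : Y ⟶ Y') : H0 𝔖 X Y →+ H0 𝔖 X Y' :=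
  H0.lift (fun _ _ c => H0.mk 𝔖 (c.push h))
    (fun _ _ _ _ r => H0.mk_rel (r.push h))
    (fun _ _ c => (congrArg (H0.mk 𝔖) (c.push_susp _ h)).symm.trans (H0.mk_susp _))
    (fun _ _ c => H0.mk_incl (c.push h))
    (fun _ _ _ _ _ r => H0.mk_sum (r.push h))
    (fun _ _ c => (congrArg (H0.mk 𝔖) (c.push_pull _ h)).symm.trans
      ((H0.mk_homotopy _).trans (congrArg (H0.mk 𝔖) (c.push_pull _ h))))

lemma one_blockSum {R S : Type u} [CommRing R] [CommRing S] (f f' f'' : R →+* S) {n N : ℕ} :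
    (zeroCols (Equiv.refl (Fin (1 + n) ⊕ Fin N)) (1 : Matrix (Fin (1 + n)) (Fin (1 + n)) R)).map f =
      blockSum finSumFinEquiv ((Equiv.sumAssoc (Fin 1) (Fin n) (Fin N)).symm.trans
        (Equiv.sumCongr finSumFinEquiv (Equiv.refl _))) ((1 : Matrix (Fin 1) (Fin 1) R).map f')
        ((zeroCols (Equiv.refl (Fin n ⊕ Fin N)) (1 : Matrix (Fin n) (Fin n) R)).map f'') := by
  ext i j
  obtain ⟨i, rfl⟩ := finSumFinEquiv.surjective i
  obtain ⟨j, rfl⟩ := ((Equiv.sumAssoc (Fin 1) (Fin n) (Fin N)).symm.trans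
      (Equiv.sumCongr finSumFinEquiv (Equiv.refl _))).surjective j
  rcases i with i | i <;> rcases j with j | j | j <;>
    simp [Matrix.one_apply, Matrix.map_apply, apply_ite f, apply_ite f'']
  all_goals
    intro h
    have h' := congrArg Fin.val h
    have := i.isLt
    have := j.isLt
    simp only [Fin.val_castAdd, Fin.val_natAdd] at h'
    omega

lemma cobMap_susp (n N : ℕ) (W : Scheme.{u}) (x : (affineSpace (Fin 1)).sec.obj (op W))
    (φ : (affineSpace (Fin n)).sec.obj (op W)) :
    (cobordism.susp n N).hom.app (op W) (x, (cobMap n N).hom.app _ φ) =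
      (cobMap (1 + n) N).hom.app _ ((framed.susp n ()).hom.app (op W) (x, φ)) := by
  refine (Quot.sound (TauDatum.Equiv.of_res (fun y => (le_top : ⊤ ⊓ ⊤ ≤ (⊤ : W.Opens))) ?_ ?_)).symm
  · intro y
    exact one_blockSum (resHom W _) (resHom W _) (resHom W _)
  · intro y
    exact vecSum_map (resHom W _) finSumFinEquiv x φ

/-- The homomorphism induced by composing the framings with `𝔸ⁿ ⟶ τ`. The maps `cobMap n N` with
different `N` agree after stabilisation along `N`, so `N = 0` gives the stable map. -/
def Hcob (X : Sch k) (Y : (Sch k)ᵒᵖ ⥤ Type u) : H0 framed X Y →+ H0 cobordism X Y :=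
  H0.lift (fun n _ c => H0.mk cobordism (i := (0 : ℕ)) (c.reframe (cobMap n 0)))
    (fun _ _ _ _ r => H0.mk_rel (𝔖 := cobordism) (r.reframe _))
    (fun n _ c => (congrArg (H0.mk cobordism)
      (c.reframe_susp _ _ _ _ (cobMap_susp n 0))).symm.trans (H0.mk_susp (𝔖 := cobordism) _))
    (fun _ _ _ => rfl)
    (fun _ _ _ _ _ r => H0.mk_sum (𝔖 := cobordism) (r.reframe _))
    (fun _ _ c => (congrArg (H0.mk cobordism) (c.reframe_pull _ _)).symm.trans
      ((H0.mk_homotopy (𝔖 := cobordism) _).trans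
        (congrArg (H0.mk cobordism) (c.reframe_pull _ _))))

lemma H0.hom_ext {X : Sch k} {Y : (Sch k)ᵒᵖ ⥤ Type u} {𝔖 : FramingTheory.{u}} {A : Type*}
    [AddCommGroup A] {f g : H0 𝔖 X Y →+ A}
    (h : ∀ (n : ℕ) (i : 𝔖.Idx) (c : ExplicitCorr n (𝔖.space n i) X Y),
      f (H0.mk 𝔖 c) = g (H0.mk 𝔖 c)) : f = g := by
  refine QuotientAddGroup.addMonoidHom_ext _ (QuotientAddGroup.addMonoidHom_ext _
    (FreeAbelianGroup.lift_ext _ _ fun s => ?_))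
  obtain ⟨⟨⟨n, i⟩, c⟩, rfl⟩ := Quot.exists_rep s
  exact h n i c

/-- The point `Spec k`. -/
def pt (k : Type u) [Field k] : Sch k := Over.mk (𝟙 (Spec (CommRingCat.of k)))

/-- The presheaf represented by `𝔾ₘᵐ`. -/
def Gm (k : Type u) [Field k] (m : ℕ) : (Sch k)ᵒᵖ ⥤ Type u where
  obj W := Fin m → Γ(W.unop.left, ⊤)ˣ
  map f := TypeCat.ofHom fun y i => Units.map f.unop.left.appTop.hom (y i)
  map_id W := by ext y i; simp
  map_comp f g := by ext y i; rfl

/-- The idempotent endomorphism of `𝔾ₘᵐ` that replaces the `i`-th coordinate by `1`. -/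
def coordOne (k : Type u) [Field k] {m : ℕ} (i : Fin m) : Gm k m ⟶ Gm k m where
  app W := TypeCat.ofHom fun y => Function.update y i 1
  naturality W W' f := by
    ext y
    funext j
    change Function.update (fun j => Units.map _ (y j)) i 1 j = Units.map _ (Function.update y i 1 j)
    by_cases h : j = i
    · subst h
      exact (Function.update_self _ _ _).trans ((map_one _).symm.trans
        (congrArg (Units.map _) (Function.update_self j (1 : Γ(W.unop.left, ⊤)ˣ)
          (y : Fin m → Γ(W.unop.left, ⊤)ˣ)).symm))
    · exact (Function.update_of_ne h _ _).trans
        (congrArg (Units.map _) (Function.update_of_ne h _ _).symm)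

/-- The isomorphism `𝔾ₘᵐ × 𝔾ₘᵐ' ⟶ 𝔾ₘᵐ⁺ᵐ'`. -/
def Gm.append (k : Type u) [Field k] (m m' : ℕ) :
    FunctorToTypes.prod (Gm k m) (Gm k m') ⟶ Gm k (m + m') where
  app W := TypeCat.ofHom fun y => Fin.append y.1 y.2
  naturality W W' f := by
    ext ⟨y, y'⟩
    funext j
    change Fin.append (fun j => Units.map _ (y j)) (fun j => Units.map _ (y' j)) j =
      Units.map _ (Fin.append y y' j)
    refine Fin.addCases (fun j => ?_) (fun j => ?_) j
    · exact (Fin.append_left _ _ _).trans (congrArg (Units.map _) (Fin.append_left _ _ _).symm)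
    · exact (Fin.append_right _ _ _).trans (congrArg (Units.map _) (Fin.append_right _ _ _).symm)

/-- The endomorphism `1 - eᵢ` of `H⁰(C_* ZF(pt, 𝔾ₘᵐ))`. -/
def oneSub (k : Type u) [Field k] {m : ℕ} (i : Fin m) : AddMonoid.End (H0 𝔖 (pt k) (Gm k m)) :=
  AddMonoidHom.id _ - H0.push 𝔖 (coordOne k i)

/-- The endomorphism `∏ (1 - eᵢ)` of `H⁰(C_* ZF(pt, 𝔾ₘᵐ))`. -/
def wedgeProj (k : Type u) [Field k] (m : ℕ) : AddMonoid.End (H0 𝔖 (pt k) (Gm k m)) :=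
  (List.ofFn fun i : Fin m => oneSub 𝔖 k i).prod

/-- The group `H⁰(C_* ZF(pt, 𝔾ₘ^∧ᵐ))`: the direct summand split out by `∏ (1 - eᵢ)`. -/
def WedgeH0 (k : Type u) [Field k] (m : ℕ) : AddSubgroup (H0 𝔖 (pt k) (Gm k m)) :=
  AddMonoidHom.range (wedgeProj 𝔖 k m)

lemma Hcob_push {X : Sch k} {Y Y' : (Sch k)ᵒᵖ ⥤ Type u} (h : Y ⟶ Y') (x : H0 framed X Y) :
    Hcob X Y' (H0.push framed h x) = H0.push cobordism h (Hcob X Y x) := by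
  have : (Hcob X Y').comp (H0.push framed h) = (H0.push cobordism h).comp (Hcob X Y) :=
    H0.hom_ext fun n i c => rfl
  exact DFunLike.congr_fun this x

lemma Hcob_wedgeProj (k : Type u) [Field k] (m : ℕ) (x : H0 framed (pt k) (Gm k m)) :
    Hcob _ _ (wedgeProj framed k m x) = wedgeProj cobordism k m (Hcob _ _ x) := by
  have : ∀ l : List (Fin m),
      Hcob _ _ ((l.map fun i => oneSub framed k i).prod x) =
      (l.map fun i => oneSub cobordism k i).prod (Hcob _ _ x) := by
    intro l
    induction l with
    | nil => rfl
    | cons i l ih =>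
      simp only [List.map_cons, List.prod_cons]
      refine (map_sub (Hcob _ _) _ _).trans ?_
      exact congrArg₂ (· - ·) ih ((Hcob_push _ _).trans (congrArg _ ih))
  have h := this (List.finRange m)
  rw [← List.ofFn_eq_map, ← List.ofFn_eq_map] at h
  exact h

/-- The restriction of `Hcob` to the summands `H⁰(C_* ZF(pt, 𝔾ₘ^∧ᵐ))`. -/
def wedgeHcob (k : Type u) [Field k] (m : ℕ) : WedgeH0 framed k m →+ WedgeH0 cobordism k m :=
  ((Hcob (pt k) (Gm k m)).comp (WedgeH0 framed k m).subtype).codRestrict _ (by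
    rintro ⟨_, x, rfl⟩
    exact ⟨Hcob _ _ x, (Hcob_wedgeProj k m x).symm⟩)

/-- The external product of correspondences from `Spec k` to powers of `𝔾ₘ`. -/
def extProd {m m' n n' : ℕ} {i i' : 𝔖.Idx} (c : ExplicitCorr n (𝔖.space n i) (pt k) (Gm k m))
    (c' : ExplicitCorr n' (𝔖.space n' i') (pt k) (Gm k m')) :
    ExplicitCorr (n + n') (𝔖.space (n + n') (𝔖.addIdx i i')) (pt k) (Gm k (m + m')) :=
  (c.prod c' (𝔖.sum n i n' i')).push (Gm.append k m m')

/-- The biadditive maps `μ` are given by the external product of correspondences. -/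
def IsExternalProduct (k : Type u) [Field k] (μ : ∀ m m' : ℕ, H0 𝔖 (pt k) (Gm k m) →+ H0 𝔖 (pt k) (Gm k m') →+
    H0 𝔖 (pt k) (Gm k (m + m'))) : Prop :=
  ∀ (m m' n n' : ℕ) (i i' : 𝔖.Idx) (c : ExplicitCorr n (𝔖.space n i) (pt k) (Gm k m))
    (c' : ExplicitCorr n' (𝔖.space n' i') (pt k) (Gm k m')),
    μ m m' (H0.mk 𝔖 c) (H0.mk 𝔖 c') = H0.mk 𝔖 (extProd 𝔖 c c')

/-- The correspondence of level `0` given by the identity of `Spec k = 𝔾ₘ⁰`. -/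
def unitCorr (k : Type u) [Field k] : ExplicitCorr 0 (𝔖.space 0 𝔖.zeroIdx) (pt k) (Gm k 0) :=
  ExplicitCorr.ofSection (Fin.elim0 : Fin 0 → Γ((pt k).left, ⊤)ˣ) (𝔖.origin _) (𝔖.zero_origin _)

/-- The graded multiplication on `⨁ₘ H⁰(C_* ZF(pt, 𝔾ₘ^∧ᵐ))` is the restriction of `μ`, and its unit is
the class of the identity of `Spec k`. -/
def IsProductRing (k : Type u) [Field k] (μ : ∀ m m' : ℕ, H0 𝔖 (pt k) (Gm k m) →+
    H0 𝔖 (pt k) (Gm k m') →+ H0 𝔖 (pt k) (Gm k (m + m')))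
    [DirectSum.GRing (fun m : ℕ => WedgeH0 𝔖 k m)] : Prop :=
  (∀ (m m' : ℕ) (x : WedgeH0 𝔖 k m) (y : WedgeH0 𝔖 k m'),
    ((GradedMonoid.GMul.mul (A := fun m : ℕ => WedgeH0 𝔖 k m) x y : WedgeH0 𝔖 k (m + m')) : H0 𝔖 (pt k) (Gm k (m + m'))) =
      μ m m' x y) ∧
  ((GradedMonoid.GOne.one (A := fun m : ℕ => WedgeH0 𝔖 k m) : WedgeH0 𝔖 k 0) : H0 𝔖 (pt k) (Gm k 0)) = H0.mk 𝔖 (unitCorr 𝔖 k)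

end CobFr

end

/-! The product of explicit correspondences descends to `H⁰` once it respects equivalence, disjoint
sums, homotopies and the two stabilisations. The first three are formal in each variable: products
of neighbourhoods are functorial for restriction, preimages of closed sets distribute over unions,
and a homotopy in one variable times the constant family of the other correspondence over the line
is a homotopy of products.

The substance lies in stabilisation. `c × (𝔸¹ × d)` and `𝔸¹ × (c × d)` differ by a permutation of
the coordinates of affine space and, in the cobordism case, of the columns of the epimorphism.
Associativity and the unit laws also hold only up to such reindexings. `StableProduct.of_invariant`
therefore reduces everything to elementary identities between framings and to one fact: a reindexing
of coordinates or columns does not change the class in `H⁰` (`invariant_framed`,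
`invariant_cobordism`).

For this fact, invertible matrices act on correspondences (`LinAct`, `ExplicitCorr.lin`), with
permutation matrices acting by reindexing. An elementary matrix is joined to the identity by scaling
its off-diagonal entry with the coordinate of the line (`H0.mk_lin_elem`). A transposition has
determinant `-1`, whereas elementary matrices have determinant `1`; but `swap_eq_rot` writes it as a
product of elementary matrices and a sign change in a third coordinate `z`. After one stabilisation
the added coordinate or column can serve as `z`, and there the sign change is harmless. For a
suspension it is absorbed by `x ↦ -x` on the neighbourhood `𝔸¹ × W` (`lin_sign_susp_rel`, with
`tauAct_sign_susp` in the cobordism case); for an added zero column it does nothing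
(`tauAct_sign_zeroCols`).

The product commutes with the idempotents of both factors, so it restricts to the summands
(`StableProduct.extMul_wedgeProj`), where associativity and unit are read off through the
identifications of powers of `𝔾ₘ`. `Hcob` is multiplicative because a sum of standard trivial
quotients is the standard trivial quotient (`cobMap_sum`). -/

noncomputable section

namespace CobFr

set_option linter.unusedSectionVars false

/-! ### Data of correspondences at generalised points. -/

section

variable {k : Type u} [Field k]

namespace ExplicitCorr

variable {n n' n'' : ℕ} {𝓕 𝓖 𝓗 𝓚 : FramingSpace.{u}} {X T : Sch k} {Y Y' Y'' : (Sch k)ᵒᵖ ⥤ Type u}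

/-- The structure morphism of the neighbourhood over `X`. -/
abbrev base (c : ExplicitCorr n 𝓕 X Y) : c.W ⟶ X.left := c.e ≫ Aff.str n X.left

/-- The framing at a generalised point of the neighbourhood. -/
def φAt (c : ExplicitCorr n 𝓕 X Y) {V : Scheme.{u}} (j : V ⟶ c.W) : 𝓕.sec.obj (op V) :=
  𝓕.sec.map j.op c.φ

/-- The section `g` at a generalised point of the neighbourhood. -/
def gAt (c : ExplicitCorr n 𝓕 X Y) {V : Scheme.{u}} (j : V ⟶ c.W) (h : V ⟶ Spec (CommRingCat.of k))
    (w : j ≫ c.e ≫ Aff.str n X.left ≫ X.hom = h) : Y.obj (op (Over.mk h)) :=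
  Y.map (Over.homMk j w : Over.mk h ⟶ c.dom).op c.g

lemma sec_map_map (𝓕 : FramingSpace.{u}) {A B C : Scheme.{u}} (f : A ⟶ B) (g : B ⟶ C)
    (x : 𝓕.sec.obj (op C)) : 𝓕.sec.map f.op (𝓕.sec.map g.op x) = 𝓕.sec.map (f ≫ g).op x := by
  rw [op_comp, Functor.map_comp_apply]

lemma sec_map_id (𝓕 : FramingSpace.{u}) {A : Scheme.{u}} (x : 𝓕.sec.obj (op A)) :
    𝓕.sec.map (𝟙 A).op x = x := by
  rw [op_id, Functor.map_id_apply]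

lemma map_map_op (Y : (Sch k)ᵒᵖ ⥤ Type u) {A B C : Sch k} (f : A ⟶ B) (g : B ⟶ C) (h : A ⟶ C)
    (w : f ≫ g = h) (x : Y.obj (op C)) : Y.map f.op (Y.map g.op x) = Y.map h.op x := by
  subst w
  rw [op_comp, Functor.map_comp_apply]

lemma sec_map_φAt (c : ExplicitCorr n 𝓕 X Y) {V V' : Scheme.{u}} (f : V' ⟶ V) (j : V ⟶ c.W) :
    𝓕.sec.map f.op (c.φAt j) = c.φAt (f ≫ j) := sec_map_map _ _ _ _

/-- The structure morphisms to `Spec k` are separate arguments with equations, because those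
produced by different constructions agree only propositionally. This avoids transport between
objects of the slice category. -/
lemma map_gAt (c : ExplicitCorr n 𝓕 X Y) {V V' : Scheme.{u}} (f : V' ⟶ V) (j : V ⟶ c.W)
    (h : V ⟶ Spec (CommRingCat.of k)) (h' : V' ⟶ Spec (CommRingCat.of k)) (w)
    (w' : f ≫ h = h') :
    Y.map (Over.homMk f w' : Over.mk h' ⟶ Over.mk h).op (c.gAt j h w) =
      c.gAt (f ≫ j) h' (by rw [Category.assoc, w, w']) :=
  map_map_op _ _ _ _ (by ext; rfl) _

lemma gAt_congr (c : ExplicitCorr n 𝓕 X Y) {V : Scheme.{u}} {j j' : V ⟶ c.W} (e : j = j')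
    (h : V ⟶ Spec (CommRingCat.of k)) (w) (w') : c.gAt j h w = c.gAt j' h w' := by
  subst e; rfl

lemma φAt_id (c : ExplicitCorr n 𝓕 X Y) : c.φAt (𝟙 _) = c.φ := sec_map_id _ _

lemma gAt_id (c : ExplicitCorr n 𝓕 X Y) (w) :
    c.gAt (𝟙 _) (c.e ≫ Aff.str n X.left ≫ X.hom) w = c.g := by
  have : (Over.homMk (𝟙 _) w : c.dom ⟶ c.dom) = 𝟙 _ := by ext; rfl
  exact (congrArg (fun f : c.dom ⟶ c.dom => Y.map f.op c.g) this).trans (Functor.map_id_apply _ _ _)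

/-- The neighbourhood and the data of `b` are obtained from those of `c` by restriction. -/
structure RestrictsTo (c b : ExplicitCorr n 𝓕 X Y) (j : b.W ⟶ c.W) : Prop where
  comp_e : j ≫ c.e = b.e
  φ_eq : c.φAt j = b.φAt (𝟙 _)
  g_eq : c.gAt j (b.e ≫ Aff.str n X.left ≫ X.hom) (by rw [reassoc_of% comp_e]) =
    b.gAt (𝟙 _) _ (Category.id_comp _)

lemma RestrictsTo.φAt_eq {c b : ExplicitCorr n 𝓕 X Y} {j : b.W ⟶ c.W} (r : c.RestrictsTo b j)
    {V : Scheme.{u}} (f : V ⟶ b.W) : c.φAt (f ≫ j) = b.φAt f := by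
  rw [← sec_map_φAt, r.φ_eq, sec_map_φAt, Category.comp_id]

lemma RestrictsTo.gAt_eq {c b : ExplicitCorr n 𝓕 X Y} {j : b.W ⟶ c.W} (r : c.RestrictsTo b j)
    {V : Scheme.{u}} (f : V ⟶ b.W) (h : V ⟶ Spec (CommRingCat.of k)) (w) :
    c.gAt (f ≫ j) h w = b.gAt f h (by rw [← r.comp_e]; simpa using w) := by
  have w' : f ≫ b.e ≫ Aff.str n X.left ≫ X.hom = h := by rw [← r.comp_e]; simpa using w
  have := congrArg (Y.map (Over.homMk f w' : Over.mk h ⟶ b.dom).op) r.g_eq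
  refine (map_gAt c f j _ h _ w').symm.trans (this.trans ((map_gAt b f (𝟙 _) _ h _ w').trans ?_))
  exact gAt_congr _ (Category.comp_id _) _ _ _

/-- The common refinement is the neighbourhood of `b` itself. `RestrictsTo` ignores supports so that
it also applies to the summands of a disjoint sum; hence the extra hypothesis. -/
lemma RestrictsTo.rel {c b : ExplicitCorr n 𝓕 X Y} {j : b.W ⟶ c.W} (r : c.RestrictsTo b j)
    (hZ : b.Z = c.Z) : b.Rel c := by
  refine ⟨hZ, b.W, 𝟙 _, j, by rw [r.comp_e, Category.id_comp], ?_, r.φ_eq.symm, ?_⟩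
  · rw [Category.id_comp]; exact b.nbhd
  · have h := r.gAt_eq (𝟙 _) ((𝟙 _ ≫ b.e) ≫ Aff.str n X.left ≫ X.hom) (by
      rw [← r.comp_e]; simp)
    exact h.symm.trans (gAt_congr _ (Category.id_comp _) _ _ _)

/-- The restriction to a smaller neighbourhood. -/
def restrict (c : ExplicitCorr n 𝓕 X Y) {V : Scheme.{u}} (i : V ⟶ c.W)
    (h : IsEtaleNbhd (i ≫ c.e) c.Z) : ExplicitCorr n 𝓕 X Y where
  Z := c.Z
  finite := c.finite
  W := V
  e := i ≫ c.e
  nbhd := h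
  φ := c.φAt i
  zero_eq := by rw [φAt, 𝓕.zero_map, c.zero_eq]; rfl
  g := c.gAt i _ (Category.assoc _ _ _).symm

lemma restrict_restrictsTo (c : ExplicitCorr n 𝓕 X Y) {V : Scheme.{u}} (i : V ⟶ c.W)
    (h : IsEtaleNbhd (i ≫ c.e) c.Z) : c.RestrictsTo (c.restrict i h) i where
  comp_e := rfl
  φ_eq := (φAt_id (c.restrict i h)).symm
  g_eq := (gAt_id (c.restrict i h) _).symm

/-- Replaces an equivalence by a span of restrictions, so that a construction respects `Rel` as soon
as it respects a single morphism of neighbourhoods. -/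
lemma Rel.exists_restrict {c c' : ExplicitCorr n 𝓕 X Y} (r : c.Rel c') :
    ∃ (b : ExplicitCorr n 𝓕 X Y) (i : b.W ⟶ c.W) (i' : b.W ⟶ c'.W), b.Z = c.Z ∧ b.Z = c'.Z ∧
      c.RestrictsTo b i ∧ c'.RestrictsTo b i' := by
  obtain ⟨hZ, V, i, i', e, hV, hφ, hg⟩ := r
  refine ⟨c.restrict i hV, i, i', rfl, hZ, c.restrict_restrictsTo i hV, e, ?_, ?_⟩
  · exact hφ.symm.trans (φAt_id (c.restrict i hV)).symm
  · exact hg.symm.trans (gAt_id (c.restrict i hV) _).symm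

/-- In terms of `RestrictsTo`, disjoint sums pass through products by the same lemma
`RestrictsTo.prod` as equivalences do. -/
lemma isDisjointSum_iff {c c₁ c₂ : ExplicitCorr n 𝓕 X Y} :
    c.IsDisjointSum c₁ c₂ ↔ Disjoint c₁.Z c₂.Z ∧ c.Z = c₁.Z ⊔ c₂.Z ∧
      (∃ i, c.RestrictsTo c₁ i) ∧ ∃ i, c.RestrictsTo c₂ i := by
  have key : ∀ d : ExplicitCorr n 𝓕 X Y, (∃ (i : d.W ⟶ c.W) (h : i ≫ c.e = d.e),
      𝓕.sec.map i.op c.φ = d.φ ∧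
      Y.map (Over.homMk i (by simp [reassoc_of% h]) : d.dom ⟶ c.dom).op c.g = d.g) ↔
      ∃ i, c.RestrictsTo d i := fun d =>
    ⟨fun ⟨i, h, h1, h2⟩ => ⟨i, h, h1.trans (φAt_id d).symm, h2.trans (gAt_id d _).symm⟩,
      fun ⟨i, r⟩ => ⟨i, r.comp_e, r.φ_eq.trans (φAt_id d), r.g_eq.trans (gAt_id d _)⟩⟩
  simp only [IsDisjointSum, List.mem_cons, List.not_mem_nil, or_false, forall_eq_or_imp, forall_eq,
    key]

/-! ### The data of products, suspensions and pullbacks at generalised points -/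

section Prod

variable (c : ExplicitCorr n 𝓕 X Y) (d : ExplicitCorr n' 𝓖 X Y') (μ : 𝓕.Pairing 𝓖 𝓗)

def prodFst : (c.prod d μ).W ⟶ c.W := pullback.fst _ _ ≫ pullback.fst c.e (projL n n' X.left)

def prodSnd : (c.prod d μ).W ⟶ d.W := pullback.snd _ _ ≫ pullback.fst d.e (projR n n' X.left)

lemma prodFst_e : c.prodFst d μ ≫ c.e = (c.prod d μ).e ≫ projL n n' X.left := by
  have : (pullback.fst (pullback.snd c.e (projL n n' X.left)) (pullback.snd d.e (projR n n' X.left)) ≫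
      pullback.fst c.e (projL n n' X.left)) ≫ c.e =
      (pullback.snd (pullback.snd c.e (projL n n' X.left)) (pullback.snd d.e (projR n n' X.left)) ≫
        pullback.snd d.e (projR n n' X.left)) ≫ projL n n' X.left := by
    rw [Category.assoc, pullback.condition, pullback.condition_assoc, Category.assoc]
  exact this

lemma prodSnd_e : c.prodSnd d μ ≫ d.e = (c.prod d μ).e ≫ projR n n' X.left := by
  have : (pullback.snd (pullback.snd c.e (projL n n' X.left)) (pullback.snd d.e (projR n n' X.left)) ≫
      pullback.fst d.e (projR n n' X.left)) ≫ d.e =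
      (pullback.snd (pullback.snd c.e (projL n n' X.left)) (pullback.snd d.e (projR n n' X.left)) ≫
        pullback.snd d.e (projR n n' X.left)) ≫ projR n n' X.left := by
    rw [Category.assoc, pullback.condition, Category.assoc]
  exact this

variable {c d} in
/-- The universal property of the neighbourhood of a product. -/
def prodLift {V : Scheme.{u}} (a : V ⟶ c.W) (b : V ⟶ d.W) (p : V ⟶ Aff (n + n') X.left)
    (ha : a ≫ c.e = p ≫ projL n n' X.left) (hb : b ≫ d.e = p ≫ projR n n' X.left) :
    V ⟶ (c.prod d μ).W :=
  pullback.lift (f := pullback.snd c.e (projL n n' X.left))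
    (g := pullback.snd d.e (projR n n' X.left)) (pullback.lift a p ha) (pullback.lift b p hb)
    ((pullback.lift_snd _ _ _).trans (pullback.lift_snd _ _ _).symm)

variable {c d} in
lemma prodLift_fst {V : Scheme.{u}} (a : V ⟶ c.W) (b : V ⟶ d.W) (p : V ⟶ Aff (n + n') X.left) (ha)
    (hb) : prodLift μ a b p ha hb ≫ c.prodFst d μ = a :=
  (pullback.lift_fst_assoc _ _ _ _).trans (pullback.lift_fst _ _ _)

variable {c d} in
lemma prodLift_snd {V : Scheme.{u}} (a : V ⟶ c.W) (b : V ⟶ d.W) (p : V ⟶ Aff (n + n') X.left) (ha)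
    (hb) : prodLift μ a b p ha hb ≫ c.prodSnd d μ = b :=
  (pullback.lift_snd_assoc _ _ _ _).trans (pullback.lift_fst _ _ _)

variable {c d} in
lemma prodLift_e {V : Scheme.{u}} (a : V ⟶ c.W) (b : V ⟶ d.W) (p : V ⟶ Aff (n + n') X.left) (ha)
    (hb) : prodLift μ a b p ha hb ≫ (c.prod d μ).e = p :=
  (pullback.lift_snd_assoc _ _ _ _).trans (pullback.lift_snd _ _ _)

/-- By naturality of the pairing, only the two components of the generalised point enter. With this
and its analogues for `susp` and `pull`, comparing data amounts to comparing morphisms into the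
original neighbourhoods. -/
lemma prod_φAt {V : Scheme.{u}} (j : V ⟶ (c.prod d μ).W) :
    (c.prod d μ).φAt j =
      μ.hom.app (op V) (c.φAt (j ≫ c.prodFst d μ), d.φAt (j ≫ c.prodSnd d μ)) := by
  refine (NatTrans.naturality_apply μ.hom j.op _).symm.trans ?_
  exact congrArg (μ.hom.app (op V)) (Prod.ext (sec_map_map _ _ _ _) (sec_map_map _ _ _ _))

lemma prod_gAt {V : Scheme.{u}} (j : V ⟶ (c.prod d μ).W) (h) (w) :
    (c.prod d μ).gAt j h w =
      (c.gAt (j ≫ c.prodFst d μ) h (by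
          rw [Category.assoc, reassoc_of% c.prodFst_e d μ, ← w]
          rw [AffineSpace.reindex_over_assoc]),
        d.gAt (j ≫ c.prodSnd d μ) h (by
          rw [Category.assoc, reassoc_of% c.prodSnd_e d μ, ← w]
          rw [AffineSpace.reindex_over_assoc])) :=
  Prod.ext (map_map_op _ _ _ _ (by ext; rfl) _) (map_map_op _ _ _ _ (by ext; rfl) _)

end Prod

section Susp

variable (c : ExplicitCorr n 𝓕 X Y) (σ : (affineSpace (Fin 1)).Pairing 𝓕 𝓖)

def suspFst : (c.susp σ).W ⟶ c.W := pullback.fst c.e (projR 1 n X.left)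

lemma suspFst_e : c.suspFst σ ≫ c.e = (c.susp σ).e ≫ projR 1 n X.left := pullback.condition

variable {c} in
def suspLift {V : Scheme.{u}} (a : V ⟶ c.W) (p : V ⟶ Aff (1 + n) X.left)
    (ha : a ≫ c.e = p ≫ projR 1 n X.left) : V ⟶ (c.susp σ).W := pullback.lift a p ha

variable {c} in
lemma suspLift_fst {V : Scheme.{u}} (a : V ⟶ c.W) (p : V ⟶ Aff (1 + n) X.left) (ha) :
    suspLift σ a p ha ≫ c.suspFst σ = a := pullback.lift_fst _ _ _

variable {c} in
lemma suspLift_e {V : Scheme.{u}} (a : V ⟶ c.W) (p : V ⟶ Aff (1 + n) X.left) (ha) :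
    suspLift σ a p ha ≫ (c.susp σ).e = p := pullback.lift_snd _ _ _

/-- The coordinate on the affine line at a generalised point of the neighbourhood. -/
def suspCoord {V : Scheme.{u}} (j : V ⟶ (c.susp σ).W) : (affineSpace (Fin 1)).sec.obj (op V) :=
  fun _ => (j ≫ (c.susp σ).e).appTop (Aff.coord X.left (Fin.castAdd n 0))

lemma susp_φAt {V : Scheme.{u}} (j : V ⟶ (c.susp σ).W) :
    (c.susp σ).φAt j = σ.hom.app (op V)
      (c.suspCoord σ j, c.φAt (j ≫ c.suspFst σ)) := by
  refine (NatTrans.naturality_apply σ.hom j.op _).symm.trans ?_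
  refine congrArg (σ.hom.app (op V)) (Prod.ext ?_ (sec_map_map _ _ _ _))
  funext _
  exact congr($(Scheme.Hom.comp_appTop j (c.susp σ).e).hom _).symm

lemma susp_gAt {V : Scheme.{u}} (j : V ⟶ (c.susp σ).W) (h) (w) :
    (c.susp σ).gAt j h w = c.gAt (j ≫ c.suspFst σ) h (by
          rw [Category.assoc, reassoc_of% c.suspFst_e σ, ← w]
          rw [AffineSpace.reindex_over_assoc]) :=
  map_map_op _ _ _ _ (by ext; rfl) _

end Susp

section Pull

variable (c : ExplicitCorr n 𝓕 X Y) (a : T ⟶ X)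

def pullFst : (c.pull a).W ⟶ c.W := pullback.fst c.e (AffineSpace.map (ULift.{u} (Fin n)) a.left)

lemma pullFst_e : c.pullFst a ≫ c.e = (c.pull a).e ≫ AffineSpace.map _ a.left := pullback.condition

variable {c} in
def pullLift {V : Scheme.{u}} (b : V ⟶ c.W) (p : V ⟶ Aff n T.left)
    (hb : b ≫ c.e = p ≫ AffineSpace.map _ a.left) : V ⟶ (c.pull a).W := pullback.lift b p hb

variable {c} in
lemma pullLift_fst {V : Scheme.{u}} (b : V ⟶ c.W) (p : V ⟶ Aff n T.left) (hb) :
    pullLift a b p hb ≫ c.pullFst a = b := pullback.lift_fst _ _ _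

variable {c} in
lemma pullLift_e {V : Scheme.{u}} (b : V ⟶ c.W) (p : V ⟶ Aff n T.left) (hb) :
    pullLift a b p hb ≫ (c.pull a).e = p := pullback.lift_snd _ _ _

lemma pull_φAt {V : Scheme.{u}} (j : V ⟶ (c.pull a).W) :
    (c.pull a).φAt j = c.φAt (j ≫ c.pullFst a) := sec_map_map _ _ _ _

lemma pull_gAt {V : Scheme.{u}} (j : V ⟶ (c.pull a).W) (h) (w) :
    (c.pull a).gAt j h w = c.gAt (j ≫ c.pullFst a) h (by
          rw [Category.assoc, reassoc_of% c.pullFst_e a, ← w]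
          simp) :=
  map_map_op _ _ _ _ (by ext; rfl) _

end Pull

end ExplicitCorr

end

/-! ### Products under restriction, disjoint sums and base change. -/

section

variable {k : Type u} [Field k]

namespace ExplicitCorr

variable {n n' n'' : ℕ} {𝓕 𝓖 𝓗 𝓚 : FramingSpace.{u}} {X T S : Sch k} {Y Y' Y'' : (Sch k)ᵒᵖ ⥤ Type u}

lemma φAt_congr (c : ExplicitCorr n 𝓕 X Y) {V : Scheme.{u}} {j j' : V ⟶ c.W} (e : j = j') :
    c.φAt j = c.φAt j' := by rw [e]

lemma RestrictsTo.φAt_eq_of_comp {c b : ExplicitCorr n 𝓕 X Y} {j : b.W ⟶ c.W}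
    (r : c.RestrictsTo b j) {V : Scheme.{u}} {f : V ⟶ b.W} {l : V ⟶ c.W} (e : l = f ≫ j) :
    c.φAt l = b.φAt f := by rw [e, r.φAt_eq]

lemma RestrictsTo.gAt_eq_of_comp {c b : ExplicitCorr n 𝓕 X Y} {j : b.W ⟶ c.W}
    (r : c.RestrictsTo b j) {V : Scheme.{u}} {f : V ⟶ b.W} {l : V ⟶ c.W} (e : l = f ≫ j)
    (h : V ⟶ Spec (CommRingCat.of k)) (w) (w') :
    c.gAt l h w = b.gAt f h w' := by subst e; exact r.gAt_eq f h _

lemma RestrictsTo.refl (c : ExplicitCorr n 𝓕 X Y) : c.RestrictsTo c (𝟙 _) :=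
  ⟨Category.id_comp _, rfl, rfl⟩

lemma RestrictsTo.prod {c b : ExplicitCorr n 𝓕 X Y} {j : b.W ⟶ c.W} (r : c.RestrictsTo b j)
    {d a : ExplicitCorr n' 𝓖 X Y'} {l : a.W ⟶ d.W} (s : d.RestrictsTo a l) (μ : 𝓕.Pairing 𝓖 𝓗) :
    ∃ i, (c.prod d μ).RestrictsTo (b.prod a μ) i := by
  refine ⟨prodLift μ (b.prodFst a μ ≫ j) (b.prodSnd a μ ≫ l) (b.prod a μ).e
    (by rw [Category.assoc, r.comp_e, prodFst_e]) (by rw [Category.assoc, s.comp_e, prodSnd_e]),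
    prodLift_e _ _ _ _ _ _, ?_, ?_⟩
  · rw [prod_φAt, prod_φAt]
    refine congrArg _ (Prod.ext (r.φAt_eq_of_comp ?_) (s.φAt_eq_of_comp ?_))
    · rw [prodLift_fst, Category.id_comp]
    · rw [prodLift_snd, Category.id_comp]
  · rw [prod_gAt, prod_gAt]
    refine Prod.ext (r.gAt_eq_of_comp ?_ _ _ _) (s.gAt_eq_of_comp ?_ _ _ _)
    · rw [prodLift_fst, Category.id_comp]
    · rw [prodLift_snd, Category.id_comp]

lemma prod_Z (c : ExplicitCorr n 𝓕 X Y) (d : ExplicitCorr n' 𝓖 X Y') (μ : 𝓕.Pairing 𝓖 𝓗) :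
    (c.prod d μ).Z = c.Z.preimage (projL n n' X.left).continuous ⊓
      d.Z.preimage (projR n n' X.left).continuous := rfl

/-- Disjointness is inherited from the projections of the supports, and the union comes from
distributivity in the lattice of closed sets. -/
lemma IsDisjointSum.prod_right {c c₁ c₂ : ExplicitCorr n 𝓕 X Y} (h : c.IsDisjointSum c₁ c₂)
    (d : ExplicitCorr n' 𝓖 X Y') (μ : 𝓕.Pairing 𝓖 𝓗) :
    (c.prod d μ).IsDisjointSum (c₁.prod d μ) (c₂.prod d μ) := by
  obtain ⟨h1, h2, ⟨i, h3⟩, j, h4⟩ := isDisjointSum_iff.1 h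
  refine isDisjointSum_iff.2 ⟨?_, ?_, h3.prod (.refl d) μ, h4.prod (.refl d) μ⟩
  · rw [disjoint_iff] at h1 ⊢
    ext x
    refine ⟨fun hx => ?_, fun hx => hx.elim⟩
    have : projL n n' X.left x ∈ c₁.Z ⊓ c₂.Z := ⟨hx.1.1, hx.2.1⟩
    rw [h1] at this
    exact this.elim
  · rw [prod_Z, prod_Z, prod_Z, h2, ← inf_sup_right]
    rfl

lemma IsDisjointSum.prod_left {c c₁ c₂ : ExplicitCorr n' 𝓖 X Y'} (h : c.IsDisjointSum c₁ c₂)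
    (d : ExplicitCorr n 𝓕 X Y) (μ : 𝓕.Pairing 𝓖 𝓗) :
    (d.prod c μ).IsDisjointSum (d.prod c₁ μ) (d.prod c₂ μ) := by
  obtain ⟨h1, h2, ⟨i, h3⟩, j, h4⟩ := isDisjointSum_iff.1 h
  refine isDisjointSum_iff.2 ⟨?_, ?_, (RestrictsTo.refl d).prod h3 μ,
    (RestrictsTo.refl d).prod h4 μ⟩
  · rw [disjoint_iff] at h1 ⊢
    ext x
    refine ⟨fun hx => ?_, fun hx => hx.elim⟩
    have : projR n n' X.left x ∈ c₁.Z ⊓ c₂.Z := ⟨hx.1.2, hx.2.2⟩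
    rw [h1] at this
    exact this.elim
  · rw [prod_Z, prod_Z, prod_Z, h2, ← inf_sup_left]
    rfl

lemma closeds_preimage_eq {A B B' C : Scheme.{u}} (Z : Closeds C) {f : A ⟶ B} {g : B ⟶ C}
    {f' : A ⟶ B'} {g' : B' ⟶ C} (h : f ≫ g = f' ≫ g') :
    (Z.preimage g.continuous).preimage f.continuous =
      (Z.preimage g'.continuous).preimage f'.continuous := by
  have : ∀ x, g (f x) = g' (f' x) := fun x => by
    rw [← Scheme.Hom.comp_apply, ← Scheme.Hom.comp_apply, h]
  ext x
  change g (f x) ∈ Z ↔ g' (f' x) ∈ Z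
  rw [this]

/-- The projections of `𝔸ⁿ⁺ⁿ'` commute with base change, which yields a comparison morphism of
neighbourhoods. This is half of the argument that products respect homotopies. -/
lemma pull_prod (c : ExplicitCorr n 𝓕 X Y) (d : ExplicitCorr n' 𝓖 X Y') (μ : 𝓕.Pairing 𝓖 𝓗)
    (a : T ⟶ X) : ((c.pull a).prod (d.pull a) μ).Rel ((c.prod d μ).pull a) := by
  have hL : AffineSpace.map _ a.left ≫ projL n n' X.left =
    projL n n' T.left ≫ AffineSpace.map _ a.left := (AffineSpace.map_reindex _ _)
  have hR : AffineSpace.map _ a.left ≫ projR n n' X.left =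
    projR n n' T.left ≫ AffineSpace.map _ a.left := (AffineSpace.map_reindex _ _)
  let b := (c.pull a).prod (d.pull a) μ
  let l : b.W ⟶ (c.prod d μ).W := prodLift μ ((c.pull a).prodFst (d.pull a) μ ≫ c.pullFst a)
    ((c.pull a).prodSnd (d.pull a) μ ≫ d.pullFst a) (b.e ≫ AffineSpace.map _ a.left)
    (by rw [Category.assoc, pullFst_e, Category.assoc, hL, reassoc_of% prodFst_e])
    (by rw [Category.assoc, pullFst_e, Category.assoc, hR, reassoc_of% prodSnd_e])
  have hl : pullLift a l b.e (prodLift_e _ _ _ _ _ _) ≫ (c.prod d μ).pullFst a = l :=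
    pullLift_fst _ _ _ _
  have r : ((c.prod d μ).pull a).RestrictsTo b
      (pullLift a l b.e (prodLift_e _ _ _ _ _ _)) := by
    refine ⟨pullLift_e _ _ _ _, ?_, ?_⟩
    · rw [pull_φAt, prod_φAt, prod_φAt, pull_φAt, pull_φAt]
      refine congrArg _ (Prod.ext (φAt_congr _ ?_) (φAt_congr _ ?_))
      · rw [hl, prodLift_fst, Category.id_comp]
      · rw [hl, prodLift_snd, Category.id_comp]
    · rw [pull_gAt, prod_gAt, prod_gAt, pull_gAt, pull_gAt]
      refine Prod.ext (gAt_congr _ ?_ _ _ _) (gAt_congr _ ?_ _ _ _)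
      · rw [hl, prodLift_fst, Category.id_comp]
      · rw [hl, prodLift_snd, Category.id_comp]
  refine r.rel ?_
  refine congrArg₂ (· ⊓ ·) (closeds_preimage_eq _ hL.symm) (closeds_preimage_eq _ hR.symm)

/-- The other half, used for the projection of the line and its constant sections: the pullback to
the line is a constant homotopy. Iterated pullbacks of neighbourhoods prevent equality on the nose.
-/
lemma pull_pull_of_comp_eq_id (c : ExplicitCorr n 𝓕 X Y) (p : T ⟶ X) (a : X ⟶ T)
    (h : a ≫ p = 𝟙 X) : c.Rel ((c.pull p).pull a) := by
  have h' : AffineSpace.map (ULift.{u} (Fin n)) a.left ≫ AffineSpace.map _ p.left = 𝟙 _ := by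
    rw [← AffineSpace.map_comp, ← Over.comp_left, h, Over.id_left, AffineSpace.map_id]
  let l : c.W ⟶ (c.pull p).W := pullLift p (𝟙 _) (c.e ≫ AffineSpace.map _ a.left)
    (by rw [Category.assoc, h']; simp)
  have hl : pullLift a l c.e (pullLift_e _ _ _ _) ≫ (c.pull p).pullFst a = l := pullLift_fst _ _ _ _
  have r : ((c.pull p).pull a).RestrictsTo c (pullLift a l c.e (pullLift_e _ _ _ _)) := by
    refine ⟨pullLift_e _ _ _ _, ?_, ?_⟩
    · rw [pull_φAt, pull_φAt]
      refine φAt_congr _ ?_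
      rw [hl, pullLift_fst]
    · rw [pull_gAt, pull_gAt]
      refine gAt_congr _ ?_ _ _ _
      rw [hl, pullLift_fst]
  refine r.rel ?_
  ext x
  change _ ↔ AffineSpace.map _ p.left (AffineSpace.map _ a.left x) ∈ c.Z
  rw [← Scheme.Hom.comp_apply, h']
  rfl

end ExplicitCorr

/-- The projection from the product with the affine line. -/
def linePr (X : Sch k) : line X ⟶ X := Over.homMk (Aff.str 1 X.left) rfl

lemma lineAt_linePr (X : Sch k) (t : ℤ) : lineAt X t ≫ linePr X = 𝟙 X := by
  ext : 1
  exact AffineSpace.homOfVector_over _ _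

namespace H0

open ExplicitCorr

variable {𝔖 : FramingTheory.{u}} {X : Sch k} {Y Y' : (Sch k)ᵒᵖ ⥤ Type u}
  {n n' m : ℕ} {i i' l : 𝔖.Idx}

end H0

end

/-! ### The product on `H⁰`. -/

section

variable {k : Type u} [Field k]

namespace H0

open ExplicitCorr

variable {𝔖 : FramingTheory.{u}} {X : Sch k} {Y Y' Y'' Y₁ Y₁' : (Sch k)ᵒᵖ ⥤ Type u}
  {n n' m : ℕ} {i i' l : 𝔖.Idx}

lemma induction_on {p : H0 𝔖 X Y → Prop} (x : H0 𝔖 X Y)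
    (mk : ∀ (n : ℕ) (i : 𝔖.Idx) (c : ExplicitCorr n (𝔖.space n i) X Y), p (mk 𝔖 c))
    (zero : p 0) (neg : ∀ x, p x → p (-x)) (add : ∀ x y, p x → p y → p (x + y)) : p x := by
  obtain ⟨x, rfl⟩ := QuotientAddGroup.mk_surjective x
  obtain ⟨x, rfl⟩ := QuotientAddGroup.mk_surjective x
  have hof : ∀ s : Stable 𝔖 X Y,
      p (QuotientAddGroup.mk (QuotientAddGroup.mk (.of s) : ZF 𝔖 X Y)) := by
    intro s
    obtain ⟨⟨⟨n, i⟩, c⟩, rfl⟩ := Quot.exists_rep s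
    exact mk n i c
  induction x using FreeAbelianGroup.induction_on with
  | zero => exact zero
  | of s => exact hof s
  | neg s h => exact neg _ h
  | add a b ha hb => exact add _ _ ha hb

lemma push_mk (h : Y ⟶ Y') (c : ExplicitCorr n (𝔖.space n i) X Y) :
    push 𝔖 h (mk 𝔖 c) = mk 𝔖 (c.push h) := lift_mk _ _ _ _ _ _ _

lemma push_push (h : Y ⟶ Y') (h' : Y' ⟶ Y'') (x : H0 𝔖 X Y) :
    push 𝔖 h' (push 𝔖 h x) = push 𝔖 (h ≫ h') x := by
  induction x using H0.induction_on with
  | mk n i c => rfl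
  | zero => simp only [map_zero]
  | neg x hx => simp only [map_neg, hx]
  | add x y hx hy => simp only [map_add, hx, hy]

lemma push_id (x : H0 𝔖 X Y) : push 𝔖 (𝟙 Y) x = x := by
  induction x using H0.induction_on with
  | mk n i c => rfl
  | zero => simp only [map_zero]
  | neg x hx => simp only [map_neg, hx]
  | add x y hx hy => simp only [map_add, hx, hy]

/-- Both products restrict to the product with the common restriction `b`. -/
lemma mk_prod_congr_left {c c' : ExplicitCorr n (𝔖.space n i) X Y} (r : c.Rel c')
    (d : ExplicitCorr n' (𝔖.space n' i') X Y')
    (μ : (𝔖.space n i).Pairing (𝔖.space n' i') (𝔖.space (n + n') l)) :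
    mk 𝔖 (c.prod d μ) = mk 𝔖 (c'.prod d μ) := by
  obtain ⟨b, _, _, hZ, hZ', h, h'⟩ := r.exists_restrict
  obtain ⟨_, s⟩ := h.prod (.refl d) μ
  obtain ⟨_, s'⟩ := h'.prod (.refl d) μ
  rw [← mk_rel (s.rel (by rw [prod_Z, prod_Z, hZ])), mk_rel (s'.rel (by rw [prod_Z, prod_Z, hZ']))]

lemma mk_prod_congr_right (c : ExplicitCorr n (𝔖.space n i) X Y)
    {d d' : ExplicitCorr n' (𝔖.space n' i') X Y'} (r : d.Rel d')
    (μ : (𝔖.space n i).Pairing (𝔖.space n' i') (𝔖.space (n + n') l)) :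
    mk 𝔖 (c.prod d μ) = mk 𝔖 (c.prod d' μ) := by
  obtain ⟨b, _, _, hZ, hZ', h, h'⟩ := r.exists_restrict
  obtain ⟨_, s⟩ := (RestrictsTo.refl c).prod h μ
  obtain ⟨_, s'⟩ := (RestrictsTo.refl c).prod h' μ
  rw [← mk_rel (s.rel (by rw [prod_Z, prod_Z, hZ])), mk_rel (s'.rel (by rw [prod_Z, prod_Z, hZ']))]

lemma mk_prod_homotopy_left (c : ExplicitCorr n (𝔖.space n i) (line X) Y)
    (d : ExplicitCorr n' (𝔖.space n' i') X Y')
    (μ : (𝔖.space n i).Pairing (𝔖.space n' i') (𝔖.space (n + n') l)) :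
    mk 𝔖 ((c.pull (lineAt X 0)).prod d μ) = mk 𝔖 ((c.pull (lineAt X 1)).prod d μ) := by
  -- The factor `d` is spread out to a constant family over the line; its product with the homotopy
  -- `c` has the wanted fibre at every `t`.
  have key : ∀ t : ℤ, mk 𝔖 ((c.pull (lineAt X t)).prod d μ) =
      mk 𝔖 ((c.prod (d.pull (linePr X)) μ).pull (lineAt X t)) := fun t => by
    rw [mk_prod_congr_right _ (d.pull_pull_of_comp_eq_id _ _ (lineAt_linePr X t)),
      mk_rel (pull_prod _ _ _ _)]
  rw [key, key, mk_homotopy]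

lemma mk_prod_homotopy_right (c : ExplicitCorr n (𝔖.space n i) X Y)
    (d : ExplicitCorr n' (𝔖.space n' i') (line X) Y')
    (μ : (𝔖.space n i).Pairing (𝔖.space n' i') (𝔖.space (n + n') l)) :
    mk 𝔖 (c.prod (d.pull (lineAt X 0)) μ) = mk 𝔖 (c.prod (d.pull (lineAt X 1)) μ) := by
  have key : ∀ t : ℤ, mk 𝔖 (c.prod (d.pull (lineAt X t)) μ) =
      mk 𝔖 (((c.pull (linePr X)).prod d μ).pull (lineAt X t)) := fun t => by
    rw [mk_prod_congr_left (c.pull_pull_of_comp_eq_id _ _ (lineAt_linePr X t)),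
      mk_rel (pull_prod _ _ _ _)]
  rw [key, key, mk_homotopy]

end H0

/-- Associativity of products of presheaves. -/
def prodAssoc (Y Y' Y'' : (Sch k)ᵒᵖ ⥤ Type u) :
    FunctorToTypes.prod (FunctorToTypes.prod Y Y') Y'' ⟶
      FunctorToTypes.prod Y (FunctorToTypes.prod Y' Y'') :=
  FunctorToTypes.prod.lift (FunctorToTypes.prod.fst ≫ FunctorToTypes.prod.fst)
    (FunctorToTypes.prod.lift (FunctorToTypes.prod.fst ≫ FunctorToTypes.prod.snd)
      FunctorToTypes.prod.snd)

/-- The product of two morphisms of presheaves. -/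
def prodMap {Y Y' Y₁ Y₁' : (Sch k)ᵒᵖ ⥤ Type u} (f : Y ⟶ Y₁) (g : Y' ⟶ Y₁') :
    FunctorToTypes.prod Y Y' ⟶ FunctorToTypes.prod Y₁ Y₁' :=
  FunctorToTypes.prod.lift (FunctorToTypes.prod.fst ≫ f) (FunctorToTypes.prod.snd ≫ g)

/-- The product of correspondences is compatible with stabilisation, associative and unital, up to
stable homotopy. -/
structure StableProduct (𝔖 : FramingTheory.{u}) (k : Type u) [Field k] : Prop where
  susp_left : ∀ {X : Sch k} {Y Y' : (Sch k)ᵒᵖ ⥤ Type u} {n n' : ℕ} {i i' : 𝔖.Idx}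
    (c : ExplicitCorr n (𝔖.space n i) X Y) (d : ExplicitCorr n' (𝔖.space n' i') X Y'),
    H0.mk 𝔖 ((c.susp (𝔖.susp n i)).prod d (𝔖.sum (1 + n) i n' i')) =
      H0.mk 𝔖 (c.prod d (𝔖.sum n i n' i'))
  susp_right : ∀ {X : Sch k} {Y Y' : (Sch k)ᵒᵖ ⥤ Type u} {n n' : ℕ} {i i' : 𝔖.Idx}
    (c : ExplicitCorr n (𝔖.space n i) X Y) (d : ExplicitCorr n' (𝔖.space n' i') X Y'),
    H0.mk 𝔖 (c.prod (d.susp (𝔖.susp n' i')) (𝔖.sum n i (1 + n') i')) =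
      H0.mk 𝔖 (c.prod d (𝔖.sum n i n' i'))
  incl_left : ∀ {X : Sch k} {Y Y' : (Sch k)ᵒᵖ ⥤ Type u} {n n' : ℕ} {i i' : 𝔖.Idx}
    (c : ExplicitCorr n (𝔖.space n i) X Y) (d : ExplicitCorr n' (𝔖.space n' i') X Y'),
    H0.mk 𝔖 ((c.reframe (𝔖.incl n i)).prod d (𝔖.sum n (𝔖.next i) n' i')) =
      H0.mk 𝔖 (c.prod d (𝔖.sum n i n' i'))
  incl_right : ∀ {X : Sch k} {Y Y' : (Sch k)ᵒᵖ ⥤ Type u} {n n' : ℕ} {i i' : 𝔖.Idx}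
    (c : ExplicitCorr n (𝔖.space n i) X Y) (d : ExplicitCorr n' (𝔖.space n' i') X Y'),
    H0.mk 𝔖 (c.prod (d.reframe (𝔖.incl n' i')) (𝔖.sum n i n' (𝔖.next i'))) =
      H0.mk 𝔖 (c.prod d (𝔖.sum n i n' i'))
  assoc : ∀ {X : Sch k} {Y Y' Y'' : (Sch k)ᵒᵖ ⥤ Type u} {n n' n'' : ℕ} {i i' i'' : 𝔖.Idx}
    (c : ExplicitCorr n (𝔖.space n i) X Y) (d : ExplicitCorr n' (𝔖.space n' i') X Y')
    (e : ExplicitCorr n'' (𝔖.space n'' i'') X Y''),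
    H0.mk 𝔖 (((c.prod d (𝔖.sum n i n' i')).prod e
        (𝔖.sum (n + n') (𝔖.addIdx i i') n'' i'')).push (prodAssoc Y Y' Y'')) =
      H0.mk 𝔖 (c.prod (d.prod e (𝔖.sum n' i' n'' i'')) (𝔖.sum n i (n' + n'') (𝔖.addIdx i' i'')))
  one_left : ∀ {X : Sch k} {Y Y' : (Sch k)ᵒᵖ ⥤ Type u} {n : ℕ} {i : 𝔖.Idx}
    (s : Y.obj (op X)) (c : ExplicitCorr n (𝔖.space n i) X Y'),
    H0.mk 𝔖 (((ExplicitCorr.ofSection s (𝔖.origin _) (𝔖.zero_origin _)).prod c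
      (𝔖.sum 0 𝔖.zeroIdx n i)).push FunctorToTypes.prod.snd) = H0.mk 𝔖 c
  one_right : ∀ {X : Sch k} {Y Y' : (Sch k)ᵒᵖ ⥤ Type u} {n : ℕ} {i : 𝔖.Idx}
    (s : Y'.obj (op X)) (c : ExplicitCorr n (𝔖.space n i) X Y),
    H0.mk 𝔖 ((c.prod (ExplicitCorr.ofSection s (𝔖.origin _) (𝔖.zero_origin _))
      (𝔖.sum n i 0 𝔖.zeroIdx)).push FunctorToTypes.prod.fst) = H0.mk 𝔖 c

namespace StableProduct

variable {𝔖 : FramingTheory.{u}} (P : StableProduct 𝔖 k) {X : Sch k}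
  {Y Y' Y'' Y₁ Y₁' : (Sch k)ᵒᵖ ⥤ Type u} {n n' m : ℕ} {i i' l : 𝔖.Idx}

/-- The product with the class of a correspondence. -/
def mulCorr (c : ExplicitCorr n (𝔖.space n i) X Y) :
    H0 𝔖 X Y' →+ H0 𝔖 X (FunctorToTypes.prod Y Y') :=
  H0.lift (fun n' i' d => H0.mk 𝔖 (c.prod d (𝔖.sum n i n' i')))
    (fun _ _ _ _ r => H0.mk_prod_congr_right c r _)
    (fun _ _ d => P.susp_right c d)
    (fun _ _ d => P.incl_right c d)
    (fun _ _ _ _ _ h => H0.mk_sum (h.prod_left c _))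
    (fun _ _ d => H0.mk_prod_homotopy_right c d _)

lemma mulCorr_mk (c : ExplicitCorr n (𝔖.space n i) X Y)
    (d : ExplicitCorr n' (𝔖.space n' i') X Y') :
    P.mulCorr c (H0.mk 𝔖 d) = H0.mk 𝔖 (c.prod d (𝔖.sum n i n' i')) := H0.lift_mk _ _ _ _ _ _ _

/-- The product on `H⁰`. -/
def mul (X : Sch k) (Y Y' : (Sch k)ᵒᵖ ⥤ Type u) :
    H0 𝔖 X Y →+ H0 𝔖 X Y' →+ H0 𝔖 X (FunctorToTypes.prod Y Y') :=
  H0.lift (fun _ _ c => P.mulCorr c)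
    (fun _ _ _ _ r => H0.hom_ext fun _ _ d => by
      rw [mulCorr_mk, mulCorr_mk, H0.mk_prod_congr_left r])
    (fun _ _ c => H0.hom_ext fun _ _ d => by
      rw [mulCorr_mk, mulCorr_mk, P.susp_left])
    (fun _ _ c => H0.hom_ext fun _ _ d => by
      rw [mulCorr_mk, mulCorr_mk, P.incl_left])
    (fun _ _ _ _ _ h => H0.hom_ext fun _ _ d => by
      rw [AddMonoidHom.add_apply, mulCorr_mk, mulCorr_mk, mulCorr_mk, H0.mk_sum (h.prod_right d _)])
    (fun _ _ c => H0.hom_ext fun _ _ d => by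
      rw [mulCorr_mk, mulCorr_mk, H0.mk_prod_homotopy_left])

lemma mul_mk (c : ExplicitCorr n (𝔖.space n i) X Y) (d : ExplicitCorr n' (𝔖.space n' i') X Y') :
    P.mul X Y Y' (H0.mk 𝔖 c) (H0.mk 𝔖 d) = H0.mk 𝔖 (c.prod d (𝔖.sum n i n' i')) :=
  (DFunLike.congr_fun (H0.lift_mk _ _ _ _ _ _ c) _).trans (P.mulCorr_mk c d)

lemma mul_push (f : Y ⟶ Y₁) (g : Y' ⟶ Y₁') (x : H0 𝔖 X Y) (y : H0 𝔖 X Y') :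
    P.mul X Y₁ Y₁' (H0.push 𝔖 f x) (H0.push 𝔖 g y) =
      H0.push 𝔖 (prodMap f g) (P.mul X Y Y' x y) := by
  induction x using H0.induction_on with
  | mk n i c =>
    induction y using H0.induction_on with
    | mk n' i' d =>
      rw [H0.push_mk, H0.push_mk, mul_mk, mul_mk, H0.push_mk]
      refine congrArg (H0.mk 𝔖) (ExplicitCorr.ext_g ((c.prod d (𝔖.sum n i n' i')).push
        (prodMap f g)) ?_)
      exact Prod.ext (ExplicitCorr.naturality' f _ _) (ExplicitCorr.naturality' g _ _)
    | zero => simp only [map_zero]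
    | neg x hx => simp only [map_neg, hx]
    | add x y hx hy => simp only [map_add, hx, hy]
  | zero => simp only [map_zero, AddMonoidHom.zero_apply]
  | neg x hx => simp only [map_neg, AddMonoidHom.neg_apply, hx]
  | add x y hx hy => simp only [map_add, AddMonoidHom.add_apply, hx, hy]

lemma mul_assoc (x : H0 𝔖 X Y) (y : H0 𝔖 X Y') (z : H0 𝔖 X Y'') :
    H0.push 𝔖 (prodAssoc Y Y' Y'') (P.mul _ _ _ (P.mul _ _ _ x y) z) =
      P.mul _ _ _ x (P.mul _ _ _ y z) := by
  induction x using H0.induction_on with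
  | mk n i c =>
    induction y using H0.induction_on with
    | mk n' i' d =>
      induction z using H0.induction_on with
      | mk n'' i'' e => rw [mul_mk, mul_mk, mul_mk, mul_mk, H0.push_mk, P.assoc]
      | zero => simp only [map_zero]
      | neg x hx => simp only [map_neg, hx]
      | add x y hx hy => simp only [map_add, hx, hy]
    | zero => simp only [map_zero, AddMonoidHom.zero_apply]
    | neg x hx => simp only [map_neg, AddMonoidHom.neg_apply, hx]
    | add x y hx hy => simp only [map_add, AddMonoidHom.add_apply, hx, hy]
  | zero => simp only [map_zero, AddMonoidHom.zero_apply]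
  | neg x hx => simp only [map_neg, AddMonoidHom.neg_apply, hx]
  | add x y hx hy => simp only [map_add, AddMonoidHom.add_apply, hx, hy]

/-- Any section `s` serves as a unit once its component is forgotten. For `𝔾ₘ⁰` nothing is lost in
forgetting it, since appending an empty tuple is the projection up to a cast. -/
lemma one_mul (s : Y.obj (op X)) (x : H0 𝔖 X Y') :
    H0.push 𝔖 FunctorToTypes.prod.snd (P.mul _ _ _ (H0.mk 𝔖
      (ExplicitCorr.ofSection s (𝔖.origin _) (𝔖.zero_origin _))) x) = x := by
  induction x using H0.induction_on with
  | mk n i c => rw [mul_mk, H0.push_mk, P.one_left]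
  | zero => simp only [map_zero]
  | neg x hx => simp only [map_neg, hx]
  | add x y hx hy => simp only [map_add, hx, hy]

lemma mul_one (s : Y'.obj (op X)) (x : H0 𝔖 X Y) :
    H0.push 𝔖 FunctorToTypes.prod.fst (P.mul _ _ _ x (H0.mk 𝔖
      (ExplicitCorr.ofSection s (𝔖.origin _) (𝔖.zero_origin _)))) = x := by
  induction x using H0.induction_on with
  | mk n i c => rw [mul_mk, H0.push_mk, P.one_right]
  | zero => simp only [map_zero, AddMonoidHom.zero_apply]
  | neg x hx => simp only [map_neg, AddMonoidHom.neg_apply, hx]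
  | add x y hx hy => simp only [map_add, AddMonoidHom.add_apply, hx, hy]

/-- The external product of classes of correspondences to powers of `𝔾ₘ`. -/
def extMul (m m' : ℕ) : H0 𝔖 (pt k) (Gm k m) →+ H0 𝔖 (pt k) (Gm k m') →+
    H0 𝔖 (pt k) (Gm k (m + m')) :=
  (AddMonoidHom.compHom (H0.push 𝔖 (Gm.append k m m'))).comp (P.mul (pt k) (Gm k m) (Gm k m'))

lemma extMul_apply {m m' : ℕ} (x : H0 𝔖 (pt k) (Gm k m)) (y : H0 𝔖 (pt k) (Gm k m')) :
    P.extMul m m' x y = H0.push 𝔖 (Gm.append k m m') (P.mul _ _ _ x y) := rfl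

lemma isExternalProduct : IsExternalProduct 𝔖 k P.extMul := fun m m' n n' i i' c c' => by
  rw [extMul_apply, mul_mk, H0.push_mk]; rfl

end StableProduct

end

/-! ### The graded rings of powers of `𝔾ₘ`, and the comparison map. -/

section

variable {k : Type u} [Field k]

/-- The identification of `𝔾ₘᵐ` and `𝔾ₘᵐ'` for `m = m'`. -/
def Gm.cast (k : Type u) [Field k] {m m' : ℕ} (h : m = m') : Gm k m ⟶ Gm k m' where
  app W := TypeCat.ofHom fun y => y ∘ Fin.cast h.symm
  naturality W W' f := by ext y; rfl

lemma Gm.cast_rfl (m : ℕ) : Gm.cast k (rfl : m = m) = 𝟙 _ := by ext W y; rfl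

lemma Gm.append_assoc (m m' m'' : ℕ) :
    prodMap (Gm.append k m m') (𝟙 (Gm k m'')) ≫ Gm.append k (m + m') m'' ≫
        Gm.cast k (Nat.add_assoc m m' m'') =
      prodAssoc _ _ _ ≫ prodMap (𝟙 (Gm k m)) (Gm.append k m' m'') ≫ Gm.append k m (m' + m'') := by
  ext W ⟨⟨a, b⟩, c⟩
  funext j
  exact congrFun (Fin.append_assoc a b c) (Fin.cast _ j) |>.trans rfl

lemma Gm.append_zero_left (m : ℕ) :
    Gm.append k 0 m ≫ Gm.cast k (Nat.zero_add m) = FunctorToTypes.prod.snd := by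
  ext W ⟨a, b⟩
  funext j
  exact congrFun (Fin.append_left_nil a b rfl) (Fin.cast _ j)

lemma Gm.append_zero_right (m : ℕ) :
    Gm.append k m 0 = FunctorToTypes.prod.fst := by
  ext W ⟨a, b⟩
  funext j
  exact congrFun (Fin.append_right_nil a b rfl) j

lemma fin_append_update_left {α : Type*} {m m' : ℕ} (a : Fin m → α) (b : Fin m' → α) (i : Fin m)
    (x : α) : Fin.append (Function.update a i x) b =
      Function.update (Fin.append a b) (Fin.castAdd m' i) x := by
  funext j
  refine Fin.addCases (fun j => ?_) (fun j => ?_) j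
  · rw [Fin.append_left]
    by_cases h : j = i
    · rw [h, Function.update_self, Function.update_self]
    · rw [Function.update_of_ne h, Function.update_of_ne
        (fun h' => h (Fin.castAdd_injective _ _ h')), Fin.append_left]
  · rw [Fin.append_right, Function.update_of_ne (fun h => by
      have := congrArg Fin.val h; simp at this; omega), Fin.append_right]

lemma fin_append_update_right {α : Type*} {m m' : ℕ} (a : Fin m → α) (b : Fin m' → α) (i : Fin m')
    (x : α) : Fin.append a (Function.update b i x) =
      Function.update (Fin.append a b) (Fin.natAdd m i) x := by
  funext j
  refine Fin.addCases (fun j => ?_) (fun j => ?_) j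
  · rw [Fin.append_left, Function.update_of_ne (fun h => by
      have := congrArg Fin.val h; simp at this; omega), Fin.append_left]
  · rw [Fin.append_right]
    by_cases h : j = i
    · rw [h, Function.update_self, Function.update_self]
    · rw [Function.update_of_ne h, Function.update_of_ne
        (fun h' => h (Fin.natAdd_injective _ _ h')), Fin.append_right]

/-- The idempotents of the two factors become idempotents of the product with shifted indices; this
drives the restriction to the summands. -/
lemma prodMap_coordOne_left {m : ℕ} (m' : ℕ) (i : Fin m) :
    prodMap (coordOne k i) (𝟙 (Gm k m')) ≫ Gm.append k m m' =
      Gm.append k m m' ≫ coordOne k (Fin.castAdd m' i) := by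
  ext W ⟨a, b⟩
  exact fin_append_update_left (α := Γ(W.unop.left, ⊤)ˣ) a b i 1

lemma prodMap_coordOne_right (m : ℕ) {m' : ℕ} (i : Fin m') :
    prodMap (𝟙 (Gm k m)) (coordOne k i) ≫ Gm.append k m m' =
      Gm.append k m m' ≫ coordOne k (Fin.natAdd m i) := by
  ext W ⟨a, b⟩
  exact fin_append_update_right (α := Γ(W.unop.left, ⊤)ˣ) a b i 1

namespace StableProduct

variable {𝔖 : FramingTheory.{u}} (P : StableProduct 𝔖 k)

lemma extMul_oneSub_left {m m' : ℕ} (i : Fin m) (x : H0 𝔖 (pt k) (Gm k m))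
    (y : H0 𝔖 (pt k) (Gm k m')) :
    P.extMul m m' (oneSub 𝔖 k i x) y = oneSub 𝔖 k (Fin.castAdd m' i) (P.extMul m m' x y) := by
  have : P.extMul m m' (H0.push 𝔖 (coordOne k i) x) y =
      H0.push 𝔖 (coordOne k (Fin.castAdd m' i)) (P.extMul m m' x y) := by
    rw [extMul_apply, extMul_apply, H0.push_push, ← prodMap_coordOne_left, ← H0.push_push,
      ← mul_push, H0.push_id]
  change P.extMul m m' (x - _) y = P.extMul m m' x y - _
  rw [map_sub, AddMonoidHom.sub_apply, this]

lemma extMul_oneSub_right {m m' : ℕ} (i : Fin m') (x : H0 𝔖 (pt k) (Gm k m))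
    (y : H0 𝔖 (pt k) (Gm k m')) :
    P.extMul m m' x (oneSub 𝔖 k i y) = oneSub 𝔖 k (Fin.natAdd m i) (P.extMul m m' x y) := by
  have : P.extMul m m' x (H0.push 𝔖 (coordOne k i) y) =
      H0.push 𝔖 (coordOne k (Fin.natAdd m i)) (P.extMul m m' x y) := by
    rw [extMul_apply, extMul_apply, H0.push_push, ← prodMap_coordOne_right, ← H0.push_push,
      ← mul_push, H0.push_id]
  change P.extMul m m' x (y - _) = P.extMul m m' x y - _
  rw [map_sub, this]

/-- The `m + m'` factors `1 - eᵢ` split into the first `m`, which come from `x`, and the last `m'`,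
which come from `y`. They are pulled out in the order in which `List.ofFn_add` lists them, so
commutativity of the `eᵢ` plays no role. -/
lemma extMul_wedgeProj {m m' : ℕ} (x : H0 𝔖 (pt k) (Gm k m)) (y : H0 𝔖 (pt k) (Gm k m')) :
    P.extMul m m' (wedgeProj 𝔖 k m x) (wedgeProj 𝔖 k m' y) =
      wedgeProj 𝔖 k (m + m') (P.extMul m m' x y) := by
  have left : ∀ (l : List (Fin m)) (y : H0 𝔖 (pt k) (Gm k m')),
      P.extMul m m' ((l.map fun i => oneSub 𝔖 k i).prod x) y =
        (l.map fun i => oneSub 𝔖 k (Fin.castAdd m' i)).prod (P.extMul m m' x y) := by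
    intro l y
    induction l with
    | nil => rfl
    | cons i l ih =>
      simp only [List.map_cons, List.prod_cons]
      exact (P.extMul_oneSub_left _ _ _).trans (congrArg _ ih)
  have right : ∀ l : List (Fin m'),
      P.extMul m m' x ((l.map fun i => oneSub 𝔖 k i).prod y) =
        (l.map fun i => oneSub 𝔖 k (Fin.natAdd m i)).prod (P.extMul m m' x y) := by
    intro l
    induction l with
    | nil => rfl
    | cons i l ih =>
      simp only [List.map_cons, List.prod_cons]
      exact (P.extMul_oneSub_right _ _ _).trans (congrArg _ ih)
  have hl := left (List.finRange m) (wedgeProj 𝔖 k m' y)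
  have hr := right (List.finRange m')
  simp only [← List.ofFn_eq_map] at hl hr
  refine hl.trans ((congrArg _ hr).trans ?_)
  rw [wedgeProj, List.ofFn_add, List.prod_append]
  rfl

/-- The multiplication on the summands. -/
def wedgeMul {m m' : ℕ} (x : WedgeH0 𝔖 k m) (y : WedgeH0 𝔖 k m') : WedgeH0 𝔖 k (m + m') :=
  ⟨P.extMul m m' x y, by
    obtain ⟨⟨_, x, rfl⟩, _, y, rfl⟩ := x, y
    exact ⟨P.extMul m m' x y, (P.extMul_wedgeProj x y).symm⟩⟩

/-- The unit. -/
def wedgeOne (𝔖 : FramingTheory.{u}) (k : Type u) [Field k] : WedgeH0 𝔖 k 0 :=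
  ⟨H0.mk 𝔖 (unitCorr 𝔖 k), H0.mk 𝔖 (unitCorr 𝔖 k), by rw [wedgeProj, List.ofFn_zero]; rfl⟩

/-- The ring axioms compare elements in degrees that agree only propositionally, such as `m + m' +
m''` and `m + (m' + m'')`. The comparison is made by pushing forward along the identification of the
powers of `𝔾ₘ`. -/
lemma gradedMk_eq {m m' : ℕ} (h : m = m') {x : WedgeH0 𝔖 k m} {y : WedgeH0 𝔖 k m'}
    (e : H0.push 𝔖 (Gm.cast k h) (x : H0 𝔖 (pt k) (Gm k m)) = y) :
    (GradedMonoid.mk m x : GradedMonoid fun m : ℕ => WedgeH0 𝔖 k m) = GradedMonoid.mk m' y := by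
  subst h
  rw [Gm.cast_rfl, H0.push_id] at e
  rw [Subtype.ext e]

/-- The graded ring structure. -/
@[reducible]
def gRing : DirectSum.GRing (fun m : ℕ => WedgeH0 𝔖 k m) :=
  letI : GradedMonoid.GOne (fun m : ℕ => WedgeH0 𝔖 k m) := ⟨wedgeOne 𝔖 k⟩
  letI : GradedMonoid.GMul (fun m : ℕ => WedgeH0 𝔖 k m) := ⟨fun x y => P.wedgeMul x y⟩
{ mul := fun x y => P.wedgeMul x y
  mul_zero := fun x => Subtype.ext (map_zero _)
  zero_mul := fun y => Subtype.ext (by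
    change P.extMul _ _ 0 _ = 0
    rw [map_zero, AddMonoidHom.zero_apply])
  mul_add := fun x y z => Subtype.ext (map_add _ _ _)
  add_mul := fun x y z => Subtype.ext (by
    change P.extMul _ _ (_ + _) _ = _
    rw [map_add, AddMonoidHom.add_apply]; rfl)
  one := wedgeOne 𝔖 k
  one_mul := fun ⟨m, x⟩ => gradedMk_eq (Nat.zero_add m) (by
    change H0.push 𝔖 _ (P.extMul _ _ _ _) = _
    rw [extMul_apply, H0.push_push, Gm.append_zero_left]
    exact P.one_mul _ _)
  -- Here `m + 0` reduces to `m`, so the identification is the identity, unlike for `one_mul`.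
  mul_one := fun ⟨m, x⟩ => gradedMk_eq (Nat.add_zero m) (by
    change H0.push 𝔖 _ (P.extMul _ _ _ _) = _
    rw [Gm.cast_rfl, H0.push_id, extMul_apply, Gm.append_zero_right]
    exact P.mul_one _ _)
  mul_assoc := fun ⟨m, x⟩ ⟨m', y⟩ ⟨m'', z⟩ => gradedMk_eq (Nat.add_assoc m m' m'') (by
    change H0.push 𝔖 _ (P.extMul _ _ (P.extMul _ _ _ _) _) = P.extMul _ _ _ (P.extMul _ _ _ _)
    -- Each bracketing is written as a single pushforward of a double product `P.mul`; what remains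
    -- is associativity of `P.mul` and of `Gm.append`.
    have h1 : P.extMul (m + m') m'' (P.extMul m m' x y) z =
        H0.push 𝔖 (prodMap (Gm.append k m m') (𝟙 _) ≫ Gm.append k (m + m') m'')
          (P.mul _ _ _ (P.mul _ _ _ x y) z) := by
      rw [extMul_apply, extMul_apply, ← H0.push_push, ← mul_push, H0.push_id]
    have h2 : P.extMul m (m' + m'') x (P.extMul m' m'' y z) =
        H0.push 𝔖 (prodMap (𝟙 _) (Gm.append k m' m'') ≫ Gm.append k m (m' + m''))
          (P.mul _ _ _ x (P.mul _ _ _ y z)) := by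
      rw [extMul_apply, extMul_apply, ← H0.push_push, ← mul_push, H0.push_id]
    rw [h1, h2, H0.push_push, Category.assoc, Gm.append_assoc, ← H0.push_push, P.mul_assoc])
  natCast := fun n => n • wedgeOne 𝔖 k
  natCast_zero := zero_smul ℕ _
  natCast_succ := fun n => succ_nsmul _ _
  intCast := fun n => n • wedgeOne 𝔖 k
  intCast_ofNat := fun n => natCast_zsmul _ _
  intCast_negSucc_ofNat := fun n => negSucc_zsmul _ _ }

lemma isProductRing : letI := P.gRing; IsProductRing 𝔖 k P.extMul :=
  ⟨fun _ _ _ _ => rfl, rfl⟩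

end StableProduct

/-- The auxiliary blocks are empty, so the interchange of blocks is invisible, and a block sum of
identity matrices is an identity matrix. -/
lemma one_blockSum_cobMap {R : Type u} [CommRing R] {S : Type u} [CommRing S]
    (f f' f'' : R →+* S) {n n' : ℕ} :
    (zeroCols (Equiv.refl (Fin (n + n') ⊕ Fin 0))
        (1 : Matrix (Fin (n + n')) (Fin (n + n')) R)).map f'' =
      blockSum finSumFinEquiv ((Equiv.sumSumSumComm (Fin n) (Fin 0) (Fin n') (Fin 0)).trans
      (Equiv.sumCongr finSumFinEquiv finSumFinEquiv))
        ((zeroCols (Equiv.refl (Fin n ⊕ Fin 0)) (1 : Matrix (Fin n) (Fin n) R)).map f)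
        ((zeroCols (Equiv.refl (Fin n' ⊕ Fin 0)) (1 : Matrix (Fin n') (Fin n') R)).map f') := by
  ext i j
  obtain ⟨i, rfl⟩ := finSumFinEquiv.surjective i
  obtain ⟨j, rfl⟩ := ((Equiv.sumSumSumComm (Fin n) (Fin 0) (Fin n') (Fin 0)).trans
      (Equiv.sumCongr finSumFinEquiv finSumFinEquiv)).surjective j
  rcases i with i | i <;> rcases j with (j | j) | (j | j)
  all_goals first
    | exact j.elim0
    | skip
  · simp [Matrix.one_apply, apply_ite f, apply_ite f'']
  · have : Fin.castAdd n' i ≠ Fin.natAdd n j := fun h => by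
      have := congrArg Fin.val h; simp at this; omega
    simp [this]
  · have : Fin.natAdd n i ≠ Fin.castAdd n' j := fun h => by
      have := congrArg Fin.val h; simp at this; omega
    simp [this]
  · simp [Matrix.one_apply, apply_ite f', apply_ite f'']

/-- Behind the multiplicativity of `Hcob`: a sum of trivialised quotients is trivialised by the
joint coordinates. `N = 0` suffices because `Hcob` is defined at that index. The sum is a datum on
`⊤ ⊓ ⊤`, which is why `of_res` is needed. -/
lemma cobMap_sum (n n' : ℕ) (W : Scheme.{u}) (φ : (affineSpace (Fin n)).sec.obj (op W))
    (ψ : (affineSpace (Fin n')).sec.obj (op W)) :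
    (cobordism.sum n (0 : ℕ) n' (0 : ℕ)).hom.app (op W)
        ((cobMap n 0).hom.app _ φ, (cobMap n' 0).hom.app _ ψ) =
      (cobMap (n + n') 0).hom.app _ ((framed.sum n () n' ()).hom.app (op W) (φ, ψ)) := by
  refine (Quot.sound (TauDatum.Equiv.of_res (fun y => (le_top : ⊤ ⊓ ⊤ ≤ (⊤ : W.Opens))) ?_ ?_)).symm
  · intro y
    exact one_blockSum_cobMap (resHom W _) (resHom W _) (resHom W _)
  · intro y
    exact vecSum_map (resHom W _) finSumFinEquiv φ ψ

/-- Reframing leaves supports, neighbourhoods and sections untouched, so the two sides can differ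
only in their framing and are equal on the nose. -/
lemma ExplicitCorr.reframe_prod {n n' : ℕ} {𝓕 𝓕' 𝓖 𝓖' 𝓗 𝓗' : FramingSpace.{u}} {X : Sch k}
    {Y Y' : (Sch k)ᵒᵖ ⥤ Type u} (c : ExplicitCorr n 𝓕 X Y) (d : ExplicitCorr n' 𝓖 X Y')
    (μ : 𝓕.Pairing 𝓖 𝓗) (μ' : 𝓕'.Pairing 𝓖' 𝓗') (η : 𝓕.Hom 𝓕') (θ : 𝓖.Hom 𝓖') (κ : 𝓗.Hom 𝓗')
    (H : ∀ (W : Scheme.{u}) (φ : 𝓕.sec.obj (op W)) (ψ : 𝓖.sec.obj (op W)),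
      μ'.hom.app (op W) (η.hom.app _ φ, θ.hom.app _ ψ) = κ.hom.app _ (μ.hom.app (op W) (φ, ψ))) :
    (c.reframe η).prod (d.reframe θ) μ' = (c.prod d μ).reframe κ :=
  ExplicitCorr.ext_φ ((c.prod d μ).reframe κ) (by
    refine Eq.trans ?_ (H _ _ _)
    exact congrArg (μ'.hom.app _)
      (Prod.ext (naturality_hom η _ _) (naturality_hom θ _ _))) _ _

lemma Hcob_mul (P : StableProduct framed.{u} k) (Q : StableProduct cobordism.{u} k) {X : Sch k}
    {Y Y' : (Sch k)ᵒᵖ ⥤ Type u} (x : H0 framed X Y) (y : H0 framed X Y') :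
    Hcob _ _ (P.mul _ _ _ x y) = Q.mul _ _ _ (Hcob _ _ x) (Hcob _ _ y) := by
  induction x using H0.induction_on with
  | mk n i c =>
    induction y using H0.induction_on with
    | mk n' i' d =>
      rw [StableProduct.mul_mk]
      exact (congrArg (H0.mk cobordism) (ExplicitCorr.reframe_prod c d _
        (cobordism.sum n (0 : ℕ) n' (0 : ℕ)) _ _ _ (cobMap_sum n n'))).symm.trans
        (Q.mul_mk (i := (0 : ℕ)) (i' := (0 : ℕ)) _ _).symm
    | zero => simp only [map_zero]
    | neg x hx => simp only [map_neg, hx]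
    | add x y hx hy => simp only [map_add, hx, hy]
  | zero => simp only [map_zero, AddMonoidHom.zero_apply]
  | neg x hx => simp only [map_neg, AddMonoidHom.neg_apply, hx]
  | add x y hx hy => simp only [map_add, AddMonoidHom.add_apply, hx, hy]

lemma wedgeHcob_mul (P : StableProduct framed.{u} k) (Q : StableProduct cobordism.{u} k) {m m' : ℕ}
    (x : WedgeH0 framed k m) (y : WedgeH0 framed k m') :
    wedgeHcob k (m + m') (P.wedgeMul x y) = Q.wedgeMul (wedgeHcob k m x) (wedgeHcob k m' y) := by
  refine Subtype.ext ?_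
  change Hcob _ _ (P.extMul _ _ _ _) = Q.extMul _ _ (Hcob _ _ _) (Hcob _ _ _)
  rw [StableProduct.extMul_apply, Hcob_push, Hcob_mul P Q]
  rfl

/-- The level `0` cobordism framing is defined as the image of the framed one under `cobMap 0 0`, so
the unit correspondences match definitionally. -/
lemma wedgeHcob_one : wedgeHcob k 0 (StableProduct.wedgeOne framed k) =
    StableProduct.wedgeOne cobordism k := by
  refine Subtype.ext ?_
  refine congrArg (H0.mk cobordism) ?_
  exact ExplicitCorr.ext_φ (unitCorr cobordism k) rfl _ _

theorem exists_graded_ring_hom (P : StableProduct framed.{u} k) (Q : StableProduct cobordism.{u} k) :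
    letI := P.gRing; letI := Q.gRing
    ∃ f : DirectSum ℕ (fun m => WedgeH0 framed k m) →+* DirectSum ℕ (fun m => WedgeH0 cobordism k m),
      ∀ (m : ℕ) (x : WedgeH0 framed k m),
        f (DirectSum.of (fun m => WedgeH0 framed k m) m x) =
          DirectSum.of (fun m => WedgeH0 cobordism k m) m (wedgeHcob k m x) := by
  let := P.gRing
  let := Q.gRing
  refine ⟨DirectSum.toSemiring
    (fun m => (DirectSum.of (fun m => WedgeH0 cobordism k m) m).comp (wedgeHcob k m)) ?_ ?_, ?_⟩
  · exact congrArg (DirectSum.of (fun m => WedgeH0 cobordism k m) 0) wedgeHcob_one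
  · intro m m' x y
    exact (congrArg (DirectSum.of (fun m => WedgeH0 cobordism k m) (m + m'))
      (wedgeHcob_mul P Q x y)).trans (DirectSum.of_mul_of _ _).symm
  · intro m x
    exact DirectSum.toSemiring_of _ _ _ _ _

end

/-! ### Permutations of the coordinates of affine space. -/

section

variable {k : Type u} [Field k]

namespace ExplicitCorr

variable {n n' n'' m m' : ℕ} {𝓕 𝓖 𝓗 𝓚 𝓛 𝓜 : FramingSpace.{u}} {X T S : Sch k}
  {Y Y' Y'' : (Sch k)ᵒᵖ ⥤ Type u}

lemma isEtaleNbhd_isIso_comp {W W' A : Scheme.{u}} {e : W ⟶ A} {Z : Closeds A}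
    (h : IsEtaleNbhd e Z) (i : W' ⟶ W) [IsIso i] : IsEtaleNbhd (i ≫ e) Z := by
  obtain ⟨h1, h2⟩ := h
  refine ⟨inferInstance, ?_⟩
  have : pullback.snd (i ≫ e) (redι Z) = pullback.map (i ≫ e) (redι Z) e (redι Z) i (𝟙 _) (𝟙 _)
      (by simp) (by simp) ≫ pullback.snd e (redι Z) :=
    ((pullback.lift_snd _ _ _).trans (Category.comp_id _)).symm
  rw [this]
  infer_instance

/-- Up to an isomorphism of neighbourhoods, composing with `α` is base change along `α.inv`. -/
lemma isEtaleNbhd_comp_iso {W A A' : Scheme.{u}} {e : W ⟶ A} {Z : Closeds A} (h : IsEtaleNbhd e Z)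
    (α : A ≅ A') : IsEtaleNbhd (e ≫ α.hom) (Z.preimage α.inv.continuous) := by
  have h1 := h.pullback α.inv (Z.preimage α.inv.continuous) (fun x hx => hx)
  have h2 : pullback.snd e α.inv = pullback.fst e α.inv ≫ e ≫ α.hom := by
    rw [pullback.condition_assoc, α.inv_hom_id, Category.comp_id]
  have h3 : inv (pullback.fst e α.inv) ≫ pullback.snd e α.inv = e ≫ α.hom := by
    rw [h2, IsIso.inv_hom_id_assoc]
  rw [← h3]
  exact isEtaleNbhd_isIso_comp h1 _

/-- Transport of a correspondence along an isomorphism of affine spaces, with a new framing that has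
the same zeros. -/
def move (c : ExplicitCorr n 𝓕 X Y) (α : Aff n X.left ≅ Aff n' X.left)
    (hα : α.hom ≫ Aff.str n' X.left = Aff.str n X.left) (φ : 𝓖.sec.obj (op c.W))
    (hφ : 𝓖.zero φ = 𝓕.zero c.φ) : ExplicitCorr n' 𝓖 X Y where
  Z := c.Z.preimage α.inv.continuous
  finite := by
    obtain ⟨r, hr⟩ := exists_redMap α.inv c.Z (c.Z.preimage α.inv.continuous) (fun x hx => hx)
    have := c.finite
    have hα' : α.inv ≫ Aff.str n X.left = Aff.str n' X.left := by rw [← hα, α.inv_hom_id_assoc]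
    refine isFinite_of_coords _ (redι c.Z ≫ Aff.str n X.left) r ?_
      (fun i => (redι c.Z ≫ α.hom).appTop (Aff.coord _ i)) ?_
    · rw [reassoc_of% hr, hα']
    · intro i
      rw [← CommRingCat.comp_apply, ← Scheme.Hom.comp_appTop, reassoc_of% hr, α.inv_hom_id,
        Category.comp_id]
  W := c.W
  e := c.e ≫ α.hom
  nbhd := isEtaleNbhd_comp_iso c.nbhd α
  φ := φ
  zero_eq := by
    rw [hφ, c.zero_eq]
    ext x
    change c.e x ∈ c.Z ↔ α.inv ((c.e ≫ α.hom) x) ∈ c.Z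
    rw [← Scheme.Hom.comp_apply, Category.assoc, α.hom_inv_id, Category.comp_id]
  g := c.gAt (𝟙 _) _ (by rw [Category.id_comp, Category.assoc, reassoc_of% hα])

section Move

variable (c : ExplicitCorr n 𝓕 X Y) (α : Aff n X.left ≅ Aff n' X.left)
    (hα : α.hom ≫ Aff.str n' X.left = Aff.str n X.left) (φ : 𝓖.sec.obj (op c.W))
    (hφ : 𝓖.zero φ = 𝓕.zero c.φ)

lemma move_gAt {V : Scheme.{u}} (j : V ⟶ c.W) (h) (w) :
    (c.move α hα φ hφ).gAt j h w = c.gAt j h (by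
      rw [← w]
      change _ = j ≫ (c.e ≫ α.hom) ≫ _
      rw [Category.assoc, reassoc_of% hα]) :=
  map_map_op _ _ _ _ (by ext; exact Category.comp_id _) _

end Move

lemma comp_appTop_apply {A B C : Scheme.{u}} (f : A ⟶ B) (g : B ⟶ C) (x : Γ(C, ⊤)) :
    (f ≫ g).appTop x = f.appTop (g.appTop x) := by
  rw [Scheme.Hom.comp_appTop]; rfl

lemma aff_hom_ext {V B : Scheme.{u}} {f g : V ⟶ Aff n B} (h : f ≫ Aff.str n B = g ≫ Aff.str n B)
    (h' : ∀ i, f.appTop (Aff.coord B i) = g.appTop (Aff.coord B i)) : f = g :=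
  AffineSpace.hom_ext h fun i => h' i.down

/-- The isomorphism of affine spaces that permutes the coordinates. -/
def permIso (σ : Fin n ≃ Fin n') (B : Scheme.{u}) : Aff n B ≅ Aff n' B where
  hom := AffineSpace.reindex (fun i => ULift.up (σ.symm i.down)) B
  inv := AffineSpace.reindex (fun i => ULift.up (σ i.down)) B
  hom_inv_id := aff_hom_ext (by simp) fun i => by
    rw [comp_appTop_apply, AffineSpace.reindex_appTop_coord, AffineSpace.reindex_appTop_coord]
    simp
  inv_hom_id := aff_hom_ext (by simp) fun i => by
    rw [comp_appTop_apply, AffineSpace.reindex_appTop_coord, AffineSpace.reindex_appTop_coord]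
    simp

lemma permIso_over (σ : Fin n ≃ Fin n') (B : Scheme.{u}) :
    (permIso σ B).hom ≫ Aff.str n' B = Aff.str n B := AffineSpace.reindex_over _ _

/-- Permutation of the coordinates, together with a change of framing. -/
def reindex (c : ExplicitCorr n 𝓕 X Y) (σ : Fin n ≃ Fin n') (η : 𝓕.Hom 𝓖) :
    ExplicitCorr n' 𝓖 X Y :=
  c.move (permIso σ X.left) (permIso_over _ _) (η.hom.app _ c.φ) (η.zero_hom _)

lemma reindex_φAt (c : ExplicitCorr n 𝓕 X Y) (σ : Fin n ≃ Fin n') (η : 𝓕.Hom 𝓖) {V : Scheme.{u}}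
    (j : V ⟶ c.W) : (c.reindex σ η).φAt j = η.hom.app (op V) (c.φAt j) := naturality_hom η _ _

lemma reindex_gAt (c : ExplicitCorr n 𝓕 X Y) (σ : Fin n ≃ Fin n') (η : 𝓕.Hom 𝓖) {V : Scheme.{u}}
    (j : V ⟶ c.W) (h) (w) : (c.reindex σ η).gAt j h w = c.gAt j h (by
      rw [← w]
      change _ = j ≫ (c.e ≫ _) ≫ _
      rw [Category.assoc, reassoc_of% permIso_over]) := move_gAt _ _ _ _ _ _ _ _

lemma reindex_e (c : ExplicitCorr n 𝓕 X Y) (σ : Fin n ≃ Fin n') (η : 𝓕.Hom 𝓖) :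
    (c.reindex σ η).e = c.e ≫ (permIso σ X.left).hom := rfl

lemma push_φAt (c : ExplicitCorr n 𝓕 X Y) (f : Y ⟶ Y') {V : Scheme.{u}}
    (j : V ⟶ c.W) : (c.push f).φAt j = c.φAt j := rfl

lemma push_gAt (c : ExplicitCorr n 𝓕 X Y) (f : Y ⟶ Y') {V : Scheme.{u}}
    (j : V ⟶ c.W) (h) (w) : (c.push f).gAt j h w = f.app _ (c.gAt j h w) := naturality' f _ _

lemma comp_apply_congr {A B B' C : Scheme.{u}} {f : A ⟶ B} {g : B ⟶ C}
    {f' : A ⟶ B'} {g' : B' ⟶ C} (h : f ≫ g = f' ≫ g') (x : A) : g (f x) = g' (f' x) := by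
  rw [← Scheme.Hom.comp_apply, ← Scheme.Hom.comp_apply, h]

lemma notMem_basicOpen_comp {A B : Scheme.{u}} (p : A ⟶ B) (f : Γ(B, ⊤)) (x : A) :
    p x ∉ B.basicOpen f ↔ x ∉ A.basicOpen (p.appTop f) := by
  refine not_congr ?_
  change x ∈ p ⁻¹ᵁ B.basicOpen f ↔ _
  rw [Scheme.preimage_basicOpen]
  rfl

/-- On points the isomorphism is `x ↦ x ∘ σ.symm`. The same convention governs `permGL` and the
reindexings of framings. -/
lemma permIso_hom_coord (σ : Fin n ≃ Fin n') (B : Scheme.{u}) (i : Fin n') :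
    (permIso σ B).hom.appTop (Aff.coord B i) = Aff.coord B (σ.symm i) :=
  AffineSpace.reindex_appTop_coord _ _ _

lemma permIso_inv_coord (σ : Fin n ≃ Fin n') (B : Scheme.{u}) (i : Fin n) :
    (permIso σ B).inv.appTop (Aff.coord B i) = Aff.coord B (σ i) :=
  AffineSpace.reindex_appTop_coord _ _ _

lemma projL_coord (B : Scheme.{u}) (i : Fin n) :
    (projL n n' B).appTop (Aff.coord B i) = Aff.coord B (Fin.castAdd n' i) :=
  AffineSpace.reindex_appTop_coord _ _ _

lemma projR_coord (B : Scheme.{u}) (i : Fin n') :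
    (projR n n' B).appTop (Aff.coord B i) = Aff.coord B (Fin.natAdd n i) :=
  AffineSpace.reindex_appTop_coord _ _ _

/-- The bracketing equivalence. -/
def finAssoc (a b c : ℕ) : Fin (a + (b + c)) ≃ Fin (a + b + c) := finCongr (Nat.add_assoc a b c).symm

/-- The equivalence that exchanges the first two blocks. -/
def finLeftComm (a b c : ℕ) : Fin (a + (b + c)) ≃ Fin (b + (a + c)) :=
  (finSumFinEquiv.symm.trans ((Equiv.sumCongr (Equiv.refl _) finSumFinEquiv.symm).trans
    ((Equiv.sumAssoc _ _ _).symm.trans ((Equiv.sumCongr (Equiv.sumComm _ _) (Equiv.refl _)).trans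
      (Equiv.sumAssoc _ _ _))))).trans ((Equiv.sumCongr (Equiv.refl _) finSumFinEquiv).trans
        finSumFinEquiv)

lemma finAssoc_left (a b c : ℕ) (i : Fin a) :
    finAssoc a b c (Fin.castAdd _ i) = Fin.castAdd _ (Fin.castAdd _ i) := by
  ext; simp [finAssoc]

lemma finAssoc_mid (a b c : ℕ) (i : Fin b) :
    finAssoc a b c (Fin.natAdd _ (Fin.castAdd _ i)) = Fin.castAdd _ (Fin.natAdd _ i) := by
  ext; simp [finAssoc]

lemma finAssoc_right (a b c : ℕ) (i : Fin c) :
    finAssoc a b c (Fin.natAdd _ (Fin.natAdd _ i)) = Fin.natAdd _ i := by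
  ext; simp [finAssoc]; omega

lemma finLeftComm_left (a b c : ℕ) (i : Fin a) :
    finLeftComm a b c (Fin.castAdd _ i) = Fin.natAdd _ (Fin.castAdd _ i) := by
  simp [finLeftComm]

lemma finLeftComm_mid (a b c : ℕ) (i : Fin b) :
    finLeftComm a b c (Fin.natAdd _ (Fin.castAdd _ i)) = Fin.castAdd _ i := by
  simp [finLeftComm]

lemma finLeftComm_right (a b c : ℕ) (i : Fin c) :
    finLeftComm a b c (Fin.natAdd _ (Fin.natAdd _ i)) = Fin.natAdd _ (Fin.natAdd _ i) := by
  simp [finLeftComm]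

lemma finAssoc_symm_left (a b c : ℕ) (i : Fin a) :
    (finAssoc a b c).symm (Fin.castAdd _ (Fin.castAdd _ i)) = Fin.castAdd _ i := by
  rw [← finAssoc_left, Equiv.symm_apply_apply]

lemma finAssoc_symm_mid (a b c : ℕ) (i : Fin b) :
    (finAssoc a b c).symm (Fin.castAdd _ (Fin.natAdd _ i)) = Fin.natAdd _ (Fin.castAdd _ i) := by
  rw [← finAssoc_mid, Equiv.symm_apply_apply]

lemma finAssoc_symm_right (a b c : ℕ) (i : Fin c) :
    (finAssoc a b c).symm (Fin.natAdd _ i) = Fin.natAdd _ (Fin.natAdd _ i) := by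
  rw [← finAssoc_right, Equiv.symm_apply_apply]

lemma finLeftComm_symm_left (a b c : ℕ) (i : Fin a) :
    (finLeftComm a b c).symm (Fin.natAdd _ (Fin.castAdd _ i)) = Fin.castAdd _ i := by
  rw [← finLeftComm_left, Equiv.symm_apply_apply]

lemma finLeftComm_symm_mid (a b c : ℕ) (i : Fin b) :
    (finLeftComm a b c).symm (Fin.castAdd _ i) = Fin.natAdd _ (Fin.castAdd _ i) := by
  rw [← finLeftComm_mid, Equiv.symm_apply_apply]

lemma finLeftComm_symm_right (a b c : ℕ) (i : Fin c) :
    (finLeftComm a b c).symm (Fin.natAdd _ (Fin.natAdd _ i)) = Fin.natAdd _ (Fin.natAdd _ i) := by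
  conv_lhs => rw [← finLeftComm_right, Equiv.symm_apply_apply]

lemma mem_susp_Z (c : ExplicitCorr n 𝓕 X Y) (σ : (affineSpace (Fin 1)).Pairing 𝓕 𝓖)
    (x : Aff (1 + n) X.left) : x ∈ (c.susp σ).Z ↔
      x ∉ (Aff (1 + n) X.left).basicOpen (Aff.coord X.left (Fin.castAdd n 0)) ∧
        projR 1 n X.left x ∈ c.Z := Iff.rfl

lemma mem_prod_Z (c : ExplicitCorr n 𝓕 X Y) (d : ExplicitCorr n' 𝓖 X Y') (μ : 𝓕.Pairing 𝓖 𝓗)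
    (x : Aff (n + n') X.left) : x ∈ (c.prod d μ).Z ↔
      projL n n' X.left x ∈ c.Z ∧ projR n n' X.left x ∈ d.Z := Iff.rfl

lemma pairing_congr (μ : 𝓕.Pairing 𝓖 𝓗) {V : Scheme.{u}} {φ φ' : 𝓕.sec.obj (op V)}
    {ψ ψ' : 𝓖.sec.obj (op V)} (h : φ = φ') (h' : ψ = ψ') :
    μ.hom.app (op V) (φ, ψ) = μ.hom.app (op V) (φ', ψ') := by rw [h, h']

/-- The existential form keeps the lift opaque, so that later rewriting sees only its components. -/
lemma exists_suspLift {c : ExplicitCorr n 𝓕 X Y} (σ : (affineSpace (Fin 1)).Pairing 𝓕 𝓖)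
    {V : Scheme.{u}} (a : V ⟶ c.W) (p : V ⟶ Aff (1 + n) X.left)
    (ha : a ≫ c.e = p ≫ projR 1 n X.left) :
    ∃ j : V ⟶ (c.susp σ).W, j ≫ (c.susp σ).e = p ∧ j ≫ c.suspFst σ = a :=
  ⟨suspLift σ a p ha, suspLift_e _ _ _ _, suspLift_fst _ _ _ _⟩

lemma exists_prodLift {c : ExplicitCorr n 𝓕 X Y} {d : ExplicitCorr n' 𝓖 X Y'}
    (μ : 𝓕.Pairing 𝓖 𝓗) {V : Scheme.{u}} (a : V ⟶ c.W) (b : V ⟶ d.W)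
    (p : V ⟶ Aff (n + n') X.left) (ha : a ≫ c.e = p ≫ projL n n' X.left)
    (hb : b ≫ d.e = p ≫ projR n n' X.left) :
    ∃ j : V ⟶ (c.prod d μ).W, j ≫ (c.prod d μ).e = p ∧ j ≫ c.prodFst d μ = a ∧
      j ≫ c.prodSnd d μ = b :=
  ⟨prodLift μ a b p ha hb, prodLift_e _ _ _ _ _ _, prodLift_fst _ _ _ _ _ _,
    prodLift_snd _ _ _ _ _ _⟩

/-- A criterion for a correspondence to be obtained from another one by a permutation of the
coordinates. -/
lemma reindex_rel {b : ExplicitCorr n 𝓕 X Y} {c : ExplicitCorr n' 𝓖 X Y} {σ : Fin n ≃ Fin n'}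
    {η : 𝓕.Hom 𝓖} (j : b.W ⟶ c.W) (he : j ≫ c.e = b.e ≫ (permIso σ X.left).hom)
    (hφ : c.φAt j = η.hom.app (op b.W) (b.φAt (𝟙 _)))
    (hg : ∀ h w w', c.gAt j h w = b.gAt (𝟙 _) h w')
    (hZ : ∀ x, (permIso σ X.left).inv x ∈ b.Z ↔ x ∈ c.Z) : (b.reindex σ η).Rel c := by
  have r : c.RestrictsTo (b.reindex σ η) j := by
    refine ⟨he, hφ.trans (reindex_φAt _ _ _ _).symm, Eq.trans ?_ (reindex_gAt _ _ _ _ _ _).symm⟩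
    exact hg _ _ _
  refine r.rel ?_
  ext x
  exact hZ x

/-- `(𝔸¹ × c) × d` is obtained from `𝔸¹ × (c × d)` by rebracketing. -/
lemma susp_prod_rel (c : ExplicitCorr n 𝓕 X Y) (d : ExplicitCorr n' 𝓖 X Y')
    (σ : (affineSpace (Fin 1)).Pairing 𝓕 𝓛) (μ' : 𝓛.Pairing 𝓖 𝓚) (μ : 𝓕.Pairing 𝓖 𝓗)
    (σ' : (affineSpace (Fin 1)).Pairing 𝓗 𝓜) (η : 𝓜.Hom 𝓚)
    (H : ∀ (W : Scheme.{u}) x φ ψ, μ'.hom.app (op W) (σ.hom.app (op W) (x, φ), ψ) =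
      η.hom.app (op W) (σ'.hom.app (op W) (x, μ.hom.app (op W) (φ, ψ)))) :
    (((c.prod d μ).susp σ').reindex (finAssoc 1 n n') η).Rel ((c.susp σ).prod d μ') := by
  let p := permIso (finAssoc 1 n n') X.left
  -- The squares `q1` and `q2` relate the rebracketing to the projections onto the two factors. They
  -- produce the comparison morphism `j` and, read for `p.inv`, the equality of supports.
  have q1 : p.hom ≫ projL (1 + n) n' X.left ≫ projR 1 n X.left =
      projR 1 (n + n') X.left ≫ projL n n' X.left := by
    refine aff_hom_ext (by simp [p, permIso]) fun i => ?_
    simp only [p, comp_appTop_apply, projL_coord, projR_coord, permIso_hom_coord, finAssoc_symm_mid]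
  have q2 : p.hom ≫ projR (1 + n) n' X.left = projR 1 (n + n') X.left ≫ projR n n' X.left := by
    refine aff_hom_ext (by simp [p, permIso]) fun i => ?_
    simp only [p, comp_appTop_apply, projR_coord, permIso_hom_coord, finAssoc_symm_right]
  obtain ⟨v, hv, hv'⟩ : ∃ v : ((c.prod d μ).susp σ').W ⟶ (c.susp σ).W,
      v ≫ (c.susp σ).e = (((c.prod d μ).susp σ').e ≫ p.hom) ≫ projL (1 + n) n' X.left ∧
        v ≫ c.suspFst σ = (c.prod d μ).suspFst σ' ≫ c.prodFst d μ :=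
    exists_suspLift _ _ _ (by
      rw [Category.assoc, prodFst_e, reassoc_of% suspFst_e, Category.assoc, Category.assoc, q1])
  obtain ⟨j, hj, hj1, hj2⟩ : ∃ j : ((c.prod d μ).susp σ').W ⟶ ((c.susp σ).prod d μ').W,
      j ≫ ((c.susp σ).prod d μ').e = ((c.prod d μ).susp σ').e ≫ p.hom ∧
      j ≫ (c.susp σ).prodFst d μ' = v ∧
        j ≫ (c.susp σ).prodSnd d μ' = (c.prod d μ).suspFst σ' ≫ c.prodSnd d μ :=
    exists_prodLift _ _ _ _ hv (by
      rw [Category.assoc, prodSnd_e, reassoc_of% suspFst_e, Category.assoc, q2])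
  refine reindex_rel j hj ?_ (fun h w w' => ?_) fun x => ?_
  · rw [prod_φAt, susp_φAt, H, susp_φAt, prod_φAt]
    refine congrArg _ (pairing_congr _ ?_ (pairing_congr _ ?_ ?_))
    -- The stabilising coordinate is the first one on both sides, and `finAssoc` preserves it.
    · funext _
      change ((j ≫ (c.susp σ).prodFst d μ') ≫ (c.susp σ).e).appTop _ =
        (𝟙 _ ≫ ((c.prod d μ).susp σ').e).appTop _
      rw [hj1, hv, Category.id_comp]
      simp only [p, comp_appTop_apply, projL_coord, permIso_hom_coord, finAssoc_symm_left]
    · refine φAt_congr _ ?_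
      rw [hj1, Category.id_comp, hv']
    · refine φAt_congr _ ?_
      rw [hj2, Category.id_comp]
  · refine (prod_gAt _ _ _ _ _ _).trans (Eq.trans ?_ ((susp_gAt _ _ _ _ _).trans
      (prod_gAt _ _ _ _ _ _)).symm)
    refine Prod.ext ((susp_gAt _ _ _ _ _).trans (gAt_congr _ ?_ _ _ _)) (gAt_congr _ ?_ _ _ _)
    · rw [hj1, Category.id_comp, hv']
    · rw [hj2, Category.id_comp]
  · rw [mem_susp_Z, mem_prod_Z, mem_prod_Z, mem_susp_Z, ← and_assoc, notMem_basicOpen_comp,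
      notMem_basicOpen_comp, permIso_inv_coord, projL_coord, finAssoc_left,
      comp_apply_congr (p.eq_inv_comp.2 q1), p.eq_inv_comp.2 q2]
    rfl

end ExplicitCorr

end

/-! ### Exchange, associativity and unit, and the reduction to invariance under permutations. -/

section

variable {k : Type u} [Field k]

namespace ExplicitCorr

variable {n n' n'' m m' : ℕ} {𝓕 𝓖 𝓗 𝓚 𝓛 𝓜 𝓝 : FramingSpace.{u}} {X T S : Sch k}
  {Y Y' Y'' : (Sch k)ᵒᵖ ⥤ Type u}

/-- `c × (𝔸¹ × d)` is obtained from `𝔸¹ × (c × d)` by exchanging the first two blocks of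
coordinates. -/
lemma prod_susp_rel (c : ExplicitCorr n 𝓕 X Y) (d : ExplicitCorr n' 𝓖 X Y')
    (σ : (affineSpace (Fin 1)).Pairing 𝓖 𝓛) (μ' : 𝓕.Pairing 𝓛 𝓚) (μ : 𝓕.Pairing 𝓖 𝓗)
    (σ' : (affineSpace (Fin 1)).Pairing 𝓗 𝓜) (η : 𝓜.Hom 𝓚)
    (H : ∀ (W : Scheme.{u}) x φ ψ, μ'.hom.app (op W) (φ, σ.hom.app (op W) (x, ψ)) =
      η.hom.app (op W) (σ'.hom.app (op W) (x, μ.hom.app (op W) (φ, ψ)))) :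
    (((c.prod d μ).susp σ').reindex (finLeftComm 1 n n') η).Rel (c.prod (d.susp σ) μ') := by
  let p := permIso (finLeftComm 1 n n') X.left
  -- The stabilising coordinate has to pass the `n` coordinates of `c`. Unlike a rebracketing this
  -- is a genuine permutation, and its effect on classes will be removed by homotopies.
  have q1 : p.hom ≫ projL n (1 + n') X.left =
      projR 1 (n + n') X.left ≫ projL n n' X.left := by
    refine aff_hom_ext (by simp [p, permIso]) fun i => ?_
    simp only [p, comp_appTop_apply, projL_coord, projR_coord, permIso_hom_coord,
      finLeftComm_symm_mid]
  have q2 : p.hom ≫ projR n (1 + n') X.left ≫ projR 1 n' X.left =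
      projR 1 (n + n') X.left ≫ projR n n' X.left := by
    refine aff_hom_ext (by simp [p, permIso]) fun i => ?_
    simp only [p, comp_appTop_apply, projR_coord, permIso_hom_coord, finLeftComm_symm_right]
  obtain ⟨v, hv, hv'⟩ : ∃ v : ((c.prod d μ).susp σ').W ⟶ (d.susp σ).W,
      v ≫ (d.susp σ).e = (((c.prod d μ).susp σ').e ≫ p.hom) ≫ projR n (1 + n') X.left ∧
        v ≫ d.suspFst σ = (c.prod d μ).suspFst σ' ≫ c.prodSnd d μ :=
    exists_suspLift _ _ _ (by
      rw [Category.assoc, prodSnd_e, reassoc_of% suspFst_e, Category.assoc, Category.assoc, q2])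
  obtain ⟨j, hj, hj1, hj2⟩ : ∃ j : ((c.prod d μ).susp σ').W ⟶ (c.prod (d.susp σ) μ').W,
      j ≫ (c.prod (d.susp σ) μ').e = ((c.prod d μ).susp σ').e ≫ p.hom ∧
      j ≫ c.prodFst (d.susp σ) μ' = (c.prod d μ).suspFst σ' ≫ c.prodFst d μ ∧
        j ≫ c.prodSnd (d.susp σ) μ' = v :=
    exists_prodLift _ _ _ _ (by
      rw [Category.assoc, prodFst_e, reassoc_of% suspFst_e, Category.assoc, q1]) hv
  refine reindex_rel j hj ?_ (fun h w w' => ?_) fun x => ?_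
  · rw [prod_φAt, susp_φAt, H, susp_φAt, prod_φAt]
    refine congrArg _ (pairing_congr _ ?_ (pairing_congr _ ?_ ?_))
    · funext _
      change ((j ≫ c.prodSnd (d.susp σ) μ') ≫ (d.susp σ).e).appTop _ =
        (𝟙 _ ≫ ((c.prod d μ).susp σ').e).appTop _
      rw [hj2, hv, Category.id_comp]
      simp only [p, comp_appTop_apply, projR_coord, permIso_hom_coord, finLeftComm_symm_left]
    · refine φAt_congr _ ?_
      rw [hj1, Category.id_comp]
    · refine φAt_congr _ ?_
      rw [hj2, Category.id_comp, hv']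
  · refine (prod_gAt _ _ _ _ _ _).trans (Eq.trans ?_ ((susp_gAt _ _ _ _ _).trans
      (prod_gAt _ _ _ _ _ _)).symm)
    refine Prod.ext (gAt_congr _ ?_ _ _ _) ((susp_gAt _ _ _ _ _).trans (gAt_congr _ ?_ _ _ _))
    · rw [hj1, Category.id_comp]
    · rw [hj2, Category.id_comp, hv']
  · rw [mem_susp_Z, mem_prod_Z, mem_prod_Z, mem_susp_Z, and_left_comm, notMem_basicOpen_comp,
      notMem_basicOpen_comp, permIso_inv_coord, projR_coord, finLeftComm_left,
      comp_apply_congr (p.eq_inv_comp.2 q2), p.eq_inv_comp.2 q1]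
    rfl

/-- `(c × d) × e` is obtained from `c × (d × e)` by rebracketing. -/
lemma prod_assoc_rel (c : ExplicitCorr n 𝓕 X Y) (d : ExplicitCorr n' 𝓖 X Y')
    (e : ExplicitCorr n'' 𝓗 X Y'') (μ₁ : 𝓕.Pairing 𝓖 𝓚) (μ₂ : 𝓚.Pairing 𝓗 𝓛)
    (ν₁ : 𝓖.Pairing 𝓗 𝓜) (ν₂ : 𝓕.Pairing 𝓜 𝓝) (η : 𝓝.Hom 𝓛)
    (H : ∀ (W : Scheme.{u}) φ ψ χ, μ₂.hom.app (op W) (μ₁.hom.app (op W) (φ, ψ), χ) =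
      η.hom.app (op W) (ν₂.hom.app (op W) (φ, ν₁.hom.app (op W) (ψ, χ)))) :
    ((c.prod (d.prod e ν₁) ν₂).reindex (finAssoc n n' n'') η).Rel
      (((c.prod d μ₁).prod e μ₂).push (prodAssoc Y Y' Y'')) := by
  let p := permIso (finAssoc n n' n'') X.left
  have q1 : p.hom ≫ projL (n + n') n'' X.left ≫ projL n n' X.left =
      projL n (n' + n'') X.left := by
    refine aff_hom_ext (by simp [p, permIso]) fun i => ?_
    simp only [p, comp_appTop_apply, projL_coord, permIso_hom_coord, finAssoc_symm_left]
  have q2 : p.hom ≫ projL (n + n') n'' X.left ≫ projR n n' X.left =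
      projR n (n' + n'') X.left ≫ projL n' n'' X.left := by
    refine aff_hom_ext (by simp [p, permIso]) fun i => ?_
    simp only [p, comp_appTop_apply, projL_coord, projR_coord, permIso_hom_coord, finAssoc_symm_mid]
  have q3 : p.hom ≫ projR (n + n') n'' X.left =
      projR n (n' + n'') X.left ≫ projR n' n'' X.left := by
    refine aff_hom_ext (by simp [p, permIso]) fun i => ?_
    simp only [p, comp_appTop_apply, projR_coord, permIso_hom_coord, finAssoc_symm_right]
  obtain ⟨v, hv, hv1, hv2⟩ : ∃ v : (c.prod (d.prod e ν₁) ν₂).W ⟶ (c.prod d μ₁).W,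
      v ≫ (c.prod d μ₁).e =
        ((c.prod (d.prod e ν₁) ν₂).e ≫ p.hom) ≫ projL (n + n') n'' X.left ∧
      v ≫ c.prodFst d μ₁ = c.prodFst (d.prod e ν₁) ν₂ ∧
        v ≫ c.prodSnd d μ₁ = c.prodSnd (d.prod e ν₁) ν₂ ≫ d.prodFst e ν₁ :=
    exists_prodLift _ _ _ _
      (by rw [prodFst_e, Category.assoc, Category.assoc, q1])
      (by rw [Category.assoc, prodFst_e, reassoc_of% prodSnd_e, Category.assoc, Category.assoc, q2])
  obtain ⟨j, hj, hj1, hj2⟩ : ∃ j : (c.prod (d.prod e ν₁) ν₂).W ⟶ ((c.prod d μ₁).prod e μ₂).W,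
      j ≫ ((c.prod d μ₁).prod e μ₂).e = (c.prod (d.prod e ν₁) ν₂).e ≫ p.hom ∧
      j ≫ (c.prod d μ₁).prodFst e μ₂ = v ∧
        j ≫ (c.prod d μ₁).prodSnd e μ₂ = c.prodSnd (d.prod e ν₁) ν₂ ≫ d.prodSnd e ν₁ :=
    exists_prodLift _ _ _ _ hv (by
      rw [Category.assoc, prodSnd_e, reassoc_of% prodSnd_e, Category.assoc, q3])
  refine reindex_rel (c := ((c.prod d μ₁).prod e μ₂).push (prodAssoc Y Y' Y'')) j hj ?_
    (fun h w w' => ?_) fun x => ?_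
  · rw [push_φAt, prod_φAt, prod_φAt, H, prod_φAt, prod_φAt]
    refine congrArg _ (pairing_congr _ ?_ (pairing_congr _ ?_ ?_))
    · refine φAt_congr _ ?_
      rw [hj1, Category.id_comp, hv1]
    · refine φAt_congr _ ?_
      rw [hj1, Category.id_comp, hv2]
    · refine φAt_congr _ ?_
      rw [hj2, Category.id_comp]
  · refine (push_gAt _ _ _ _ _).trans ?_
    refine (congrArg ((prodAssoc Y Y' Y'').app _) ((prod_gAt _ _ _ _ _ _).trans
      (congrArg (fun y => (y, _)) (prod_gAt _ _ _ _ _ _)))).trans ?_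
    refine Eq.trans ?_ ((prod_gAt _ _ _ _ _ _).trans
      (congrArg (fun y => (_, y)) (prod_gAt _ _ _ _ _ _))).symm
    refine Prod.ext (gAt_congr _ ?_ _ _ _) (Prod.ext (gAt_congr _ ?_ _ _ _) (gAt_congr _ ?_ _ _ _))
    · rw [hj1, Category.id_comp, hv1]
    · rw [hj1, Category.id_comp, hv2]
    · rw [hj2, Category.id_comp]
  · refine Iff.trans ?_ (mem_prod_Z _ _ μ₂ _).symm
    rw [mem_prod_Z, mem_prod_Z, mem_prod_Z, and_assoc, comp_apply_congr (p.eq_inv_comp.2 q1),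
      comp_apply_congr (p.eq_inv_comp.2 q2), p.eq_inv_comp.2 q3]
    rfl

/-- The product with a correspondence of level `0` on the left. -/
lemma ofSection_prod_rel (s : Y.obj (op X)) (z : 𝓕.sec.obj (op (Aff 0 X.left)))
    (hz : 𝓕.zero z = Set.univ) (c : ExplicitCorr n 𝓖 X Y') (μ : 𝓕.Pairing 𝓖 𝓗) (η : 𝓖.Hom 𝓗)
    (H : ∀ (W : Scheme.{u}) (f : W ⟶ Aff 0 X.left) φ,
      μ.hom.app (op W) (𝓕.sec.map f.op z, φ) = η.hom.app (op W) φ) :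
    (c.reindex (finCongr (Nat.zero_add n).symm) η).Rel
      (((ofSection s z hz).prod c μ).push FunctorToTypes.prod.snd) := by
  let p := permIso (finCongr (Nat.zero_add n).symm) X.left
  have q : p.hom ≫ projR 0 n X.left = 𝟙 _ := by
    refine aff_hom_ext (by simp [p, permIso]) fun i => ?_
    simp only [p, comp_appTop_apply, projR_coord, permIso_hom_coord, Scheme.Hom.id_appTop]
    exact congrArg _ (Fin.ext (by simp))
  obtain ⟨j, hj, hj1, hj2⟩ : ∃ j : c.W ⟶ ((ofSection s z hz).prod c μ).W,
      j ≫ ((ofSection s z hz).prod c μ).e = c.e ≫ p.hom ∧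
      j ≫ (ofSection s z hz).prodFst c μ = (c.e ≫ p.hom) ≫ projL 0 n X.left ∧
      j ≫ (ofSection s z hz).prodSnd c μ = 𝟙 _ :=
    exists_prodLift (c := ofSection s z hz) (d := c) μ _ (𝟙 _) _ (Category.comp_id _) (by
      rw [Category.id_comp, Category.assoc, q, Category.comp_id])
  refine reindex_rel (c := ((ofSection s z hz).prod c μ).push FunctorToTypes.prod.snd) j hj ?_
    (fun h w w' => ?_) fun x => ?_
  · rw [push_φAt, prod_φAt]
    exact (H _ _ _).trans (congrArg _ (φAt_congr _ hj2))
  · refine (push_gAt _ _ _ _ _).trans ?_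
    refine (congrArg (FunctorToTypes.prod.snd.app _) (prod_gAt _ _ _ _ _ _)).trans ?_
    exact gAt_congr _ hj2 _ _ _
  · refine Iff.trans ?_ (mem_prod_Z _ _ μ _).symm
    have q' : p.inv = projR 0 n X.left := ((p.eq_inv_comp.2 q).trans (Category.comp_id _)).symm
    change p.inv x ∈ c.Z ↔ _
    rw [q']
    -- The level `0` correspondence is supported on all of `𝔸⁰`, so it imposes no condition.
    exact (and_iff_right trivial).symm

/-- The product with a correspondence of level `0` on the right. -/
lemma prod_ofSection_rel (s : Y'.obj (op X)) (z : 𝓕.sec.obj (op (Aff 0 X.left)))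
    (hz : 𝓕.zero z = Set.univ) (c : ExplicitCorr n 𝓖 X Y) (μ : 𝓖.Pairing 𝓕 𝓗) (η : 𝓖.Hom 𝓗)
    (H : ∀ (W : Scheme.{u}) (f : W ⟶ Aff 0 X.left) φ,
      μ.hom.app (op W) (φ, 𝓕.sec.map f.op z) = η.hom.app (op W) φ) :
    (c.reindex (finCongr (Nat.add_zero n).symm) η).Rel
      ((c.prod (ofSection s z hz) μ).push FunctorToTypes.prod.fst) := by
  let p := permIso (finCongr (Nat.add_zero n).symm) X.left
  have q : p.hom ≫ projL n 0 X.left = 𝟙 _ := by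
    refine aff_hom_ext (by simp [p, permIso]) fun i => ?_
    simp only [p, comp_appTop_apply, projL_coord, permIso_hom_coord, Scheme.Hom.id_appTop]
    exact congrArg _ (Fin.ext (by simp))
  obtain ⟨j, hj, hj2, hj1⟩ : ∃ j : c.W ⟶ (c.prod (ofSection s z hz) μ).W,
      j ≫ (c.prod (ofSection s z hz) μ).e = c.e ≫ p.hom ∧
      j ≫ c.prodFst (ofSection s z hz) μ = 𝟙 _ ∧
      j ≫ c.prodSnd (ofSection s z hz) μ = (c.e ≫ p.hom) ≫ projR n 0 X.left :=
    exists_prodLift (d := ofSection s z hz) (c := c) μ (𝟙 _) _ _ (by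
      rw [Category.id_comp, Category.assoc, q, Category.comp_id]) (Category.comp_id _)
  refine reindex_rel (c := (c.prod (ofSection s z hz) μ).push FunctorToTypes.prod.fst) j hj ?_
    (fun h w w' => ?_) fun x => ?_
  · rw [push_φAt, prod_φAt]
    exact (H _ _ _).trans (congrArg _ (φAt_congr _ hj2))
  · refine (push_gAt _ _ _ _ _).trans ?_
    refine (congrArg (FunctorToTypes.prod.fst.app _) (prod_gAt _ _ _ _ _ _)).trans ?_
    exact gAt_congr _ hj2 _ _ _
  · refine Iff.trans ?_ (mem_prod_Z _ _ μ _).symm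
    have q' : p.inv = projL n 0 X.left := ((p.eq_inv_comp.2 q).trans (Category.comp_id _)).symm
    change p.inv x ∈ c.Z ↔ _
    rw [q']
    exact (and_iff_left trivial).symm

/-- Without permutation of the coordinates, `reindex` is `reframe`. -/
lemma reindex_refl_rel (c : ExplicitCorr n 𝓕 X Y) (η : 𝓕.Hom 𝓖) :
    (c.reindex (Equiv.refl _) η).Rel (c.reframe η) := by
  have hp : (permIso (Equiv.refl (Fin n)) X.left).hom = 𝟙 _ := AffineSpace.reindex_id _ |>.trans rfl
  have hp' : (permIso (Equiv.refl (Fin n)) X.left).inv = 𝟙 _ :=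
    AffineSpace.reindex_id _ |>.trans rfl
  refine reindex_rel (c := c.reframe η) (𝟙 c.W) ?_ ?_ (fun h w w' => rfl) fun x => ?_
  · rw [hp, Category.comp_id]
    exact Category.id_comp _
  · exact naturality_hom η _ _
  · rw [hp']
    rfl

end ExplicitCorr

open ExplicitCorr

/-- The class of a correspondence does not change under the permutation `σ` of the coordinates and
the change of framing `η`. -/
def Invariant (𝔖 : FramingTheory.{u}) (k : Type u) [Field k] {n n' : ℕ} {i i' : 𝔖.Idx}
    (σ : Fin n ≃ Fin n') (η : (𝔖.space n i).Hom (𝔖.space n' i')) : Prop :=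
  ∀ (X : Sch k) (Y : (Sch k)ᵒᵖ ⥤ Type u) (c : ExplicitCorr n (𝔖.space n i) X Y),
    H0.mk 𝔖 (c.reindex σ η) = H0.mk 𝔖 c

/-- Reduction of `StableProduct` to identities between operations on framings. -/
lemma StableProduct.of_invariant {𝔖 : FramingTheory.{u}}
    (susp_left : ∀ n i n' i', ∃ η, Invariant 𝔖 k (i := 𝔖.addIdx i i') (finAssoc 1 n n') η ∧
      ∀ (W : Scheme.{u}) x φ ψ, (𝔖.sum (1 + n) i n' i').hom.app (op W)
          ((𝔖.susp n i).hom.app (op W) (x, φ), ψ) =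
        η.hom.app (op W) ((𝔖.susp (n + n') (𝔖.addIdx i i')).hom.app (op W)
          (x, (𝔖.sum n i n' i').hom.app (op W) (φ, ψ))))
    (susp_right : ∀ n i n' i', ∃ η, Invariant 𝔖 k (i := 𝔖.addIdx i i') (finLeftComm 1 n n') η ∧
      ∀ (W : Scheme.{u}) x φ ψ, (𝔖.sum n i (1 + n') i').hom.app (op W)
          (φ, (𝔖.susp n' i').hom.app (op W) (x, ψ)) =
        η.hom.app (op W) ((𝔖.susp (n + n') (𝔖.addIdx i i')).hom.app (op W)
          (x, (𝔖.sum n i n' i').hom.app (op W) (φ, ψ))))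
    (incl_left : ∀ n i n' i', ∃ η, Invariant 𝔖 k (i := 𝔖.next (𝔖.addIdx i i'))
        (Equiv.refl (Fin (n + n'))) η ∧
      ∀ (W : Scheme.{u}) φ ψ, (𝔖.sum n (𝔖.next i) n' i').hom.app (op W)
          ((𝔖.incl n i).hom.app (op W) φ, ψ) =
        η.hom.app (op W) ((𝔖.incl (n + n') (𝔖.addIdx i i')).hom.app (op W)
          ((𝔖.sum n i n' i').hom.app (op W) (φ, ψ))))
    (incl_right : ∀ n i n' i', ∃ η, Invariant 𝔖 k (i := 𝔖.next (𝔖.addIdx i i'))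
        (Equiv.refl (Fin (n + n'))) η ∧
      ∀ (W : Scheme.{u}) φ ψ, (𝔖.sum n i n' (𝔖.next i')).hom.app (op W)
          (φ, (𝔖.incl n' i').hom.app (op W) ψ) =
        η.hom.app (op W) ((𝔖.incl (n + n') (𝔖.addIdx i i')).hom.app (op W)
          ((𝔖.sum n i n' i').hom.app (op W) (φ, ψ))))
    (assoc : ∀ n i n' i' n'' i'', ∃ η, Invariant 𝔖 k (i := 𝔖.addIdx i (𝔖.addIdx i' i''))
        (finAssoc n n' n'') η ∧
      ∀ (W : Scheme.{u}) φ ψ χ, (𝔖.sum (n + n') (𝔖.addIdx i i') n'' i'').hom.app (op W)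
          ((𝔖.sum n i n' i').hom.app (op W) (φ, ψ), χ) =
        η.hom.app (op W) ((𝔖.sum n i (n' + n'') (𝔖.addIdx i' i'')).hom.app (op W)
          (φ, (𝔖.sum n' i' n'' i'').hom.app (op W) (ψ, χ))))
    (one_left : ∀ n i, ∃ η, Invariant 𝔖 k (i := i) (finCongr (Nat.zero_add n).symm) η ∧
      ∀ (V W : Scheme.{u}) (f : W ⟶ V) φ, (𝔖.sum 0 𝔖.zeroIdx n i).hom.app (op W)
        ((𝔖.space 0 𝔖.zeroIdx).sec.map f.op (𝔖.origin V), φ) = η.hom.app (op W) φ)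
    (one_right : ∀ n i, ∃ η, Invariant 𝔖 k (i := i) (finCongr (Nat.add_zero n).symm) η ∧
      ∀ (V W : Scheme.{u}) (f : W ⟶ V) φ, (𝔖.sum n i 0 𝔖.zeroIdx).hom.app (op W)
        (φ, (𝔖.space 0 𝔖.zeroIdx).sec.map f.op (𝔖.origin V)) = η.hom.app (op W) φ) :
    StableProduct 𝔖 k where
  susp_left {X Y Y' n n' i i'} c d := by
    -- The common pattern: `H` makes the correspondence equivalent to a reindexing of a simpler one,
    -- `h` discards the reindexing, and any stabilisation is then removed in `H⁰`.
    obtain ⟨η, h, H⟩ := susp_left n i n' i'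
    rw [← H0.mk_rel (susp_prod_rel c d _ _ _ _ η H), h, H0.mk_susp]
  susp_right {X Y Y' n n' i i'} c d := by
    obtain ⟨η, h, H⟩ := susp_right n i n' i'
    rw [← H0.mk_rel (prod_susp_rel c d _ _ _ _ η H), h, H0.mk_susp]
  incl_left {X Y Y' n n' i i'} c d := by
    obtain ⟨η, h, H⟩ := incl_left n i n' i'
    -- Stabilisation along the auxiliary index changes only the framing, so the product is first
    -- compared by `reframe`; the remaining change `η` is then viewed as a reindexing along the
    -- identity.
    have e := c.reframe_prod d (𝔖.sum n i n' i') (𝔖.sum n (𝔖.next i) n' i') (𝔖.incl n i)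
      (FramingSpace.Hom.id _) ((𝔖.incl (n + n') (𝔖.addIdx i i')).comp η) H
    refine (congrArg (H0.mk 𝔖) e).trans ?_
    exact (H0.mk_rel (reindex_refl_rel ((c.prod d (𝔖.sum n i n' i')).reframe
      (𝔖.incl (n + n') (𝔖.addIdx i i'))) η)).symm.trans
        ((h _ _ _).trans (H0.mk_incl (c.prod d (𝔖.sum n i n' i'))))
  incl_right {X Y Y' n n' i i'} c d := by
    obtain ⟨η, h, H⟩ := incl_right n i n' i'
    have e := c.reframe_prod d (𝔖.sum n i n' i') (𝔖.sum n i n' (𝔖.next i'))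
      (FramingSpace.Hom.id _) (𝔖.incl n' i') ((𝔖.incl (n + n') (𝔖.addIdx i i')).comp η) H
    refine (congrArg (H0.mk 𝔖) e).trans ?_
    exact (H0.mk_rel (reindex_refl_rel ((c.prod d (𝔖.sum n i n' i')).reframe
      (𝔖.incl (n + n') (𝔖.addIdx i i'))) η)).symm.trans
        ((h _ _ _).trans (H0.mk_incl (c.prod d (𝔖.sum n i n' i'))))
  assoc {X Y Y' Y'' n n' n'' i i' i''} c d e := by
    obtain ⟨η, h, H⟩ := assoc n i n' i' n'' i''
    rw [← H0.mk_rel (prod_assoc_rel c d e _ _ _ _ η H), h]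
  one_left {X Y Y' n i} s c := by
    obtain ⟨η, h, H⟩ := one_left n i
    rw [← H0.mk_rel (ofSection_prod_rel s _ _ c _ η (H _)), h]
  one_right {X Y Y' n i} s c := by
    obtain ⟨η, h, H⟩ := one_right n i
    rw [← H0.mk_rel (prod_ofSection_rel s _ _ c _ η (H _)), h]

end

section

variable {k : Type u} [Field k]

/-! ### Linear automorphisms of affine spaces -/

section Linear

variable {n : ℕ} {R S : Type u} [CommRing R] [CommRing S]

/-- The column of coordinate functions. -/
def coordVec (n : ℕ) (B : Scheme.{u}) : Fin n → Γ(Aff n B, ⊤) := Aff.coord B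

/-- The homomorphism of rings of global functions. -/
abbrev gl {V W : Scheme.{u}} (f : V ⟶ W) : Γ(W, ⊤) →+* Γ(V, ⊤) := f.appTop.hom

lemma gl_comp {A B C : Scheme.{u}} (f : A ⟶ B) (g : B ⟶ C) : (gl f).comp (gl g) = gl (f ≫ g) :=
  RingHom.ext fun x => (ExplicitCorr.comp_appTop_apply f g x).symm

lemma gl_id (A : Scheme.{u}) : gl (𝟙 A) = RingHom.id _ := RingHom.ext fun x => by
  change (𝟙 A : A ⟶ A).appTop x = x
  rw [Scheme.Hom.id_appTop]; rfl

/-- The endomorphism of `𝔸ⁿ` given by a matrix. -/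
def linHom {B : Scheme.{u}} (M : Matrix (Fin n) (Fin n) Γ(B, ⊤)) : Aff n B ⟶ Aff n B :=
  Aff.lift (Aff.str n B) ((M.map (gl (Aff.str n B))).mulVec (coordVec n B))

lemma linHom_over {B : Scheme.{u}} (M : Matrix (Fin n) (Fin n) Γ(B, ⊤)) :
    linHom M ≫ Aff.str n B = Aff.str n B := AffineSpace.homOfVector_over _ _

lemma linHom_coord {B : Scheme.{u}} (M : Matrix (Fin n) (Fin n) Γ(B, ⊤)) :
    gl (linHom M) ∘ coordVec n B = (M.map (gl (Aff.str n B))).mulVec (coordVec n B) :=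
  funext fun _ => AffineSpace.homOfVector_appTop_coord _ _ _

lemma aff_hom_ext_vec {V B : Scheme.{u}} {f g : V ⟶ Aff n B}
    (h : f ≫ Aff.str n B = g ≫ Aff.str n B)
    (h' : gl f ∘ coordVec n B = gl g ∘ coordVec n B) : f = g :=
  ExplicitCorr.aff_hom_ext h fun i => congrFun h' i

lemma gl_comp_mulVec {V B : Scheme.{u}} (f : V ⟶ B) (M : Matrix (Fin n) (Fin n) Γ(B, ⊤))
    (v : Fin n → Γ(B, ⊤)) : gl f ∘ M.mulVec v = (M.map (gl f)).mulVec (gl f ∘ v) :=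
  funext fun i => RingHom.map_mulVec (gl f) M v i

lemma gl_comp_map {A B C : Scheme.{u}} (f : A ⟶ B) (g : B ⟶ C)
    (M : Matrix (Fin n) (Fin n) Γ(C, ⊤)) : (M.map (gl g)).map (gl f) = M.map (gl (f ≫ g)) := by
  rw [← gl_comp, Matrix.map_map]; rfl

lemma gl_comp_comp {A B C : Scheme.{u}} (f : A ⟶ B) (g : B ⟶ C)
    (v : Fin n → Γ(C, ⊤)) : gl f ∘ gl g ∘ v = gl (f ≫ g) ∘ v := by
  rw [← gl_comp]; rfl

/-- The entries of `N` come from the base and are unchanged by pullback along `linHom M`.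
Composition is in diagrammatic order, so the matrix applied first is the right factor. -/
lemma linHom_comp {B : Scheme.{u}} (M N : Matrix (Fin n) (Fin n) Γ(B, ⊤)) :
    linHom M ≫ linHom N = linHom (N * M) := by
  refine aff_hom_ext_vec (by rw [Category.assoc, linHom_over, linHom_over, linHom_over]) ?_
  rw [← gl_comp_comp, linHom_coord, linHom_coord, gl_comp_mulVec, linHom_coord, gl_comp_map,
    linHom_over, Matrix.mulVec_mulVec, Matrix.map_mul]

lemma linHom_one (B : Scheme.{u}) : linHom (1 : Matrix (Fin n) (Fin n) Γ(B, ⊤)) = 𝟙 _ := by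
  refine aff_hom_ext_vec (by rw [linHom_over, Category.id_comp]) ?_
  rw [linHom_coord, Matrix.map_one _ (map_zero _) (map_one _), Matrix.one_mulVec, gl_id]
  rfl

lemma linHom_map {A B : Scheme.{u}} (f : A ⟶ B) (M : Matrix (Fin n) (Fin n) Γ(B, ⊤)) :
    linHom (M.map (gl f)) ≫ AffineSpace.map (ULift.{u} (Fin n)) f =
      AffineSpace.map (ULift.{u} (Fin n)) f ≫ linHom M := by
  have h : gl (AffineSpace.map (ULift.{u} (Fin n)) f) ∘ coordVec n B = coordVec n A :=
    funext fun _ => AffineSpace.map_appTop_coord _ _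
  refine aff_hom_ext_vec (by
    rw [Category.assoc, Category.assoc, linHom_over, AffineSpace.map_over, reassoc_of% linHom_over])
    ?_
  rw [← gl_comp_comp, ← gl_comp_comp, h, linHom_coord, linHom_coord, gl_comp_mulVec, h,
    gl_comp_map, gl_comp_map, AffineSpace.map_over]

/-- The automorphism of `𝔸ⁿ` given by an invertible matrix. -/
def linIso {B : Scheme.{u}} (g : Matrix.GeneralLinearGroup (Fin n) Γ(B, ⊤)) : Aff n B ≅ Aff n B where
  hom := linHom g.1
  inv := linHom g⁻¹.1
  hom_inv_id := by rw [linHom_comp, ← Units.val_mul, inv_mul_cancel, Units.val_one, linHom_one]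
  inv_hom_id := by rw [linHom_comp, ← Units.val_mul, mul_inv_cancel, Units.val_one, linHom_one]

end Linear

/-! ### Linear actions on framings -/

open Matrix (GeneralLinearGroup)

/-- A natural action of invertible matrices on framings of level `n`, which act on the coordinates
through a homomorphism `mat` of groups. -/
structure LinAct (ι : Type) [Fintype ι] [DecidableEq ι] (n : ℕ) (𝓕 : FramingSpace.{u}) where
  mat : ∀ (R : Type u) [CommRing R], GeneralLinearGroup ι R →* GeneralLinearGroup (Fin n) R
  mat_map : ∀ (R S : Type u) [CommRing R] [CommRing S] (f : R →+* S) (g : GeneralLinearGroup ι R),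
    mat S (GeneralLinearGroup.map f g) = GeneralLinearGroup.map f (mat R g)
  act : ∀ (W : Scheme.{u}), GeneralLinearGroup ι Γ(W, ⊤) → 𝓕.sec.obj (op W) → 𝓕.sec.obj (op W)
  act_one : ∀ W φ, act W 1 φ = φ
  act_mul : ∀ W g h φ, act W (g * h) φ = act W g (act W h φ)
  act_map : ∀ (V W : Scheme.{u}) (f : V ⟶ W) g φ,
    𝓕.sec.map f.op (act W g φ) = act V (GeneralLinearGroup.map (gl f) g) (𝓕.sec.map f.op φ)
  zero_act : ∀ W g φ, 𝓕.zero (act W g φ) = 𝓕.zero φ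

namespace ExplicitCorr

variable {ι : Type} [Fintype ι] [DecidableEq ι] {n : ℕ} {𝓕 : FramingSpace.{u}} {X T : Sch k}
  {Y : (Sch k)ᵒᵖ ⥤ Type u} (L : LinAct ι n 𝓕)

/-- The action of an invertible matrix on a correspondence. -/
def lin (c : ExplicitCorr n 𝓕 X Y) (g : GeneralLinearGroup ι Γ(X.left, ⊤)) :
    ExplicitCorr n 𝓕 X Y :=
  c.move (linIso (L.mat _ g)) (linHom_over _)
    (L.act c.W (GeneralLinearGroup.map (gl c.base) g) c.φ) (L.zero_act _ _ _)

lemma lin_e_base (c : ExplicitCorr n 𝓕 X Y) (g : GeneralLinearGroup ι Γ(X.left, ⊤)) :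
    (c.lin L g).base = c.base := by
  change (c.e ≫ linHom _) ≫ _ = c.e ≫ _
  rw [Category.assoc, linHom_over]

lemma lin_e_hom (c : ExplicitCorr n 𝓕 X Y) (g : GeneralLinearGroup ι Γ(X.left, ⊤)) :
    (c.lin L g).e ≫ Aff.str n X.left ≫ X.hom = c.e ≫ Aff.str n X.left ≫ X.hom := by
  change (c.e ≫ linHom _) ≫ _ = _
  rw [Category.assoc, reassoc_of% linHom_over]

lemma act_map_congr {V W : Scheme.{u}} {f f' : V ⟶ W} (e : f = f')
    (g : GeneralLinearGroup ι Γ(W, ⊤)) {φ φ' : 𝓕.sec.obj (op V)} (h : φ = φ') :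
    L.act V (GeneralLinearGroup.map (gl f) g) φ = L.act V (GeneralLinearGroup.map (gl f') g) φ' := by
  rw [e, h]

lemma act_map_map {U V W : Scheme.{u}} (f : U ⟶ V) (f' : V ⟶ W)
    (g : GeneralLinearGroup ι Γ(W, ⊤)) (φ : 𝓕.sec.obj (op U)) :
    L.act U (GeneralLinearGroup.map (gl f) (GeneralLinearGroup.map (gl f') g)) φ =
      L.act U (GeneralLinearGroup.map (gl (f ≫ f')) g) φ := by
  rw [← gl_comp, GeneralLinearGroup.map_comp]
  rfl

lemma lin_φAt (c : ExplicitCorr n 𝓕 X Y) (g : GeneralLinearGroup ι Γ(X.left, ⊤)) {V : Scheme.{u}}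
    (j : V ⟶ c.W) :
    (c.lin L g).φAt j = L.act V (GeneralLinearGroup.map (gl (j ≫ c.base)) g) (c.φAt j) :=
  (L.act_map _ _ _ _ _).trans (act_map_map L _ _ _ _)

lemma lin_gAt (c : ExplicitCorr n 𝓕 X Y) (g : GeneralLinearGroup ι Γ(X.left, ⊤)) {V : Scheme.{u}}
    (j : V ⟶ c.W) (h) (w) (w') : (c.lin L g).gAt j h w = c.gAt j h w' :=
  move_gAt _ _ _ _ _ _ _ _

lemma mem_lin_Z (c : ExplicitCorr n 𝓕 X Y) (g : GeneralLinearGroup ι Γ(X.left, ⊤)) (x) :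
    x ∈ (c.lin L g).Z ↔ linHom (L.mat _ g)⁻¹.1 x ∈ c.Z := Iff.rfl

/-- A criterion for a correspondence to be obtained from another one by a linear action. -/
lemma lin_rel {b c : ExplicitCorr n 𝓕 X Y} {g : GeneralLinearGroup ι Γ(X.left, ⊤)} (j : b.W ⟶ c.W)
    (he : j ≫ c.e = b.e ≫ linHom (L.mat _ g).1)
    (hφ : c.φAt j = L.act b.W (GeneralLinearGroup.map (gl b.base) g) (b.φAt (𝟙 _)))
    (hg : ∀ h w w', c.gAt j h w = b.gAt (𝟙 _) h w')
    (hZ : ∀ x, linHom (L.mat _ g)⁻¹.1 x ∈ b.Z ↔ x ∈ c.Z) : (b.lin L g).Rel c := by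
  have r : c.RestrictsTo (b.lin L g) j := by
    refine ⟨he, ?_, ?_⟩
    · exact hφ.trans ((lin_φAt _ _ _ _).trans (act_map_congr L (Category.id_comp _) _ rfl)).symm
    · have w : 𝟙 b.W ≫ b.e ≫ Aff.str n X.left ≫ X.hom =
          (b.lin L g).e ≫ Aff.str n X.left ≫ X.hom := by
        rw [lin_e_hom, Category.id_comp]
      exact (hg _ _ w).trans (lin_gAt _ _ _ _ _ _ _).symm
  refine r.rel ?_
  ext x
  exact hZ x

lemma lin_one_rel (c : ExplicitCorr n 𝓕 X Y) : (c.lin L 1).Rel c := by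
  refine lin_rel L (𝟙 _) ?_ ?_ (fun _ _ _ => rfl) fun x => ?_
  · rw [map_one, Units.val_one, linHom_one, Category.id_comp, Category.comp_id]
  · rw [map_one, L.act_one]
  · rw [map_one, inv_one, Units.val_one, linHom_one]
    rfl

/-- Both `mat` and `act` are multiplicative, so the identity of the neighbourhood compares the two
sides. A factorisation of a matrix can thus be treated one factor at a time. -/
lemma lin_lin_rel (c : ExplicitCorr n 𝓕 X Y) (g h : GeneralLinearGroup ι Γ(X.left, ⊤)) :
    (c.lin L (h * g)).Rel ((c.lin L g).lin L h) := by
  refine lin_rel L (c := (c.lin L g).lin L h) (𝟙 c.W) ?_ ?_ (fun _ w w' => ?_) fun x => ?_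
  · rw [map_mul, Units.val_mul, ← linHom_comp]
    exact (Category.id_comp _).trans (Category.assoc _ _ _)
  · refine (lin_φAt L (c.lin L g) h (𝟙 c.W)).trans ?_
    rw [map_mul, L.act_mul]
    refine act_map_congr L ((Category.id_comp _).trans (lin_e_base L _ _)) _ ?_
    exact (lin_φAt L _ _ _).trans (act_map_congr L (Category.id_comp _) _ rfl)
  · refine (lin_gAt L (c.lin L g) h (𝟙 c.W) _ _ ?_).trans (lin_gAt _ _ _ _ _ _ _)
    refine Eq.trans ?_ w'
    exact congrArg (𝟙 c.W ≫ ·) (lin_e_hom L c g)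
  · rw [mem_lin_Z, mem_lin_Z, map_mul, mul_inv_rev, Units.val_mul, ← linHom_comp,
      Scheme.Hom.comp_apply]

lemma RestrictsTo.lin {b c : ExplicitCorr n 𝓕 X Y} {j : b.W ⟶ c.W} (r : c.RestrictsTo b j)
    (g : GeneralLinearGroup ι Γ(X.left, ⊤)) : (c.lin L g).RestrictsTo (b.lin L g) j := by
  refine ⟨(Category.assoc _ _ _).symm.trans (congrArg (· ≫ _) r.comp_e), ?_, ?_⟩
  · refine (lin_φAt L c g j).trans (Eq.trans ?_ (lin_φAt L b g (𝟙 _)).symm)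
    refine act_map_congr L ?_ _ r.φ_eq
    rw [Category.id_comp, ← Category.assoc, r.comp_e]
  · have w : 𝟙 b.W ≫ b.e ≫ Aff.str n X.left ≫ X.hom =
        (b.lin L g).e ≫ Aff.str n X.left ≫ X.hom := by rw [lin_e_hom, Category.id_comp]
    refine (lin_gAt L c g j _ _ ?_).trans (Eq.trans (r.gAt_eq_of_comp (Category.id_comp _).symm _ _ w)
      (lin_gAt L b g (𝟙 _) _ _ w).symm)
    rw [← w, Category.id_comp, ← r.comp_e, Category.assoc]

/-- The converse of `Rel.exists_restrict`. -/
lemma RestrictsTo.rel_of {b c d : ExplicitCorr n 𝓕 X Y} {i : d.W ⟶ b.W} {j : d.W ⟶ c.W}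
    (r : b.RestrictsTo d i) (r' : c.RestrictsTo d j) (h : d.Z = b.Z) (h' : d.Z = c.Z) :
    b.Rel c := by
  refine ⟨h.symm.trans h', d.W, i, j, r'.comp_e.trans r.comp_e.symm, ?_, r.φ_eq.trans r'.φ_eq.symm,
    ?_⟩
  · rw [r.comp_e, ← h]
    exact d.nbhd
  · have w : 𝟙 d.W ≫ d.e ≫ Aff.str n X.left ≫ X.hom =
        (i ≫ b.e) ≫ Aff.str n X.left ≫ X.hom := by rw [Category.id_comp, r.comp_e]
    exact (r.gAt_eq_of_comp (Category.id_comp _).symm _ _ w).trans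
      (r'.gAt_eq_of_comp (Category.id_comp _).symm _ _ w).symm

lemma Rel.lin {b c : ExplicitCorr n 𝓕 X Y} (r : b.Rel c) (g : GeneralLinearGroup ι Γ(X.left, ⊤)) :
    (b.lin L g).Rel (c.lin L g) := by
  obtain ⟨a, i, i', h, h', r, r'⟩ := r.exists_restrict
  exact (r.lin L g).rel_of (r'.lin L g)
    (congrArg (fun Z : Closeds _ => Z.preimage (linIso (L.mat _ g)).inv.continuous) h)
    (congrArg (fun Z : Closeds _ => Z.preimage (linIso (L.mat _ g)).inv.continuous) h')

/-- The matrix has entries on the base and specialises with it. Acting on a constant family by a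
matrix over the line therefore gives a homotopy between the actions of its two specialisations. -/
lemma lin_pull_rel (c : ExplicitCorr n 𝓕 X Y) (g : GeneralLinearGroup ι Γ(X.left, ⊤)) (a : T ⟶ X) :
    ((c.pull a).lin L (GeneralLinearGroup.map (gl a.left) g)).Rel ((c.lin L g).pull a) := by
  have h1 : linHom (L.mat _ (GeneralLinearGroup.map (gl a.left) g)).1 ≫
      AffineSpace.map (ULift.{u} (Fin n)) a.left = AffineSpace.map _ a.left ≫ linHom (L.mat _ g).1 := by
    rw [L.mat_map]
    exact linHom_map _ _
  obtain ⟨j, hj, hj1⟩ : ∃ j : (c.pull a).W ⟶ ((c.lin L g).pull a).W,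
      j ≫ ((c.lin L g).pull a).e = (c.pull a).e ≫ linHom (L.mat _ (GeneralLinearGroup.map (gl a.left) g)).1 ∧
      (j ≫ (c.lin L g).pullFst a : (c.pull a).W ⟶ c.W) = c.pullFst a := by
    refine ⟨pullLift (c := c.lin L g) a (c.pullFst a) ((c.pull a).e ≫ _) ?_, pullLift_e _ _ _ _,
      pullLift_fst _ _ _ _⟩
    rw [Category.assoc, h1, ← Category.assoc, ← pullFst_e, Category.assoc]
    rfl
  refine lin_rel L j hj ?_ ?_ ?_
  · refine (pull_φAt _ _ _).trans ((φAt_congr (c.lin L g) hj1).trans ?_)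
    refine (lin_φAt L c g _).trans ?_
    rw [act_map_map, pull_φAt, Category.id_comp]
    refine act_map_congr L ?_ _ rfl
    rw [base, reassoc_of% pullFst_e, AffineSpace.map_over, base, Category.assoc]
  · intro h w w'
    have w'' : c.pullFst a ≫ c.e ≫ Aff.str n X.left ≫ X.hom = h := by
      rw [reassoc_of% pullFst_e, ← w', Category.id_comp, AffineSpace.map_over_assoc, Over.w]
    refine (pull_gAt _ _ _ _ _).trans ((gAt_congr (c.lin L g) hj1 _ _ ?_).trans
      ((lin_gAt L c g _ _ _ w'').trans ((gAt_congr c (Category.id_comp _).symm _ _ ?_).trans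
        (pull_gAt _ _ _ _ _).symm)))
    · exact (congrArg (c.pullFst a ≫ ·) (lin_e_hom L c g)).trans w''
    · exact (congrArg (· ≫ _) (Category.id_comp _)).trans w''
  · intro x
    have h2 : linHom (L.mat _ (GeneralLinearGroup.map (gl a.left) g))⁻¹.1 ≫
        AffineSpace.map (ULift.{u} (Fin n)) a.left =
          AffineSpace.map _ a.left ≫ linHom (L.mat _ g)⁻¹.1 := by
      rw [L.mat_map, ← map_inv]
      exact linHom_map _ _
    change AffineSpace.map _ a.left (linHom _ x) ∈ c.Z ↔ linHom _ (AffineSpace.map _ a.left x) ∈ c.Z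
    rw [comp_apply_congr h2]

end ExplicitCorr

/-! ### Triviality of the action on classes -/

section Matrices

variable {ι : Type} [Fintype ι] [DecidableEq ι] {R S : Type*} [CommRing R] [CommRing S]

/-- Elementary matrices. -/
def elem {a b : ι} (h : a ≠ b) (s : R) : GeneralLinearGroup ι R where
  val := Matrix.transvection a b s
  inv := Matrix.transvection a b (-s)
  val_inv := by rw [Matrix.transvection_mul_transvection_same _ _ h, add_neg_cancel,
    Matrix.transvection_zero]
  inv_val := by rw [Matrix.transvection_mul_transvection_same _ _ h, neg_add_cancel,
    Matrix.transvection_zero]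

lemma map_elem (f : R →+* S) {a b : ι} (h : a ≠ b) (s : R) :
    GeneralLinearGroup.map f (elem h s) = elem h (f s) := by
  ext i j
  simp [elem, Matrix.transvection, Matrix.one_apply, Matrix.single_apply, apply_ite f]

lemma elem_zero {a b : ι} (h : a ≠ b) : elem h (0 : R) = 1 :=
  Units.ext (Matrix.transvection_zero a b)

lemma elem_mulVec {a b : ι} (h : a ≠ b) (s : R) (v : ι → R) :
    (elem h s).1.mulVec v = Function.update v a (v a + s * v b) := by
  ext i
  change (1 + Matrix.single a b s).mulVec v i = _
  rw [Matrix.add_mulVec, Matrix.one_mulVec, Matrix.single_mulVec, Pi.add_apply]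
  by_cases hi : i = a
  · subst hi; simp
  · simp [hi]

/-- The sign change of one coordinate. -/
def signGL (z : ι) : GeneralLinearGroup ι R where
  val := Matrix.diagonal (Function.update 1 z (-1))
  inv := Matrix.diagonal (Function.update 1 z (-1))
  val_inv := by
    rw [Matrix.diagonal_mul_diagonal, ← Matrix.diagonal_one]
    congr 1
    ext i
    by_cases h : i = z
    · subst h; simp
    · simp [h]
  inv_val := by
    rw [Matrix.diagonal_mul_diagonal, ← Matrix.diagonal_one]
    congr 1
    ext i
    by_cases h : i = z
    · subst h; simp
    · simp [h]

lemma signGL_mulVec (z : ι) (v : ι → R) :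
    (signGL z).1.mulVec v = Function.update v z (-v z) := by
  ext i
  change (Matrix.diagonal _).mulVec v i = _
  rw [Matrix.mulVec_diagonal]
  by_cases h : i = z
  · subst h; simp
  · simp [h]

/-- The permutation of the coordinates. -/
def permGL (σ : Equiv.Perm ι) : GeneralLinearGroup ι R where
  val := σ⁻¹.permMatrix R
  inv := σ.permMatrix R
  val_inv := by rw [← Matrix.permMatrix_mul]; simp
  inv_val := by rw [← Matrix.permMatrix_mul]; simp

/-- The inverse in the definition of `permGL` makes it multiplicative in `σ` and lets it act on
vectors as `permIso` acts on coordinates. -/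
lemma permGL_mulVec (σ : Equiv.Perm ι) (v : ι → R) : (permGL σ).1.mulVec v = v ∘ σ.symm :=
  Matrix.permMatrix_mulVec _

lemma permGL_one : (permGL 1 : GeneralLinearGroup ι R) = 1 := by
  refine Units.ext (Matrix.ext_of_mulVec_single fun i => ?_)
  rw [permGL_mulVec, Units.val_one, Matrix.one_mulVec]
  rfl

lemma permGL_mul (σ τ : Equiv.Perm ι) : (permGL (σ * τ) : GeneralLinearGroup ι R) =
    permGL σ * permGL τ := by
  refine Units.ext (Matrix.ext_of_mulVec_single fun i => ?_)
  rw [Units.val_mul, ← Matrix.mulVec_mulVec, permGL_mulVec, permGL_mulVec, permGL_mulVec]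
  rfl

lemma map_permGL (f : R →+* S) (σ : Equiv.Perm ι) :
    GeneralLinearGroup.map f (permGL σ) = permGL σ := by
  ext i j
  simp [permGL, Equiv.Perm.permMatrix, PEquiv.toMatrix_apply, apply_ite f]

lemma map_signGL (f : R →+* S) (z : ι) :
    GeneralLinearGroup.map f (signGL z) = signGL z := by
  ext i j
  change f (Matrix.diagonal _ i j) = Matrix.diagonal _ i j
  by_cases h : i = j
  · subst h
    by_cases h' : i = z
    · subst h'; simp
    · simp [h']
  · simp [h]

/-- The matrix of the rotation of a coordinate plane by a right angle. -/
def rot {a b : ι} (h : a ≠ b) : GeneralLinearGroup ι R :=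
  elem h 1 * elem h.symm (-1) * elem h 1

/-- The three shears compose to the quarter turn `(x, y) ↦ (y, -x)` in the plane of `a` and `b`. -/
lemma rot_mulVec {a b : ι} (h : a ≠ b) (v : ι → R) :
    (rot h).1.mulVec v = Function.update (Function.update v a (v b)) b (-v a) := by
  rw [rot, Units.val_mul, Units.val_mul, ← Matrix.mulVec_mulVec, ← Matrix.mulVec_mulVec,
    elem_mulVec, elem_mulVec, elem_mulVec]
  ext i
  by_cases h1 : i = a
  · subst h1; simp [h, h.symm]
  · by_cases h2 : i = b
    · subst h2; simp [h, h.symm]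
    · simp [h1, h2]

/-- Read from the right: `signGL z` negates `z`, the half turn `rot ha * rot ha` negates `a` and
`z`, so together they negate only `a`; the quarter turn in the plane of `a` and `b` then exchanges
the entries with the correct signs. The determinant `-1` of the transposition is thereby moved to
the spare coordinate `z`. -/
lemma swap_eq_rot {a b z : ι} (h : a ≠ b) (ha : a ≠ z) (hb : b ≠ z) :
    (permGL (Equiv.swap a b) : GeneralLinearGroup ι R) = rot h * (rot ha * rot ha) * signGL z := by
  refine Units.ext (Matrix.ext_of_mulVec_single fun i => ?_)
  generalize (Pi.single i 1 : ι → R) = v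
  rw [Units.val_mul, Units.val_mul, Units.val_mul, ← Matrix.mulVec_mulVec, ← Matrix.mulVec_mulVec,
    ← Matrix.mulVec_mulVec, permGL_mulVec, signGL_mulVec, rot_mulVec, rot_mulVec, rot_mulVec]
  ext i
  by_cases h1 : i = a
  · subst h1; simp [h, h.symm, ha, hb]
  · by_cases h2 : i = b
    · subst h2; simp [h.symm, ha, hb]
    · by_cases h3 : i = z
      · subst h3; simp [h.symm, ha, hb, hb.symm, ha.symm, Equiv.swap_apply_of_ne_of_ne]
      · simp [h1, h2, h3, Equiv.swap_apply_of_ne_of_ne]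

end Matrices

end

/-! ### Triviality of permutation matrices on classes. -/

section

variable {k : Type u} [Field k]

open Matrix (GeneralLinearGroup)

/-- The change of framing given by a permutation matrix. -/
def LinAct.permHom {ι : Type} [Fintype ι] [DecidableEq ι] {n : ℕ} {𝓕 : FramingSpace.{u}}
    (L : LinAct ι n 𝓕) (σ : Equiv.Perm ι) : 𝓕.Hom 𝓕 where
  hom :=
    { app := fun W => TypeCat.ofHom fun φ => L.act W.unop (permGL σ) φ
      naturality := fun W W' f => by
        ext φ
        refine Eq.trans ?_ (L.act_map W'.unop W.unop f.unop (permGL σ) φ).symm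
        rw [map_permGL]
        rfl }
  zero_hom φ := L.zero_act _ _ φ

namespace H0

open ExplicitCorr

variable {𝔖 : FramingTheory.{u}} {ι : Type} [Fintype ι] [DecidableEq ι] {n : ℕ} {i : 𝔖.Idx}
  {X : Sch k} {Y : (Sch k)ᵒᵖ ⥤ Type u} (L : LinAct ι n (𝔖.space n i))

/-- The coordinate on the product with the affine line. -/
def lineCoord (X : Sch k) : Γ((line X).left, ⊤) := Aff.coord X.left (0 : Fin 1)

/-- The fibre at `t` of a constant family on which a matrix over the line acts: only the matrix is
specialised. -/
lemma mk_pull_lin (c : ExplicitCorr n (𝔖.space n i) X Y)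
    (g : GeneralLinearGroup ι Γ((line X).left, ⊤)) (t : ℤ) :
    mk 𝔖 (((c.pull (linePr X)).lin L g).pull (lineAt X t)) =
      mk 𝔖 (c.lin L (GeneralLinearGroup.map (gl (lineAt X t).left) g)) :=
  (mk_rel (lin_pull_rel L _ g _)).symm.trans
    (mk_rel ((pull_pull_of_comp_eq_id c _ _ (lineAt_linePr X t)).lin L _)).symm

/-- Elementary matrices are homotopic to the identity. -/
lemma mk_lin_elem (c : ExplicitCorr n (𝔖.space n i) X Y) {a b : ι} (h : a ≠ b) (s : Γ(X.left, ⊤)) :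
    mk 𝔖 (c.lin L (elem h s)) = mk 𝔖 c := by
  -- The homotopy is the elementary matrix whose entry is `s` times the coordinate of the line: the
  -- identity at `0`, the given matrix at `1`.
  have key : ∀ t : ℤ, GeneralLinearGroup.map (gl (lineAt X t).left)
      (elem h (gl (linePr X).left s * lineCoord X)) = elem h (s * (t : Γ(X.left, ⊤))) := by
    intro t
    rw [map_elem, map_mul]
    congr 2
    · change (gl (lineAt X t).left).comp (gl (linePr X).left) s = s
      rw [gl_comp, ← Over.comp_left, lineAt_linePr]
      exact congr($(gl_id X.left) s)
    · exact AffineSpace.homOfVector_appTop_coord _ _ _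
  have h0 := mk_pull_lin L c (elem h (gl (linePr X).left s * lineCoord X)) 0
  have h1 := mk_pull_lin L c (elem h (gl (linePr X).left s * lineCoord X)) 1
  rw [key, Int.cast_zero, mul_zero, elem_zero, mk_rel (lin_one_rel L c), mk_homotopy] at h0
  rw [key, Int.cast_one, mul_one] at h1
  exact h1.symm.trans h0

/-- The left factor acts last, on `c.lin L h`; this is why its triviality is assumed for every
correspondence. -/
lemma mk_lin_mul {g : GeneralLinearGroup ι Γ(X.left, ⊤)}
    (hg : ∀ c : ExplicitCorr n (𝔖.space n i) X Y, mk 𝔖 (c.lin L g) = mk 𝔖 c)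
    (h : GeneralLinearGroup ι Γ(X.left, ⊤)) (c : ExplicitCorr n (𝔖.space n i) X Y) :
    mk 𝔖 (c.lin L (g * h)) = mk 𝔖 (c.lin L h) :=
  (mk_rel (lin_lin_rel L c h g)).trans (hg _)

lemma mk_lin_rot {a b : ι} (h : a ≠ b) (c : ExplicitCorr n (𝔖.space n i) X Y) :
    mk 𝔖 (c.lin L (rot h)) = mk 𝔖 c := by
  rw [rot, mul_assoc, mk_lin_mul L (fun c => mk_lin_elem L c h _),
    mk_lin_mul L (fun c => mk_lin_elem L c h.symm _), mk_lin_elem]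

/-- In `swap_eq_rot` the sign change is the rightmost factor and acts first, so its triviality is
needed for this `c` only. The rotations are products of elementary matrices and act trivially on all
classes. -/
lemma mk_lin_swap {a b z : ι} (h : a ≠ b) (ha : a ≠ z) (hb : b ≠ z)
    (c : ExplicitCorr n (𝔖.space n i) X Y) (hc : mk 𝔖 (c.lin L (signGL z)) = mk 𝔖 c) :
    mk 𝔖 (c.lin L (permGL (Equiv.swap a b))) = mk 𝔖 c := by
  rw [swap_eq_rot h ha hb, mul_assoc, mul_assoc, mk_lin_mul L (mk_lin_rot L h),
    mk_lin_mul L (mk_lin_rot L ha), mk_lin_mul L (mk_lin_rot L ha), hc]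

lemma mk_lin_perm (H : ∀ (a b : ι), a ≠ b → ∀ c : ExplicitCorr n (𝔖.space n i) X Y,
      mk 𝔖 (c.lin L (permGL (Equiv.swap a b))) = mk 𝔖 c)
    (σ : Equiv.Perm ι) (c : ExplicitCorr n (𝔖.space n i) X Y) :
    mk 𝔖 (c.lin L (permGL σ)) = mk 𝔖 c := by
  induction σ using Equiv.Perm.swap_induction_on generalizing c with
  | one =>
    rw [permGL_one]
    exact mk_rel (lin_one_rel L c)
  | swap_mul f a b hab ih => rw [permGL_mul, mk_lin_mul L (H a b hab), ih]

end H0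

namespace ExplicitCorr

variable {ι ι' : Type} [Fintype ι] [DecidableEq ι] [Fintype ι'] [DecidableEq ι'] {n n' n'' : ℕ}
  {𝓕 𝓖 𝓗 : FramingSpace.{u}} {X : Sch k} {Y : (Sch k)ᵒᵖ ⥤ Type u}

lemma linHom_permGL (σ : Equiv.Perm (Fin n)) (B : Scheme.{u}) :
    linHom (permGL σ).1 = (permIso σ B).hom := by
  refine aff_hom_ext_vec (by rw [linHom_over, permIso_over]) ?_
  have := congrArg Units.val (map_permGL (gl (Aff.str n B)) σ)
  rw [linHom_coord]
  refine (congrArg (Matrix.mulVec · _) this).trans ((permGL_mulVec _ _).trans ?_)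
  exact funext fun i => (permIso_hom_coord σ B i).symm

lemma linHom_permGL_inv (σ : Equiv.Perm (Fin n)) (B : Scheme.{u}) :
    linHom (permGL σ)⁻¹.1 = (permIso σ B).inv := by
  have : (linIso (permGL σ)).inv = (permIso σ B).inv := by
    rw [Iso.inv_eq_inv]
    exact linHom_permGL σ B
  exact this

lemma reindex_reindex_rel (c : ExplicitCorr n 𝓕 X Y) (σ : Fin n ≃ Fin n') (η : 𝓕.Hom 𝓖)
    (τ : Fin n' ≃ Fin n'') (θ : 𝓖.Hom 𝓗) :
    (c.reindex (σ.trans τ) (η.comp θ)).Rel ((c.reindex σ η).reindex τ θ) := by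
  have h1 : (permIso (σ.trans τ) X.left).hom = (permIso σ X.left).hom ≫ (permIso τ X.left).hom :=
    aff_hom_ext (by rw [Category.assoc, permIso_over, permIso_over, permIso_over]) fun i => by
      rw [comp_appTop_apply, permIso_hom_coord, permIso_hom_coord, permIso_hom_coord]
      rfl
  have h2 : (permIso (σ.trans τ) X.left).inv = (permIso τ X.left).inv ≫ (permIso σ X.left).inv := by
    rw [← Iso.trans_inv, Iso.inv_eq_inv]
    exact h1
  refine reindex_rel (c := (c.reindex σ η).reindex τ θ) (𝟙 c.W) ?_ ?_ (fun h w w' => ?_) fun x => ?_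
  · rw [h1]
    exact (Category.id_comp _).trans (Category.assoc _ _ _)
  · refine (reindex_φAt (c.reindex σ η) τ θ (𝟙 c.W)).trans ?_
    exact congrArg (θ.hom.app _) (reindex_φAt c σ η (𝟙 c.W))
  · have w'' : 𝟙 c.W ≫ (c.reindex σ η).e ≫ Aff.str n' X.left ≫ X.hom = h := by
      rw [reindex_e, Category.assoc, reassoc_of% permIso_over]
      exact w'
    exact (reindex_gAt (c.reindex σ η) τ θ (𝟙 c.W) h _).trans (reindex_gAt c σ η (𝟙 c.W) h w'')
  · rw [h2, Scheme.Hom.comp_apply]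
    rfl

/-- The action of a permutation matrix is a permutation of the coordinates. -/
lemma reindex_lin_rel (L : LinAct ι n 𝓕) (τ : Equiv.Perm ι) (σ : Equiv.Perm (Fin n)) (η : 𝓕.Hom 𝓕)
    (hmat : ∀ (R : Type u) [CommRing R], L.mat R (permGL τ) = permGL σ)
    (hη : ∀ (W : Scheme.{u}) φ, L.act W (permGL τ) φ = η.hom.app (op W) φ)
    (c : ExplicitCorr n 𝓕 X Y) : (c.reindex σ η).Rel (c.lin L (permGL τ)) := by
  refine reindex_rel (c := c.lin L (permGL τ)) (𝟙 c.W) ?_ ?_ (fun h w w' => ?_) fun x => ?_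
  · rw [← linHom_permGL, ← hmat]
    exact Category.id_comp _
  · refine (lin_φAt L c _ (𝟙 c.W)).trans ?_
    rw [map_permGL, hη]
  · exact lin_gAt L c _ (𝟙 c.W) h _ w'
  · rw [mem_lin_Z, hmat, linHom_permGL_inv]

/-- The extension of a permutation by a fixed point at the beginning. -/
def onePerm (σ : Equiv.Perm (Fin n)) : Equiv.Perm (Fin (1 + n)) :=
  finSumFinEquiv.permCongr (Equiv.sumCongr (Equiv.refl _) σ)

lemma onePerm_castAdd (σ : Equiv.Perm (Fin n)) (i : Fin 1) :
    onePerm σ (Fin.castAdd n i) = Fin.castAdd n i := by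
  simp [onePerm, Equiv.permCongr_apply]

lemma onePerm_natAdd (σ : Equiv.Perm (Fin n)) (i : Fin n) :
    onePerm σ (Fin.natAdd 1 i) = Fin.natAdd 1 (σ i) := by
  simp [onePerm, Equiv.permCongr_apply]

lemma onePerm_symm_castAdd (σ : Equiv.Perm (Fin n)) (i : Fin 1) :
    (onePerm σ).symm (Fin.castAdd n i) = Fin.castAdd n i := by
  rw [Equiv.symm_apply_eq, onePerm_castAdd]

lemma onePerm_symm_natAdd (σ : Equiv.Perm (Fin n)) (i : Fin n) :
    (onePerm σ).symm (Fin.natAdd 1 i) = Fin.natAdd 1 (σ.symm i) := by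
  rw [Equiv.symm_apply_eq, onePerm_natAdd, Equiv.apply_symm_apply]

lemma onePerm_swap (a b : Fin n) :
    onePerm (Equiv.swap a b) = Equiv.swap (Fin.natAdd 1 a) (Fin.natAdd 1 b) := by
  ext1 i
  refine Fin.addCases (fun i => ?_) (fun i => ?_) i
  · rw [onePerm_castAdd, Equiv.swap_apply_of_ne_of_ne]
    · intro h
      have := congrArg Fin.val h
      simp at this
      omega
    · intro h
      have := congrArg Fin.val h
      simp at this
      omega
  · rw [onePerm_natAdd]
    exact (Function.Injective.map_swap (Fin.natAdd_injective _ 1) _ _ _).symm ▸ rfl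

/-- Moves a permutation of the coordinates to the stabilised level, where the first coordinate stays
fixed and is available as a spare one. -/
lemma reindex_susp_rel (c : ExplicitCorr n 𝓕 X Y) (σ : Equiv.Perm (Fin n)) (η : 𝓕.Hom 𝓕)
    (s : (affineSpace (Fin 1)).Pairing 𝓕 𝓖) (η' : 𝓖.Hom 𝓖)
    (H : ∀ (W : Scheme.{u}) x φ, s.hom.app (op W) (x, η.hom.app (op W) φ) =
      η'.hom.app (op W) (s.hom.app (op W) (x, φ))) :
    ((c.susp s).reindex (onePerm σ) η').Rel ((c.reindex σ η).susp s) := by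
  let p := permIso (onePerm σ) X.left
  have q : p.hom ≫ projR 1 n X.left = projR 1 n X.left ≫ (permIso σ X.left).hom := by
    refine aff_hom_ext (by simp [p, permIso]) fun i => ?_
    simp only [p, comp_appTop_apply, projR_coord, permIso_hom_coord]
    rw [onePerm_symm_natAdd]
  obtain ⟨j, hj, hj1⟩ : ∃ j : (c.susp s).W ⟶ ((c.reindex σ η).susp s).W,
      j ≫ ((c.reindex σ η).susp s).e = (c.susp s).e ≫ p.hom ∧
      (j ≫ (c.reindex σ η).suspFst s : (c.susp s).W ⟶ c.W) = c.suspFst s := by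
    refine exists_suspLift (c := c.reindex σ η) s _ _ ?_
    rw [Category.assoc, q, ← Category.assoc, ← suspFst_e, Category.assoc]
    rfl
  have q' : p.inv ≫ projR 1 n X.left = projR 1 n X.left ≫ (permIso σ X.left).inv := by
    rw [Iso.inv_comp_eq, ← Category.assoc, Iso.eq_comp_inv, q]
  refine reindex_rel j hj ?_ (fun h w w' => ?_) fun x => ?_
  · rw [susp_φAt, susp_φAt, Category.id_comp, ← H]
    refine pairing_congr _ ?_ ?_
    · funext _
      change (j ≫ ((c.reindex σ η).susp s).e).appTop _ = (𝟙 _ ≫ (c.susp s).e).appTop _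
      rw [hj, comp_appTop_apply, permIso_hom_coord, onePerm_symm_castAdd, Category.id_comp]
    · exact (φAt_congr (c.reindex σ η) hj1).trans (reindex_φAt _ _ _ _)
  · have w'' : c.suspFst s ≫ c.e ≫ Aff.str n X.left ≫ X.hom = h := by
      rw [reassoc_of% suspFst_e, ← w', Category.id_comp, AffineSpace.reindex_over_assoc]
    have w3 : c.suspFst s ≫ (c.reindex σ η).e ≫ Aff.str n X.left ≫ X.hom = h := by
      rw [reindex_e, Category.assoc, reassoc_of% permIso_over]
      exact w''
    refine (susp_gAt _ _ _ _ _).trans ((gAt_congr (c.reindex σ η) hj1 _ _ w3).trans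
      ((reindex_gAt c σ η _ _ _).trans ((gAt_congr c (Category.id_comp _).symm _ _ ?_).trans
        (susp_gAt _ _ _ _ _).symm)))
    exact (congrArg (· ≫ _) (Category.id_comp _)).trans w''
  · rw [mem_susp_Z, mem_susp_Z, notMem_basicOpen_comp, permIso_inv_coord, onePerm_castAdd,
      comp_apply_congr q']
    rfl

lemma linHom_sign_coord (z i : Fin n) (B : Scheme.{u}) :
    gl (linHom (signGL z : GeneralLinearGroup (Fin n) Γ(B, ⊤)).1) (Aff.coord B i) =
      Function.update (coordVec n B) z (-coordVec n B z) i := by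
  have := congrArg Units.val (map_signGL (gl (Aff.str n B)) z)
  refine (congrFun (linHom_coord _) i).trans ?_
  exact congrFun ((congrArg (Matrix.mulVec · _) this).trans (signGL_mulVec _ _)) i

/-- The change of sign of the first coordinate acts trivially on suspensions. -/
lemma lin_sign_susp_rel (c : ExplicitCorr n 𝓕 X Y) (s : (affineSpace (Fin 1)).Pairing 𝓕 𝓖)
    (L : LinAct (Fin (1 + n)) (1 + n) 𝓖)
    (hL : ∀ (R : Type u) [CommRing R] g, L.mat R g = g)
    (H : ∀ (W : Scheme.{u}) (x : Γ(W, ⊤)) φ,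
      L.act W (signGL (Fin.castAdd n 0)) (s.hom.app (op W) ((fun _ => x : Fin 1 → _), φ)) =
        s.hom.app (op W) ((fun _ => -x : Fin 1 → _), φ)) :
    ((c.susp s).lin L (signGL (Fin.castAdd n 0))).Rel (c.susp s) := by
  let p : Aff (1 + n) X.left ⟶ Aff (1 + n) X.left := linHom (signGL (Fin.castAdd n 0)).1
  have q : p ≫ projR 1 n X.left = projR 1 n X.left := by
    refine aff_hom_ext ?_ fun i => ?_
    · rw [Category.assoc, AffineSpace.reindex_over]
      exact linHom_over _
    · rw [comp_appTop_apply, projR_coord]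
      refine (linHom_sign_coord _ _ _).trans (Function.update_of_ne ?_ _ _)
      intro h
      have := congrArg Fin.val h
      simp at this
  have q0 : p.appTop (Aff.coord X.left (Fin.castAdd n 0)) = -Aff.coord X.left (Fin.castAdd n 0) :=
    (linHom_sign_coord _ _ _).trans (Function.update_self _ _ _)
  -- The map `(x, w) ↦ (-x, w)` of `𝔸¹ × W`. It turns the étale map into its composite with the sign
  -- change and the framing `(x, φ)` into `(-x, φ)`, thus absorbing both effects of the action
  -- without any homotopy.
  obtain ⟨j, hj, hj1⟩ : ∃ j : (c.susp s).W ⟶ (c.susp s).W,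
      j ≫ (c.susp s).e = (c.susp s).e ≫ p ∧ j ≫ c.suspFst s = c.suspFst s :=
    exists_suspLift s _ _ (by rw [Category.assoc, q, suspFst_e])
  refine lin_rel L j ?_ ?_ (fun h w w' => ?_) fun x => ?_
  · rw [hL]
    exact hj
  · rw [map_signGL]
    refine (susp_φAt _ _ _).trans (Eq.trans ?_
      ((congrArg (L.act _ _) (susp_φAt _ _ _)).trans (H _ _ _)).symm)
    refine pairing_congr _ ?_ (φAt_congr _ ?_)
    · funext _
      change (j ≫ (c.susp s).e).appTop _ = -(𝟙 _ ≫ (c.susp s).e).appTop _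
      rw [hj, comp_appTop_apply, q0, map_neg, Category.id_comp]
    · rw [hj1, Category.id_comp]
  · refine (susp_gAt _ _ _ _ _).trans ((gAt_congr _ ?_ _ _ _).trans (susp_gAt _ _ _ _ _).symm)
    rw [hj1, Category.id_comp]
  · have h' : linHom (L.mat _ (signGL (Fin.castAdd n 0)))⁻¹.1 = p := by
      rw [hL]
      rfl
    have h2 : (projR 1 n X.left) (p x) = (projR 1 n X.left) x := by
      rw [← Scheme.Hom.comp_apply, q]
    -- `-x` vanishes exactly where `x` does, as `-1` is a unit.
    rw [h', mem_susp_Z, mem_susp_Z, notMem_basicOpen_comp, q0, h2, ← neg_one_mul,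
      Scheme.basicOpen_mul, Scheme.basicOpen_of_isUnit _ isUnit_one.neg, top_inf_eq]

end ExplicitCorr

namespace H0

open ExplicitCorr

variable {𝔖 : FramingTheory.{u}} {n : ℕ} {i : 𝔖.Idx} {X : Sch k} {Y : (Sch k)ᵒᵖ ⥤ Type u}

/-- Permutations of the coordinates act trivially on classes. -/
lemma mk_lin_perm_of_susp (L : LinAct (Fin n) n (𝔖.space n i))
    (L' : LinAct (Fin (1 + n)) (1 + n) (𝔖.space (1 + n) i))
    (hL : ∀ (R : Type u) [CommRing R] g, L.mat R g = g)
    (hL' : ∀ (R : Type u) [CommRing R] g, L'.mat R g = g)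
    (H : ∀ (W : Scheme.{u}) x φ (σ : Equiv.Perm (Fin n)),
      (𝔖.susp n i).hom.app (op W) (x, L.act W (permGL σ) φ) =
        L'.act W (permGL (onePerm σ)) ((𝔖.susp n i).hom.app (op W) (x, φ)))
    (H' : ∀ (W : Scheme.{u}) (x : Γ(W, ⊤)) φ,
      L'.act W (signGL (Fin.castAdd n 0)) ((𝔖.susp n i).hom.app (op W) ((fun _ => x : Fin 1 → _), φ)) =
        (𝔖.susp n i).hom.app (op W) ((fun _ => -x : Fin 1 → _), φ))
    (σ : Equiv.Perm (Fin n)) (c : ExplicitCorr n (𝔖.space n i) X Y) :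
    mk 𝔖 (c.lin L (permGL σ)) = mk 𝔖 c := by
  refine mk_lin_perm L (fun a b hab c => ?_) σ c
  have h1 := reindex_susp_rel c (Equiv.swap a b) (L.permHom _) (𝔖.susp n i)
    (L'.permHom (onePerm (Equiv.swap a b))) (fun W x φ => H W x φ _)
  have h2 := (reindex_lin_rel L (Equiv.swap a b) (Equiv.swap a b) (L.permHom _) (fun R _ => hL R _)
    (fun _ _ => rfl) c)
  have h3 := (reindex_lin_rel L' (onePerm (Equiv.swap a b)) (onePerm (Equiv.swap a b)) (L'.permHom _)
    (fun R _ => hL' R _) (fun _ _ => rfl) (c.susp (𝔖.susp n i)))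
  -- The action on `c` is turned into a reindexing, which commutes with stabilisation, and back into
  -- the action of a transposition at level `1 + n`. The stabilising coordinate is then the third
  -- index required by `mk_lin_swap`.
  rw [← mk_rel h2, ← mk_susp, ← mk_rel h1, mk_rel h3, onePerm_swap]
  refine (mk_lin_swap L' (z := Fin.castAdd n 0) ?_ ?_ ?_ _ ?_).trans (mk_susp c)
  · exact fun h => hab (Fin.natAdd_injective _ 1 h)
  · intro h
    have := congrArg Fin.val h
    simp at this
  · intro h
    have := congrArg Fin.val h
    simp at this
  · exact mk_rel (lin_sign_susp_rel c _ L' hL' H')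

end H0

end

section

/-! ### Operations on points of tautological bundles -/

open Matrix (GeneralLinearGroup)

section Tau

variable {r c r' c' r'' c'' : Type} [Fintype c] [Fintype c'] [Fintype c''] [Fintype r] [DecidableEq r]
  [Fintype r'] [DecidableEq r'] [Fintype r''] [DecidableEq r''] {W : Scheme.{u}}

lemma SameQuot.trans {R : Type u} [CommRing R] {A A' A'' : Matrix r c R} {v v' v'' : r → R}
    (h : SameQuot A A' v v') (h' : SameQuot A' A'' v' v'') : SameQuot A A'' v v'' := by
  obtain ⟨g, rfl, rfl⟩ := h
  obtain ⟨g', rfl, rfl⟩ := h'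
  exact ⟨g' * g, by rw [Units.val_mul, Matrix.mul_assoc],
    by rw [Units.val_mul, Matrix.mulVec_mulVec]⟩

lemma SameQuot.reindex {R : Type u} [CommRing R] (er : r ≃ r') (ec : c ≃ c')
    {A A' : Matrix r c R} {v v' : r → R} (h : SameQuot A A' v v') :
    SameQuot (Matrix.reindex er ec A) (Matrix.reindex er ec A') (v ∘ er.symm) (v' ∘ er.symm) := by
  obtain ⟨g, rfl, rfl⟩ := h
  refine ⟨⟨Matrix.reindex er er g.1, Matrix.reindex er er g⁻¹.1, ?_, ?_⟩, ?_, ?_⟩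
  · simp only [Matrix.reindex_apply, Matrix.submatrix_mul_equiv, ← Units.val_mul, mul_inv_cancel,
      Units.val_one, Matrix.submatrix_one_equiv]
  · simp only [Matrix.reindex_apply, Matrix.submatrix_mul_equiv, ← Units.val_mul, inv_mul_cancel,
      Units.val_one, Matrix.submatrix_one_equiv]
  · simp only [Matrix.reindex_apply, Matrix.submatrix_mul_equiv]
  · simp only [Matrix.reindex_apply, Matrix.submatrix_mulVec_equiv]
    rw [Function.comp_assoc]
    simp

lemma SameQuot.mul_right {R : Type u} [CommRing R] {A A' : Matrix r c R} {v v' : r → R}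
    (h : SameQuot A A' v v') (M : Matrix c c' R) : SameQuot (A * M) (A' * M) v v' := by
  obtain ⟨g, rfl, rfl⟩ := h
  exact ⟨g, by rw [Matrix.mul_assoc], rfl⟩

/-- One invertible matrix at each point suffices; on a general `V` it is preceded by the gluing of
`d`. `of_res` is the case of identity matrices, which is too narrow when the rows have to change. -/
lemma TauDatum.Equiv.of_sameQuot {d d' : TauDatum r c W} (hU : ∀ y, d'.U y ≤ d.U y)
    (h : ∀ y, SameQuot ((d.A y).map (resHom W (hU y))) (d'.A y) (resHom W (hU y) ∘ d.v y) (d'.v y)) :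
    d.Equiv d' := by
  intro x y V hx hy
  refine (d.glue x y V hx (hy.trans (hU y))).trans ?_
  convert (h y).map (resHom W hy) using 1
  · ext i j; simp [resHom_resHom]
  · funext i; simp [resHom_resHom]

/-- Reindexing of rows and columns. -/
def TauDatum.reindex (er : r ≃ r') (ec : c ≃ c') (d : TauDatum r c W) : TauDatum r' c' W where
  U := d.U
  mem := d.mem
  A x := Matrix.reindex er ec (d.A x)
  v x := d.v x ∘ er.symm
  epi x := by
    obtain ⟨B, hB⟩ := d.epi x
    refine ⟨Matrix.reindex ec er B, ?_⟩
    simp only [Matrix.reindex_apply, Matrix.submatrix_mul_equiv, hB, Matrix.submatrix_one_equiv]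
  glue x y V hx hy := (d.glue x y V hx hy).reindex er ec

lemma TauDatum.Equiv.reindex (er : r ≃ r') (ec : c ≃ c') {d e : TauDatum r c W} (h : d.Equiv e) :
    (d.reindex er ec).Equiv (e.reindex er ec) := fun x y V hx hy => (h x y V hx hy).reindex er ec

/-- Reindexing of rows and columns. -/
def tauReindex (er : r ≃ r') (ec : c ≃ c') :
    FramingSpace.Hom.{u} (tauSpace r c) (tauSpace r' c') where
  hom :=
    { app := fun W => TypeCat.ofHom (Quot.map (TauDatum.reindex er ec) fun _ _ h => h.reindex er ec)
      naturality := fun W W' f => by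
        ext φ
        obtain ⟨d, rfl⟩ := Quot.exists_rep φ
        exact Quot.sound (TauDatum.Equiv.refl (r := r') (c := c') ((d.reindex er ec).pull f.unop)) }
  zero_hom φ := by
    obtain ⟨d, rfl⟩ := Quot.exists_rep φ
    ext x
    exact ⟨fun h i => er.symm_apply_apply i ▸ h (er i), fun h i => h _⟩

/-- Permutations of the rows give isomorphic quotients. -/
lemma tauReindex_perm (er : Equiv.Perm r) (ec : c ≃ c') (φ : (tauSpace.{u} r c).sec.obj (op W)) :
    (tauReindex er ec).hom.app (op W) φ = (tauReindex (Equiv.refl _) ec).hom.app (op W) φ := by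
  obtain ⟨d, rfl⟩ := Quot.exists_rep φ
  refine (Quot.sound (TauDatum.Equiv.of_sameQuot (d := d.reindex (Equiv.refl r) ec)
    (d' := d.reindex er ec) (fun y => le_rfl) fun y =>
    ⟨permGL er, ?_, ?_⟩)).symm
  · refine (congrArg (fun M : Matrix r c' Γ(W, d.U y) =>
      (permGL er : GeneralLinearGroup r Γ(W, d.U y)).1 * M) (matrix_resHom_self _ _)).trans ?_
    ext i j
    change ((permGL er : GeneralLinearGroup r Γ(W, d.U y)).1.mulVec
      fun i => (d.A y).submatrix id ec.symm i j) i = _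
    rw [permGL_mulVec]
    rfl
  · exact (congrArg (Matrix.mulVec _) (vec_resHom_self _ _)).trans (permGL_mulVec _ _)

section Action

variable [DecidableEq c]

/-- The product of a matrix with the image of a matrix under a homomorphism of rings. -/
def mulMap {R S : Type u} [CommRing R] [CommRing S] (f : S →+* R) (A : Matrix r c R)
    (M : Matrix c c S) : Matrix r c R := A * M.map f

lemma map_mulMap {R R' S : Type u} [CommRing R] [CommRing R'] [CommRing S] (f : S →+* R)
    (h : R →+* R') (A : Matrix r c R) (M : Matrix c c S) :
    (mulMap f A M).map h = mulMap (h.comp f) (A.map h) M := by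
  rw [mulMap, Matrix.map_mul, Matrix.map_map]; rfl

lemma mulMap_mul {R S : Type u} [CommRing R] [CommRing S] (f : S →+* R) (A : Matrix r c R)
    (M N : Matrix c c S) : mulMap f A (M * N) = mulMap f (mulMap f A M) N := by
  rw [mulMap, mulMap, mulMap, Matrix.map_mul, Matrix.mul_assoc]

lemma mulMap_one {R S : Type u} [CommRing R] [CommRing S] (f : S →+* R) (A : Matrix r c R) :
    mulMap f A 1 = A := by
  rw [mulMap, Matrix.map_one _ (map_zero _) (map_one _), Matrix.mul_one]

lemma mulMap_epi {R S : Type u} [CommRing R] [CommRing S] (f : S →+* R) {A : Matrix r c R}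
    {B : Matrix c r R} (h : A * B = 1) {M N : Matrix c c S} (h' : M * N = 1) :
    mulMap f A M * (N.map f * B) = 1 := by
  rw [← Matrix.mul_assoc]
  change mulMap f (mulMap f A M) N * B = 1
  rw [← mulMap_mul, h', mulMap_one, h]

lemma SameQuot.mulMap {R S : Type u} [CommRing R] [CommRing S] (f : S →+* R) {A A' : Matrix r c R}
    {v v' : r → R} (h : SameQuot A A' v v') (M : Matrix c c S) :
    SameQuot (mulMap f A M) (mulMap f A' M) v v' := h.mul_right _

lemma mulMap_res {U V : W.Opens} (h : V ≤ U) (A : Matrix r c Γ(W, U)) (M : Matrix c c Γ(W, ⊤)) :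
    (mulMap (resHom W le_top) A M).map (resHom W h) =
      mulMap (resHom W le_top) (A.map (resHom W h)) M := by
  rw [map_mulMap]
  congr 1
  ext x
  exact resHom_resHom _ _ _

/-- Precomposition of the epimorphism with the inverse of an automorphism of `𝒪ᶜ`. -/
def TauDatum.act (g : GeneralLinearGroup c Γ(W, ⊤)) (d : TauDatum r c W) : TauDatum r c W where
  U := d.U
  mem := d.mem
  A x := mulMap (resHom W le_top) (d.A x) g⁻¹.1
  v := d.v
  epi x := by
    obtain ⟨B, hB⟩ := d.epi x
    exact ⟨_, mulMap_epi _ hB (by rw [← Units.val_mul, inv_mul_cancel, Units.val_one])⟩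
  glue x y V hx hy := by
    rw [mulMap_res, mulMap_res]
    exact (d.glue x y V hx hy).mulMap _ _

lemma TauDatum.Equiv.act (g : GeneralLinearGroup c Γ(W, ⊤)) {d e : TauDatum r c W} (h : d.Equiv e) :
    (d.act g).Equiv (e.act g) := by
  intro x y V hx hy
  convert (h x y V hx hy).mulMap (resHom W le_top) g⁻¹.1 using 1
  · exact mulMap_res _ _ _
  · exact mulMap_res _ _ _
  · rfl
  · rfl

/-- Precomposition of the epimorphism with the inverse of an automorphism of `𝒪ᶜ`. -/
def tauAct (g : GeneralLinearGroup c Γ(W, ⊤)) :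
    (tauSpace.{u} r c).sec.obj (op W) → (tauSpace.{u} r c).sec.obj (op W) :=
  Quot.map (TauDatum.act g) fun _ _ h => h.act g

lemma tauAct_one (φ : (tauSpace.{u} r c).sec.obj (op W)) : tauAct 1 φ = φ := by
  obtain ⟨d, rfl⟩ := Quot.exists_rep φ
  refine Quot.sound (TauDatum.Equiv.of_res (fun y => le_rfl) (fun y => ?_)
    fun y => vec_resHom_self _ _)
  exact (matrix_resHom_self _ _).trans (mulMap_one _ _)

/-- Precomposition reverses products and inversion reverses them back: this is the reason for using
the inverse in the action. -/
lemma tauAct_mul (g h : GeneralLinearGroup c Γ(W, ⊤)) (φ : (tauSpace.{u} r c).sec.obj (op W)) :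
    tauAct (g * h) φ = tauAct g (tauAct h φ) := by
  obtain ⟨d, rfl⟩ := Quot.exists_rep φ
  refine Quot.sound (TauDatum.Equiv.of_res (fun y => le_rfl) (fun y => ?_)
    fun y => vec_resHom_self _ _)
  refine (matrix_resHom_self _ _).trans ?_
  change mulMap _ (d.A y) (g * h)⁻¹.1 = mulMap _ (mulMap _ (d.A y) h⁻¹.1) g⁻¹.1
  rw [mul_inv_rev, Units.val_mul, mulMap_mul]
  rfl

lemma tauAct_map {V : Scheme.{u}} (f : V ⟶ W) (g : GeneralLinearGroup c Γ(W, ⊤))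
    (φ : (tauSpace.{u} r c).sec.obj (op W)) :
    (tauSpace r c).sec.map f.op (tauAct g φ) =
      tauAct (GeneralLinearGroup.map (gl f) g) ((tauSpace r c).sec.map f.op φ) := by
  obtain ⟨d, rfl⟩ := Quot.exists_rep φ
  refine Quot.sound (TauDatum.Equiv.of_res (fun y => le_rfl) (fun y => ?_)
    fun y => vec_resHom_self _ _)
  refine (matrix_resHom_self _ _).trans ((map_mulMap _ _ _ _).trans ?_)
  exact congrArg (_ * ·) (matrix_app_resHom f le_top g⁻¹.1)

lemma zero_tauAct (g : GeneralLinearGroup c Γ(W, ⊤)) (φ : (tauSpace.{u} r c).sec.obj (op W)) :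
    (tauSpace r c).zero (tauAct g φ) = (tauSpace r c).zero φ := by
  obtain ⟨d, rfl⟩ := Quot.exists_rep φ
  rfl

/-- The inverse of `permGL e` is `e.permMatrix`, whose `j`-th column has its only nonzero entry in
row `e.symm j`. The sum defining the product of matrices therefore collapses to one term. -/
lemma tauAct_perm (e : Equiv.Perm c) (φ : (tauSpace.{u} r c).sec.obj (op W)) :
    tauAct (permGL e) φ = (tauReindex (Equiv.refl _) e).hom.app (op W) φ := by
  obtain ⟨d, rfl⟩ := Quot.exists_rep φ
  refine Quot.sound (TauDatum.Equiv.of_res (fun y => le_rfl) (fun y => ?_)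
    fun y => vec_resHom_self _ _)
  refine (matrix_resHom_self _ _).trans ?_
  ext i j
  change mulMap _ (d.A y) (e.permMatrix _) i j = d.A y i (e.symm j)
  rw [mulMap, Matrix.mul_apply, Finset.sum_eq_single (e.symm j)]
  · simp [Equiv.Perm.permMatrix, PEquiv.toMatrix_apply]
  · intro l _ hl
    have : e l ≠ j := fun h => hl (by rw [← h, Equiv.symm_apply_apply])
    simp [Equiv.Perm.permMatrix, PEquiv.toMatrix_apply, this]
  · simp

lemma act_sign_apply (z : c) (d : TauDatum r c W) (y : W) (i : r) (j : c) :
    (d.act (signGL z)).A y i j = if j = z then -d.A y i j else d.A y i j := by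
  change mulMap _ (d.A y) (Matrix.diagonal _) i j = _
  rw [mulMap, Matrix.diagonal_map (map_zero _), Matrix.mul_diagonal]
  split_ifs with h
  · subst h; simp
  · simp [h]

end Action

end Tau

end

section

open Matrix (GeneralLinearGroup)

/-! ### Identities between operations on framings -/

/-- `σ` identifies `a ⊕ (b ⊕ c)` with `(a ⊕ b) ⊕ c`. -/
structure IsAssoc {a b c ab bc s s' : Type} (e₁ : ab ⊕ c ≃ s) (e₂ : a ⊕ b ≃ ab) (e₃ : a ⊕ bc ≃ s')
    (e₄ : b ⊕ c ≃ bc) (σ : s' ≃ s) : Prop where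
  left : ∀ x, σ (e₃ (.inl x)) = e₁ (.inl (e₂ (.inl x)))
  mid : ∀ x, σ (e₃ (.inr (e₄ (.inl x)))) = e₁ (.inl (e₂ (.inr x)))
  right : ∀ x, σ (e₃ (.inr (e₄ (.inr x)))) = e₁ (.inr x)

/-- `σ` identifies `a ⊕ (b ⊕ c)` with `b ⊕ (a ⊕ c)`. -/
structure IsLeftComm {a b c ac bc s s' : Type} (e₁ : b ⊕ ac ≃ s) (e₂ : a ⊕ c ≃ ac) (e₃ : a ⊕ bc ≃ s')
    (e₄ : b ⊕ c ≃ bc) (σ : s' ≃ s) : Prop where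
  left : ∀ x, σ (e₃ (.inl x)) = e₁ (.inr (e₂ (.inl x)))
  mid : ∀ x, σ (e₃ (.inr (e₄ (.inl x)))) = e₁ (.inl x)
  right : ∀ x, σ (e₃ (.inr (e₄ (.inr x)))) = e₁ (.inr (e₂ (.inr x)))

/-- `σ` identifies `(a ⊕ b) ⊕ c` with `(a ⊕ c) ⊕ b`. -/
structure IsRightComm {a b c ab ac s s' : Type} (e₁ : ac ⊕ b ≃ s) (e₂ : a ⊕ c ≃ ac)
    (e₃ : ab ⊕ c ≃ s') (e₄ : a ⊕ b ≃ ab) (σ : s' ≃ s) : Prop where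
  left : ∀ x, σ (e₃ (.inl (e₄ (.inl x)))) = e₁ (.inl (e₂ (.inl x)))
  mid : ∀ x, σ (e₃ (.inl (e₄ (.inr x)))) = e₁ (.inr x)
  right : ∀ x, σ (e₃ (.inr x)) = e₁ (.inl (e₂ (.inr x)))

/-- `σ` is the sum of `α` and `β`. -/
structure IsSum {a b a' b' s s' : Type} (e : a ⊕ b ≃ s) (e' : a' ⊕ b' ≃ s') (α : a ≃ a') (β : b ≃ b')
    (σ : s ≃ s') : Prop where
  left : ∀ x, σ (e (.inl x)) = e' (.inl (α x))
  right : ∀ x, σ (e (.inr x)) = e' (.inr (β x))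

lemma eq_reindex {s s' t t' : Type} {R : Type u} {M : Matrix s t R} {N : Matrix s' t' R} {σ : s' ≃ s} {τ : t' ≃ t}
    (h : ∀ i j, M (σ i) (τ j) = N i j) : M = Matrix.reindex σ τ N := by
  ext i j
  rw [Matrix.reindex_apply, Matrix.submatrix_apply, ← h, Equiv.apply_symm_apply,
    Equiv.apply_symm_apply]

lemma eq_comp_symm {s s' : Type} {R : Type u} {v : s → R} {w : s' → R} {σ : s' ≃ s} (h : ∀ i, v (σ i) = w i) :
    v = w ∘ σ.symm := by
  ext i
  rw [Function.comp_apply, ← h, Equiv.apply_symm_apply]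

section Identities

variable {r₁ r₂ r₃ r₁₂ r₂₃ s s' c₁ c₂ c₃ c₁₂ c₂₃ t t' : Type}
  [Fintype r₁] [Fintype r₂] [Fintype r₃] [Fintype r₁₂] [Fintype r₂₃] [Fintype s] [Fintype s']
  [DecidableEq r₁] [DecidableEq r₂] [DecidableEq r₃] [DecidableEq r₁₂] [DecidableEq r₂₃]
  [DecidableEq s] [DecidableEq s']
  [Fintype c₁] [Fintype c₂] [Fintype c₃] [Fintype c₁₂] [Fintype c₂₃] [Fintype t] [Fintype t']

section Assoc

variable {er₁ : r₁₂ ⊕ r₃ ≃ s} {er₂ : r₁ ⊕ r₂ ≃ r₁₂} {er₃ : r₁ ⊕ r₂₃ ≃ s'} {er₄ : r₂ ⊕ r₃ ≃ r₂₃}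
  {ec₁ : c₁₂ ⊕ c₃ ≃ t} {ec₂ : c₁ ⊕ c₂ ≃ c₁₂} {ec₃ : c₁ ⊕ c₂₃ ≃ t'} {ec₄ : c₂ ⊕ c₃ ≃ c₂₃}
  {σ : s' ≃ s} {τ : t' ≃ t}

lemma vecSum_assoc (h : IsAssoc er₁ er₂ er₃ er₄ σ) {R : Type u} (u : r₁ → R) (v : r₂ → R)
    (w : r₃ → R) : vecSum er₁ (vecSum er₂ u v) w = vecSum er₃ u (vecSum er₄ v w) ∘ σ.symm := by
  refine eq_comp_symm fun i => ?_
  obtain ⟨i | i, rfl⟩ := er₃.surjective i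
  · simp [h.left]
  · obtain ⟨i | i, rfl⟩ := er₄.surjective i
    · simp [h.mid]
    · simp [h.right]

/-- The nine blocks are compared separately. Keeping the index bijections arbitrary lets the same
computation serve rank stabilisation and external products, whose columns are grouped differently.
-/
lemma blockSum_assoc (h : IsAssoc er₁ er₂ er₃ er₄ σ) (h' : IsAssoc ec₁ ec₂ ec₃ ec₄ τ) {R : Type u}
    [CommRing R] (A : Matrix r₁ c₁ R) (B : Matrix r₂ c₂ R) (C : Matrix r₃ c₃ R) :
    blockSum er₁ ec₁ (blockSum er₂ ec₂ A B) C =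
      Matrix.reindex σ τ (blockSum er₃ ec₃ A (blockSum er₄ ec₄ B C)) := by
  refine eq_reindex fun i j => ?_
  obtain ⟨i | i, rfl⟩ := er₃.surjective i
  · obtain ⟨j | j, rfl⟩ := ec₃.surjective j
    · simp [h.left, h'.left]
    · obtain ⟨j | j, rfl⟩ := ec₄.surjective j
      · simp [h.left, h'.mid]
      · simp [h.left, h'.right]
  · obtain ⟨i | i, rfl⟩ := er₄.surjective i
    · obtain ⟨j | j, rfl⟩ := ec₃.surjective j
      · simp [h.mid, h'.left]
      · obtain ⟨j | j, rfl⟩ := ec₄.surjective j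
        · simp [h.mid, h'.mid]
        · simp [h.mid, h'.right]
    · obtain ⟨j | j, rfl⟩ := ec₃.surjective j
      · simp [h.right, h'.left]
      · obtain ⟨j | j, rfl⟩ := ec₄.surjective j
        · simp [h.right, h'.mid]
        · simp [h.right, h'.right]

lemma tauSum_assoc (h : IsAssoc er₁ er₂ er₃ er₄ σ) (h' : IsAssoc ec₁ ec₂ ec₃ ec₄ τ) (W : Scheme.{u})
    (φ : (tauSpace.{u} r₁ c₁).sec.obj (op W)) (ψ : (tauSpace.{u} r₂ c₂).sec.obj (op W))
    (χ : (tauSpace.{u} r₃ c₃).sec.obj (op W)) :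
    (tauSum er₁ ec₁).hom.app (op W) ((tauSum er₂ ec₂).hom.app (op W) (φ, ψ), χ) =
      (tauReindex σ τ).hom.app (op W) ((tauSum er₃ ec₃).hom.app (op W)
        (φ, (tauSum er₄ ec₄).hom.app (op W) (ψ, χ))) := by
  obtain ⟨d, rfl⟩ := Quot.exists_rep φ
  obtain ⟨e, rfl⟩ := Quot.exists_rep ψ
  obtain ⟨f, rfl⟩ := Quot.exists_rep χ
  refine Quot.sound (TauDatum.Equiv.of_res (d := (d.sum er₂ ec₂ e).sum er₁ ec₁ f)
    (d' := (d.sum er₃ ec₃ (e.sum er₄ ec₄ f)).reindex σ τ)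
    -- The domains of the two local trivialisations agree only up to associativity of intersections,
    -- so an actual restriction occurs, which `blockSum_res` and `vecSum_res` move inside.
    (fun y => (inf_assoc (d.U y) (e.U y) (f.U y)).ge) (fun y => ?_) fun y => ?_)
  · refine (blockSum_res er₁ ec₁ _ _ _ _ _).trans ((congrArg (blockSum er₁ ec₁ · _)
      (blockSum_res er₂ ec₂ _ _ _ _ _)).trans ((blockSum_assoc h h' _ _ _).trans ?_))
    exact congrArg (fun M => Matrix.reindex σ τ (blockSum er₃ ec₃ _ M))
      (blockSum_res er₄ ec₄ _ _ _ _ _).symm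
  · refine (vecSum_res er₁ _ _ _ _ _).trans ((congrArg (vecSum er₁ · _)
      (vecSum_res er₂ _ _ _ _ _)).trans ((vecSum_assoc h _ _ _).trans ?_))
    exact congrArg (fun M => vecSum er₃ _ M ∘ σ.symm) (vecSum_res er₄ _ _ _ _ _).symm

end Assoc

section LeftComm

variable {r₁₃ c₁₃ : Type} [Fintype r₁₃] [DecidableEq r₁₃] [Fintype c₁₃]
  {er₁ : r₂ ⊕ r₁₃ ≃ s} {er₂ : r₁ ⊕ r₃ ≃ r₁₃} {er₃ : r₁ ⊕ r₂₃ ≃ s'} {er₄ : r₂ ⊕ r₃ ≃ r₂₃}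
  {ec₁ : c₂ ⊕ c₁₃ ≃ t} {ec₂ : c₁ ⊕ c₃ ≃ c₁₃} {ec₃ : c₁ ⊕ c₂₃ ≃ t'} {ec₄ : c₂ ⊕ c₃ ≃ c₂₃}
  {σ : s' ≃ s} {τ : t' ≃ t}

lemma vecSum_leftComm (h : IsLeftComm er₁ er₂ er₃ er₄ σ) {R : Type u} (u : r₁ → R) (v : r₂ → R)
    (w : r₃ → R) : vecSum er₁ v (vecSum er₂ u w) = vecSum er₃ u (vecSum er₄ v w) ∘ σ.symm := by
  refine eq_comp_symm fun i => ?_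
  obtain ⟨i | i, rfl⟩ := er₃.surjective i
  · simp [h.left]
  · obtain ⟨i | i, rfl⟩ := er₄.surjective i
    · simp [h.mid]
    · simp [h.right]

lemma blockSum_leftComm (h : IsLeftComm er₁ er₂ er₃ er₄ σ) (h' : IsLeftComm ec₁ ec₂ ec₃ ec₄ τ)
    {R : Type u} [CommRing R] (A : Matrix r₁ c₁ R) (B : Matrix r₂ c₂ R) (C : Matrix r₃ c₃ R) :
    blockSum er₁ ec₁ B (blockSum er₂ ec₂ A C) =
      Matrix.reindex σ τ (blockSum er₃ ec₃ A (blockSum er₄ ec₄ B C)) := by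
  refine eq_reindex fun i j => ?_
  obtain ⟨i | i, rfl⟩ := er₃.surjective i
  · obtain ⟨j | j, rfl⟩ := ec₃.surjective j
    · simp [h.left, h'.left]
    · obtain ⟨j | j, rfl⟩ := ec₄.surjective j
      · simp [h.left, h'.mid]
      · simp [h.left, h'.right]
  · obtain ⟨i | i, rfl⟩ := er₄.surjective i
    · obtain ⟨j | j, rfl⟩ := ec₃.surjective j
      · simp [h.mid, h'.left]
      · obtain ⟨j | j, rfl⟩ := ec₄.surjective j
        · simp [h.mid, h'.mid]
        · simp [h.mid, h'.right]
    · obtain ⟨j | j, rfl⟩ := ec₃.surjective j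
      · simp [h.right, h'.left]
      · obtain ⟨j | j, rfl⟩ := ec₄.surjective j
        · simp [h.right, h'.mid]
        · simp [h.right, h'.right]

lemma tauSum_leftComm (h : IsLeftComm er₁ er₂ er₃ er₄ σ) (h' : IsLeftComm ec₁ ec₂ ec₃ ec₄ τ)
    (W : Scheme.{u}) (φ : (tauSpace.{u} r₁ c₁).sec.obj (op W))
    (ψ : (tauSpace.{u} r₂ c₂).sec.obj (op W)) (χ : (tauSpace.{u} r₃ c₃).sec.obj (op W)) :
    (tauSum er₁ ec₁).hom.app (op W) (ψ, (tauSum er₂ ec₂).hom.app (op W) (φ, χ)) =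
      (tauReindex σ τ).hom.app (op W) ((tauSum er₃ ec₃).hom.app (op W)
        (φ, (tauSum er₄ ec₄).hom.app (op W) (ψ, χ))) := by
  obtain ⟨d, rfl⟩ := Quot.exists_rep φ
  obtain ⟨e, rfl⟩ := Quot.exists_rep ψ
  obtain ⟨f, rfl⟩ := Quot.exists_rep χ
  refine Quot.sound (TauDatum.Equiv.of_res (d := e.sum er₁ ec₁ (d.sum er₂ ec₂ f))
    (d' := (d.sum er₃ ec₃ (e.sum er₄ ec₄ f)).reindex σ τ)
    (fun y => (inf_left_comm (d.U y) (e.U y) (f.U y)).le) (fun y => ?_) fun y => ?_)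
  · refine (blockSum_res er₁ ec₁ _ _ _ _ _).trans ((congrArg (blockSum er₁ ec₁ _ ·)
      (blockSum_res er₂ ec₂ _ _ _ _ _)).trans ((blockSum_leftComm h h' _ _ _).trans ?_))
    exact congrArg (fun M => Matrix.reindex σ τ (blockSum er₃ ec₃ _ M))
      (blockSum_res er₄ ec₄ _ _ _ _ _).symm
  · refine (vecSum_res er₁ _ _ _ _ _).trans ((congrArg (vecSum er₁ _ ·)
      (vecSum_res er₂ _ _ _ _ _)).trans ((vecSum_leftComm h _ _ _).trans ?_))
    exact congrArg (fun M => vecSum er₃ _ M ∘ σ.symm) (vecSum_res er₄ _ _ _ _ _).symm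

end LeftComm

/-- Extension by zero in the first summand of a direct sum. -/
lemma tauSum_zeroCols_left {c₁₃ : Type} [Fintype c₁₃] {er : r₁ ⊕ r₂ ≃ s} {ec₁ : c₁₃ ⊕ c₂ ≃ t}
    {ec₂ : c₁ ⊕ c₃ ≃ c₁₃} {ec₃ : c₁₂ ⊕ c₃ ≃ t'} {ec₄ : c₁ ⊕ c₂ ≃ c₁₂} {τ : t' ≃ t}
    (h : IsRightComm ec₁ ec₂ ec₃ ec₄ τ) (W : Scheme.{u})
    (φ : (tauSpace.{u} r₁ c₁).sec.obj (op W)) (ψ : (tauSpace.{u} r₂ c₂).sec.obj (op W)) :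
    (tauSum er ec₁).hom.app (op W) ((tauZeroCols r₁ ec₂).hom.app (op W) φ, ψ) =
      (tauReindex (Equiv.refl _) τ).hom.app (op W) ((tauZeroCols s ec₃).hom.app (op W)
        ((tauSum er ec₄).hom.app (op W) (φ, ψ))) := by
  obtain ⟨d, rfl⟩ := Quot.exists_rep φ
  obtain ⟨e, rfl⟩ := Quot.exists_rep ψ
  refine Quot.sound (TauDatum.Equiv.of_res (d := (d.zeroCols ec₂).sum er ec₁ e)
    (d' := ((d.sum er ec₄ e).zeroCols ec₃).reindex (Equiv.refl _) τ)
    (fun y => le_rfl) (fun y => ?_) fun y => vec_resHom_self _ _)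
  refine (matrix_resHom_self _ _).trans (eq_reindex fun i j => ?_)
  obtain ⟨i | i, rfl⟩ := er.surjective i
  · obtain ⟨j | j, rfl⟩ := ec₃.surjective j
    · obtain ⟨j | j, rfl⟩ := ec₄.surjective j
      · simp [TauDatum.sum, TauDatum.zeroCols, h.left]
      · simp [TauDatum.sum, TauDatum.zeroCols, h.mid]
    · simp [TauDatum.sum, TauDatum.zeroCols, h.right]
  · obtain ⟨j | j, rfl⟩ := ec₃.surjective j
    · obtain ⟨j | j, rfl⟩ := ec₄.surjective j
      · simp [TauDatum.sum, TauDatum.zeroCols, h.left]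
      · simp [TauDatum.sum, TauDatum.zeroCols, h.mid]
    · simp [TauDatum.sum, TauDatum.zeroCols, h.right]

/-- Extension by zero in the second summand of a direct sum. -/
lemma tauSum_zeroCols_right {er : r₁ ⊕ r₂ ≃ s} {ec₁ : c₁ ⊕ c₂₃ ≃ t}
    {ec₂ : c₂ ⊕ c₃ ≃ c₂₃} {ec₃ : c₁₂ ⊕ c₃ ≃ t'} {ec₄ : c₁ ⊕ c₂ ≃ c₁₂} {τ : t' ≃ t}
    (h : IsAssoc ec₃ ec₄ ec₁ ec₂ τ.symm) (W : Scheme.{u})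
    (φ : (tauSpace.{u} r₁ c₁).sec.obj (op W)) (ψ : (tauSpace.{u} r₂ c₂).sec.obj (op W)) :
    (tauSum er ec₁).hom.app (op W) (φ, (tauZeroCols r₂ ec₂).hom.app (op W) ψ) =
      (tauReindex (Equiv.refl _) τ).hom.app (op W) ((tauZeroCols s ec₃).hom.app (op W)
        ((tauSum er ec₄).hom.app (op W) (φ, ψ))) := by
  obtain ⟨d, rfl⟩ := Quot.exists_rep φ
  obtain ⟨e, rfl⟩ := Quot.exists_rep ψ
  refine Quot.sound (TauDatum.Equiv.of_res (d := d.sum er ec₁ (e.zeroCols ec₂))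
    (d' := ((d.sum er ec₄ e).zeroCols ec₃).reindex (Equiv.refl _) τ)
    (fun y => le_rfl) (fun y => ?_) fun y => vec_resHom_self _ _)
  refine (matrix_resHom_self _ _).trans ?_
  ext i j
  obtain ⟨i | i, rfl⟩ := er.surjective i
  · obtain ⟨j | j, rfl⟩ := ec₁.surjective j
    · simp [TauDatum.sum, TauDatum.zeroCols, TauDatum.reindex, h.left]
    · obtain ⟨j | j, rfl⟩ := ec₂.surjective j
      · simp [TauDatum.sum, TauDatum.zeroCols, TauDatum.reindex, h.mid]
      · simp [TauDatum.sum, TauDatum.zeroCols, TauDatum.reindex, h.right]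
  · obtain ⟨j | j, rfl⟩ := ec₁.surjective j
    · simp [TauDatum.sum, TauDatum.zeroCols, TauDatum.reindex, h.left]
    · obtain ⟨j | j, rfl⟩ := ec₂.surjective j
      · simp [TauDatum.sum, TauDatum.zeroCols, TauDatum.reindex, h.mid]
      · simp [TauDatum.sum, TauDatum.zeroCols, TauDatum.reindex, h.right]

/-- Needed for suspensions: a permutation of columns before stabilising becomes one that fixes the
added column. `tauZeroCols_reindex` plays this part for the added zero columns. -/
lemma tauSum_reindex_right {er : r₁ ⊕ r₂ ≃ s} {er' : r₁ ⊕ r₃ ≃ s'} {ec : c₁ ⊕ c₂ ≃ t}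
    {ec' : c₁ ⊕ c₃ ≃ t'} {σ : r₂ ≃ r₃} {τ : c₂ ≃ c₃} {σ' : s ≃ s'} {τ' : t ≃ t'}
    (h : IsSum er er' (Equiv.refl _) σ σ') (h' : IsSum ec ec' (Equiv.refl _) τ τ') (W : Scheme.{u})
    (φ : (tauSpace.{u} r₁ c₁).sec.obj (op W)) (ψ : (tauSpace.{u} r₂ c₂).sec.obj (op W)) :
    (tauSum er' ec').hom.app (op W) (φ, (tauReindex σ τ).hom.app (op W) ψ) =
      (tauReindex σ' τ').hom.app (op W) ((tauSum er ec).hom.app (op W) (φ, ψ)) := by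
  obtain ⟨d, rfl⟩ := Quot.exists_rep φ
  obtain ⟨e, rfl⟩ := Quot.exists_rep ψ
  refine Quot.sound (TauDatum.Equiv.of_res (d := d.sum er' ec' (e.reindex σ τ))
    (d' := (d.sum er ec e).reindex σ' τ')
    (fun y => le_rfl) (fun y => ?_) fun y => ?_)
  · refine (matrix_resHom_self _ _).trans (eq_reindex fun i j => ?_)
    obtain ⟨i | i, rfl⟩ := er.surjective i <;> obtain ⟨j | j, rfl⟩ := ec.surjective j <;>
      simp [TauDatum.sum, TauDatum.reindex, h.left, h.right, h'.left, h'.right]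
  · refine (vec_resHom_self _ _).trans (eq_comp_symm (σ := σ') (w := (d.sum er ec e).v y) fun i => ?_)
    obtain ⟨i | i, rfl⟩ := er.surjective i <;>
      simp [TauDatum.sum, TauDatum.reindex, h.left, h.right]

lemma tauZeroCols_reindex {ec : c₁ ⊕ c₂ ≃ t} {ec' : c₃ ⊕ c₂ ≃ t'} {τ : c₁ ≃ c₃} {τ' : t ≃ t'}
    (h : IsSum ec ec' τ (Equiv.refl _) τ') (W : Scheme.{u})
    (φ : (tauSpace.{u} r₁ c₁).sec.obj (op W)) :
    (tauZeroCols r₁ ec').hom.app (op W) ((tauReindex (Equiv.refl _) τ).hom.app (op W) φ) =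
      (tauReindex (Equiv.refl _) τ').hom.app (op W) ((tauZeroCols r₁ ec).hom.app (op W) φ) := by
  obtain ⟨d, rfl⟩ := Quot.exists_rep φ
  refine Quot.sound (TauDatum.Equiv.of_res (d := (d.reindex (Equiv.refl _) τ).zeroCols ec')
    (d' := (d.zeroCols ec).reindex (Equiv.refl _) τ')
    (fun y => le_rfl) (fun y => ?_) fun y => vec_resHom_self _ _)
  refine (matrix_resHom_self _ _).trans (eq_reindex fun i j => ?_)
  obtain ⟨j | j, rfl⟩ := ec.surjective j <;>
    simp [TauDatum.zeroCols, TauDatum.reindex, h.left, h.right]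

/-- A framing of level `0` is a left unit. -/
lemma tauSum_empty_left [IsEmpty r₁] [IsEmpty c₁] {er : r₁ ⊕ r₂ ≃ s} {ec : c₁ ⊕ c₂ ≃ t}
    {σ : r₂ ≃ s} {τ : c₂ ≃ t} (h : ∀ x, σ x = er (.inr x)) (h' : ∀ x, τ x = ec (.inr x))
    (W : Scheme.{u}) (φ : (tauSpace.{u} r₁ c₁).sec.obj (op W))
    (ψ : (tauSpace.{u} r₂ c₂).sec.obj (op W)) :
    (tauSum er ec).hom.app (op W) (φ, ψ) = (tauReindex σ τ).hom.app (op W) ψ := by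
  obtain ⟨d, rfl⟩ := Quot.exists_rep φ
  obtain ⟨e, rfl⟩ := Quot.exists_rep ψ
  refine (Quot.sound (TauDatum.Equiv.of_res (d := e.reindex σ τ) (d' := d.sum er ec e)
    (fun y => inf_le_right) (fun y => ?_) fun y => ?_)).symm
  · refine Eq.symm ?_
    ext i j
    obtain ⟨i, rfl⟩ := σ.surjective i
    obtain ⟨j, rfl⟩ := τ.surjective j
    have hs : σ.symm (er (.inr i)) = i := by rw [← h, Equiv.symm_apply_apply]
    have ht : τ.symm (ec (.inr j)) = j := by rw [← h', Equiv.symm_apply_apply]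
    simp [TauDatum.sum, TauDatum.reindex, h, h', hs, ht]
    rfl
  · ext i
    obtain ⟨i, rfl⟩ := σ.surjective i
    have hs : σ.symm (er (.inr i)) = i := by rw [← h, Equiv.symm_apply_apply]
    simp [TauDatum.sum, TauDatum.reindex, h, hs]
    rfl

/-- A framing of level `0` is a right unit. -/
lemma tauSum_empty_right [IsEmpty r₂] [IsEmpty c₂] {er : r₁ ⊕ r₂ ≃ s} {ec : c₁ ⊕ c₂ ≃ t}
    {σ : r₁ ≃ s} {τ : c₁ ≃ t} (h : ∀ x, σ x = er (.inl x)) (h' : ∀ x, τ x = ec (.inl x))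
    (W : Scheme.{u}) (φ : (tauSpace.{u} r₁ c₁).sec.obj (op W))
    (ψ : (tauSpace.{u} r₂ c₂).sec.obj (op W)) :
    (tauSum er ec).hom.app (op W) (φ, ψ) = (tauReindex σ τ).hom.app (op W) φ := by
  obtain ⟨d, rfl⟩ := Quot.exists_rep φ
  obtain ⟨e, rfl⟩ := Quot.exists_rep ψ
  refine (Quot.sound (TauDatum.Equiv.of_res (d := d.reindex σ τ) (d' := d.sum er ec e)
    (fun y => inf_le_left) (fun y => ?_) fun y => ?_)).symm
  · refine Eq.symm ?_
    ext i j
    obtain ⟨i, rfl⟩ := σ.surjective i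
    obtain ⟨j, rfl⟩ := τ.surjective j
    have hs : σ.symm (er (.inl i)) = i := by rw [← h, Equiv.symm_apply_apply]
    have ht : τ.symm (ec (.inl j)) = j := by rw [← h', Equiv.symm_apply_apply]
    simp [TauDatum.sum, TauDatum.reindex, h, h', hs, ht]
    rfl
  · ext i
    obtain ⟨i, rfl⟩ := σ.surjective i
    have hs : σ.symm (er (.inl i)) = i := by rw [← h, Equiv.symm_apply_apply]
    simp [TauDatum.sum, TauDatum.reindex, h, hs]
    rfl

lemma tauReindex_comp (σ : r₁ ≃ r₂) (σ' : r₂ ≃ r₃) (τ : c₁ ≃ c₂) (τ' : c₂ ≃ c₃) :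
    tauReindex.{u} (σ.trans σ') (τ.trans τ') = (tauReindex σ τ).comp (tauReindex σ' τ') := by
  have : (tauReindex.{u} (σ.trans σ') (τ.trans τ')).hom =
      (tauReindex σ τ).hom ≫ (tauReindex σ' τ').hom := by
    ext W φ
    obtain ⟨d, rfl⟩ := Quot.exists_rep φ
    rfl
  change FramingSpace.Hom.mk _ _ = FramingSpace.Hom.mk _ _
  congr 1

/-- Extensions by zero are invariant under a sign change of the added coordinate. -/
lemma tauAct_sign_zeroCols [DecidableEq t] {ec : c₁ ⊕ c₂ ≃ t} (z : c₂) (W : Scheme.{u})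
    (φ : (tauSpace.{u} r₁ c₁).sec.obj (op W)) :
    tauAct (signGL (ec (.inr z))) ((tauZeroCols r₁ ec).hom.app (op W) φ) =
      (tauZeroCols r₁ ec).hom.app (op W) φ := by
  obtain ⟨d, rfl⟩ := Quot.exists_rep φ
  refine Quot.sound (TauDatum.Equiv.of_res (d := (d.zeroCols ec).act (signGL (ec (.inr z))))
    (d' := d.zeroCols ec) (fun y => le_rfl) (fun y => ?_) fun y => vec_resHom_self _ _)
  refine (matrix_resHom_self _ _).trans ?_
  ext i j
  rw [act_sign_apply]
  split_ifs with h
  · subst h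
    simp [TauDatum.zeroCols]
    exact neg_zero
  · rfl

lemma signGL_mul_apply {R : Type u} [CommRing R] (z : s) (M : Matrix s t R) (i : s) (j : t) :
    ((signGL z : GeneralLinearGroup s R).1 * M) i j = if i = z then -M i j else M i j := by
  refine (Matrix.diagonal_mul _ M i j).trans ?_
  split_ifs with h <;> simp [h]

/-- The sign change of the first coordinate of a suspension. -/
lemma tauAct_sign_susp [DecidableEq t] {er : Fin 1 ⊕ r₂ ≃ s} {ec : Fin 1 ⊕ c₂ ≃ t} (W : Scheme.{u})
    (x : Γ(W, ⊤)) (φ : (tauSpace.{u} r₂ c₂).sec.obj (op W)) :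
    tauAct (signGL (ec (.inl 0))) ((tauSum er ec).hom.app (op W)
      ((tauTriv (Fin 1)).hom.app (op W) (fun _ => x : Fin 1 → _), φ)) =
      (tauSum er ec).hom.app (op W)
        ((tauTriv (Fin 1)).hom.app (op W) (fun _ => -x : Fin 1 → _), φ) := by
  obtain ⟨d, rfl⟩ := Quot.exists_rep φ
  let b (x : Γ(W, ⊤)) : TauDatum (Fin 1) (Fin 1) W := TauDatum.triv (fun _ => x)
  refine Quot.sound (TauDatum.Equiv.of_sameQuot
    (d := (((b x).sum er ec d).act (signGL (ec (.inl 0))))) (d' := (b (-x)).sum er ec d)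
    -- The negated column is compensated by the automorphism `-1` of the first summand of `𝒪 ⊕ E`.
    -- This restores the epimorphism and moves the sign into the section.
    (fun y => le_rfl) fun y => ⟨signGL (er (.inl 0)), ?_, ?_⟩)
  · refine (congrArg (fun M : Matrix s t Γ(W, ⊤ ⊓ d.U y) =>
      (signGL (er (.inl 0)) : GeneralLinearGroup s Γ(W, ⊤ ⊓ d.U y)).1 * M)
        (matrix_resHom_self _ _)).trans ?_
    ext i j
    refine (signGL_mul_apply _ _ _ _).trans ?_
    rw [act_sign_apply]
    obtain ⟨i | i, rfl⟩ := er.surjective i <;> obtain ⟨j | j, rfl⟩ := ec.surjective j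
    · simp [TauDatum.sum, b, TauDatum.triv, Subsingleton.elim i 0, Subsingleton.elim j 0]
      exact neg_neg 1
    · simp [TauDatum.sum, b, TauDatum.triv]
    · simp [TauDatum.sum, b, TauDatum.triv]
      exact fun _ => neg_zero
    · simp [TauDatum.sum, b, TauDatum.triv]
  · refine (congrArg (Matrix.mulVec _) (vec_resHom_self _ _)).trans ((signGL_mulVec _ _).trans ?_)
    ext i
    obtain ⟨i | i, rfl⟩ := er.surjective i
    · simp [TauDatum.sum, TauDatum.act, b, TauDatum.triv, Subsingleton.elim i 0]
      rfl
    · simp [TauDatum.sum, TauDatum.act, b, TauDatum.triv]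

end Identities

end

section

variable {k : Type u} [Field k]

open Matrix (GeneralLinearGroup)
open ExplicitCorr

/-! ### Invariance of framed correspondences -/

/-- Reindexing of the coordinates. -/
def affineReindex {r r' : Type} (σ : r ≃ r') :
    FramingSpace.Hom.{u} (affineSpace r) (affineSpace r') where
  hom :=
    { app := fun W => TypeCat.ofHom fun φ => φ ∘ σ.symm
      naturality := fun W W' f => by
        ext φ
        rfl }
  zero_hom φ := by
    ext x
    exact ⟨fun h i => σ.symm_apply_apply i ▸ h (σ i), fun h i => h _⟩

/-- The linear action on affine space. -/
def affineAct (n : ℕ) : LinAct.{u} (Fin n) n (affineSpace (Fin n)) where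
  mat _ _ := MonoidHom.id _
  mat_map _ _ _ _ _ _ := rfl
  act W g φ := g.1.mulVec φ
  act_one W φ := Matrix.one_mulVec _
  act_mul W g h φ := (Matrix.mulVec_mulVec φ g.1 h.1).symm
  act_map V W f g φ := funext fun i => RingHom.map_mulVec (gl f) g.1 φ i
  zero_act W g φ := by
    -- In every residue field the entries of `g φ` are linear combinations of those of `φ`. The
    -- reverse inclusion is the same statement for `g⁻¹`.
    have key : ∀ (g : GeneralLinearGroup (Fin n) Γ(W, ⊤)) (φ : Fin n → Γ(W, ⊤)),
        (affineSpace (Fin n)).zero φ ⊆ (affineSpace (Fin n)).zero (W := W) (g.1.mulVec φ) := by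
      intro g φ x hx i
      have hm : x ∈ (⊤ : W.Opens) := trivial
      have hx' : ∀ j, (W.evaluation ⊤ x hm).hom (φ j) = 0 := fun j =>
        (W.evaluation_eq_zero_iff_notMem_basicOpen x (U := ⊤) hm _).2 (hx j)
      refine (W.evaluation_eq_zero_iff_notMem_basicOpen x (U := ⊤) hm _).1 ?_
      change (W.evaluation ⊤ x hm).hom (g.1.mulVec φ i) = 0
      simp only [Matrix.mulVec, dotProduct, map_sum, map_mul, hx', mul_zero, Finset.sum_const_zero]
    refine Set.Subset.antisymm ?_ (key g φ)
    have e : g⁻¹.1.mulVec (g.1.mulVec φ) = φ := by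
      refine (Matrix.mulVec_mulVec (φ : Fin n → Γ(W, ⊤)) g⁻¹.1 g.1).trans ?_
      rw [← Units.val_mul, inv_mul_cancel, Units.val_one]
      exact Matrix.one_mulVec _
    exact (key g⁻¹ (g.1.mulVec φ)).trans (congrArg (affineSpace (Fin n)).zero e).le

lemma vecSum_perm {R : Type u} [CommRing R] {n : ℕ} (σ : Equiv.Perm (Fin n)) (x : Fin 1 → R)
    (v : Fin n → R) : vecSum finSumFinEquiv x ((permGL σ).1.mulVec v) =
      (permGL (onePerm σ)).1.mulVec (vecSum finSumFinEquiv x v) := by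
  rw [permGL_mulVec, permGL_mulVec]
  funext j
  refine Fin.addCases (fun j => ?_) (fun j => ?_) j
  · simp [onePerm_symm_castAdd]
  · simp [onePerm_symm_natAdd]

lemma vecSum_sign {R : Type u} [CommRing R] {n : ℕ} (x : R) (v : Fin n → R) :
    (signGL (Fin.castAdd n 0)).1.mulVec (vecSum finSumFinEquiv (fun _ : Fin 1 => x) v) =
      vecSum finSumFinEquiv (fun _ => -x) v := by
  rw [signGL_mulVec]
  funext j
  refine Fin.addCases (fun j => ?_) (fun j => ?_) j
  · obtain rfl := Subsingleton.elim j 0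
    simp
  · have : Fin.natAdd 1 j ≠ Fin.castAdd n 0 := fun h => by
      have := congrArg Fin.val h
      simp at this
    simp [Function.update_of_ne this]

/-- The levels of the bijections in use, such as `finLeftComm`, agree only propositionally. Once
they are identified, `σ` is a permutation and the reindexing is the action of its matrix. -/
lemma invariant_framed {n n' : ℕ} (σ : Fin n ≃ Fin n') :
    Invariant framed.{u} k (i := ()) (i' := ()) σ (affineReindex σ) := by
  obtain rfl : n = n' := by simpa using Fintype.card_congr σ
  intro X Y c
  refine (H0.mk_rel (reindex_lin_rel (affineAct n) σ σ (affineReindex σ) (fun _ _ => rfl)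
    (fun W φ => permGL_mulVec σ φ) c)).trans ?_
  refine H0.mk_lin_perm_of_susp (𝔖 := framed) (i := ()) (affineAct n) (affineAct (1 + n))
    (fun _ _ _ => rfl) (fun _ _ _ => rfl) (fun W x φ σ => ?_) (fun W x φ => ?_) σ c
  · exact vecSum_perm σ x φ
  · exact vecSum_sign x φ

/-! ### Invariance of cobordism-framed correspondences -/

section Blocks

variable {a b : Type} [Fintype a] [DecidableEq a] [Fintype b] [DecidableEq b] {R S : Type u}
  [CommRing R] [CommRing S]

/-- Extension of an invertible matrix by the identity on a second summand. -/
def inlGL : GeneralLinearGroup a R →* GeneralLinearGroup (a ⊕ b) R :=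
  Units.map
    { toFun := fun M => Matrix.fromBlocks M 0 0 1
      map_one' := Matrix.fromBlocks_one
      map_mul' := fun M N => by simp [Matrix.fromBlocks_multiply] }

/-- Extension of an invertible matrix by the identity on a first summand. -/
def inrGL : GeneralLinearGroup b R →* GeneralLinearGroup (a ⊕ b) R :=
  Units.map
    { toFun := fun M => Matrix.fromBlocks 1 0 0 M
      map_one' := Matrix.fromBlocks_one
      map_mul' := fun M N => by simp [Matrix.fromBlocks_multiply] }

lemma map_inlGL (f : R →+* S) (g : GeneralLinearGroup a R) :
    GeneralLinearGroup.map f (inlGL (b := b) g) = inlGL (GeneralLinearGroup.map f g) := by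
  refine Units.ext ((Matrix.fromBlocks_map _ _ _ _ f).trans ?_)
  rw [Matrix.map_zero f (map_zero f), Matrix.map_zero f (map_zero f),
    Matrix.map_one f (map_zero f) (map_one f)]
  rfl

lemma map_inrGL (f : R →+* S) (g : GeneralLinearGroup b R) :
    GeneralLinearGroup.map f (inrGL (a := a) g) = inrGL (GeneralLinearGroup.map f g) := by
  refine Units.ext ((Matrix.fromBlocks_map _ _ _ _ f).trans ?_)
  rw [Matrix.map_zero f (map_zero f), Matrix.map_zero f (map_zero f),
    Matrix.map_one f (map_zero f) (map_one f)]
  rfl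

lemma inlGL_permGL (σ : Equiv.Perm a) :
    inlGL (b := b) (permGL σ : GeneralLinearGroup a R) =
      permGL (Equiv.sumCongr σ (Equiv.refl b)) := by
  refine Units.ext (Matrix.ext ?_)
  rintro (i | i) (j | j) <;>
    simp [inlGL, permGL, Equiv.Perm.permMatrix, PEquiv.toMatrix_apply, Matrix.one_apply]

lemma inrGL_permGL (σ : Equiv.Perm b) :
    inrGL (a := a) (permGL σ : GeneralLinearGroup b R) =
      permGL (Equiv.sumCongr (Equiv.refl a) σ) := by
  refine Units.ext (Matrix.ext ?_)
  rintro (i | i) (j | j) <;>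
    simp [inrGL, permGL, Equiv.Perm.permMatrix, PEquiv.toMatrix_apply, Matrix.one_apply]

lemma inlGL_signGL (z : a) :
    inlGL (b := b) (signGL z : GeneralLinearGroup a R) = signGL (.inl z) := by
  refine Units.ext (Matrix.ext ?_)
  rintro (i | i) (j | j) <;>
    simp [inlGL, signGL, Matrix.diagonal_apply, Function.update_apply, Matrix.one_apply]

lemma inrGL_signGL (z : b) :
    inrGL (a := a) (signGL z : GeneralLinearGroup b R) = signGL (.inr z) := by
  refine Units.ext (Matrix.ext ?_)
  rintro (i | i) (j | j) <;>
    simp [inrGL, signGL, Matrix.diagonal_apply, Function.update_apply, Matrix.one_apply]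

end Blocks

/-- Simultaneous changes of the coordinates of affine space and of the first `n` columns. -/
def tauActLeft (n N : ℕ) : LinAct.{u} (Fin n) n (tau n N) where
  mat _ _ := MonoidHom.id _
  mat_map _ _ _ _ _ _ := rfl
  act W g φ := tauAct (inlGL g) φ
  act_one W φ := by rw [map_one, tauAct_one]
  act_mul W g h φ := by rw [map_mul, tauAct_mul]
  act_map V W f g φ := by rw [tauAct_map, map_inlGL]
  zero_act W g φ := zero_tauAct _ φ

/-- Changes of the last `N` columns. -/
def tauActRight (n N : ℕ) : LinAct.{u} (Fin N) n (tau n N) where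
  mat _ _ := 1
  mat_map _ _ _ _ _ _ := (map_one _).symm
  act W g φ := tauAct (inrGL g) φ
  act_one W φ := by rw [map_one, tauAct_one]
  act_mul W g h φ := by rw [map_mul, tauAct_mul]
  act_map V W f g φ := by rw [tauAct_map, map_inrGL]
  zero_act W g φ := zero_tauAct _ φ

/-- The columns of a suspension. -/
abbrev suspCols (n N : ℕ) : Fin 1 ⊕ (Fin n ⊕ Fin N) ≃ Fin (1 + n) ⊕ Fin N :=
  (Equiv.sumAssoc (Fin 1) (Fin n) (Fin N)).symm.trans
    (Equiv.sumCongr finSumFinEquiv (Equiv.refl _))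

/-- The columns of an extension by zero. -/
abbrev inclCols (n N : ℕ) : (Fin n ⊕ Fin N) ⊕ Fin 1 ≃ Fin n ⊕ Fin (N + 1) :=
  (Equiv.sumAssoc (Fin n) (Fin N) (Fin 1)).trans
    (Equiv.sumCongr (Equiv.refl _) finSumFinEquiv)

lemma isSum_susp_cols {n N : ℕ} (σ : Equiv.Perm (Fin n)) :
    IsSum (suspCols n N) (suspCols n N) (Equiv.refl _) (Equiv.sumCongr σ (Equiv.refl _))
      (Equiv.sumCongr (onePerm σ) (Equiv.refl _)) where
  left x := by simp [onePerm_castAdd]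
  right x := by rcases x with x | x <;> simp [onePerm_natAdd]

lemma tauSum_act_perm {n N : ℕ} (W : Scheme.{u}) (x : (affineSpace (Fin 1)).sec.obj (op W))
    (φ : (tau.{u} n N).sec.obj (op W)) (σ : Equiv.Perm (Fin n)) :
    (cobordism.susp n N).hom.app (op W) (x, (tauActLeft n N).act W (permGL σ) φ) =
      (tauActLeft (1 + n) N).act W (permGL (onePerm σ))
        ((cobordism.susp n N).hom.app (op W) (x, φ)) := by
  change (cobordism.susp n N).hom.app (op W) (x, tauAct (inlGL (permGL σ)) φ) =
    tauAct (inlGL (permGL (onePerm σ))) ((cobordism.susp n N).hom.app (op W) (x, φ))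
  rw [inlGL_permGL, inlGL_permGL, tauAct_perm]
  refine Eq.trans ?_ (tauAct_perm (c := Fin (1 + n) ⊕ Fin N) _ _).symm
  exact tauSum_reindex_right (er := finSumFinEquiv) (er' := finSumFinEquiv) (σ := Equiv.refl _)
    (σ' := Equiv.refl _) ⟨fun _ => rfl, fun _ => rfl⟩
    (isSum_susp_cols σ) W ((tauTriv (Fin 1)).hom.app (op W) x) φ

/-- Coordinates of affine space and the first `n` columns are changed together: rank stabilisation
adds one of each, and it is their combined sign change that `tauAct_sign_susp` and
`lin_sign_susp_rel` make trivial. -/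
lemma mk_lin_tauActLeft {n N : ℕ} {X : Sch k} {Y : (Sch k)ᵒᵖ ⥤ Type u} (σ : Equiv.Perm (Fin n))
    (c : ExplicitCorr n (cobordism.{u}.space n N) X Y) :
    H0.mk cobordism (c.lin (tauActLeft n N) (permGL σ)) = H0.mk cobordism (i := N) c := by
  refine H0.mk_lin_perm_of_susp (𝔖 := cobordism) (i := N) (tauActLeft n N) (tauActLeft (1 + n) N)
    (fun _ _ _ => rfl) (fun _ _ _ => rfl) tauSum_act_perm (fun W x φ => ?_) σ c
  change tauAct (inlGL (signGL (Fin.castAdd n 0))) _ = _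
  rw [inlGL_signGL]
  exact tauAct_sign_susp (ec := suspCols n N) W x φ

section Right

variable {ι : Type} [Fintype ι] [DecidableEq ι] {n : ℕ} {𝓕 𝓖 : FramingSpace.{u}} {X : Sch k}
  {Y : (Sch k)ᵒᵖ ⥤ Type u} (L : LinAct ι n 𝓕)

lemma lin_rel_self (c : ExplicitCorr n 𝓕 X Y) (g : GeneralLinearGroup ι Γ(X.left, ⊤))
    (hL : L.mat _ g = 1) (h : L.act c.W (GeneralLinearGroup.map (gl c.base) g) c.φ = c.φ) :
    (c.lin L g).Rel c := by
  refine lin_rel L (𝟙 _) ?_ ?_ (fun _ _ _ => rfl) fun x => ?_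
  · rw [hL, Units.val_one, linHom_one, Category.id_comp, Category.comp_id]
  · have e : c.φAt (𝟙 _) = c.φ := 𝓕.sec.map_id_apply _ _
    rw [e, h]
  · rw [hL, inv_one, Units.val_one, linHom_one]
    rfl

end Right

/-- The extension of a permutation by a fixed point at the end. -/
def permOne {n : ℕ} (σ : Equiv.Perm (Fin n)) : Equiv.Perm (Fin (n + 1)) :=
  finSumFinEquiv.permCongr (Equiv.sumCongr σ (Equiv.refl _))

lemma permOne_castAdd {n : ℕ} (σ : Equiv.Perm (Fin n)) (i : Fin n) :
    permOne σ (Fin.castAdd 1 i) = Fin.castAdd 1 (σ i) := by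
  simp only [permOne, Equiv.permCongr_apply, finSumFinEquiv_symm_apply_castAdd]
  rfl

lemma permOne_natAdd {n : ℕ} (σ : Equiv.Perm (Fin n)) (i : Fin 1) :
    permOne σ (Fin.natAdd n i) = Fin.natAdd n i := by
  simp only [permOne, Equiv.permCongr_apply, finSumFinEquiv_symm_apply_natAdd]
  rfl

lemma permOne_swap {n : ℕ} (a b : Fin n) :
    permOne (Equiv.swap a b) = Equiv.swap (Fin.castAdd 1 a) (Fin.castAdd 1 b) := by
  ext1 i
  refine Fin.addCases (fun i => ?_) (fun i => ?_) i
  · rw [permOne_castAdd]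
    exact (Function.Injective.map_swap (Fin.castAdd_injective _ 1) _ _ _).symm ▸ rfl
  · rw [permOne_natAdd, Equiv.swap_apply_of_ne_of_ne]
    · intro h
      have := congrArg Fin.val h
      simp at this
      omega
    · intro h
      have := congrArg Fin.val h
      simp at this
      omega

/-- With `mat` trivial no coordinate moves, so the action is a mere change of framing. This is the
situation of the auxiliary columns. -/
lemma H0.mk_lin_perm_eq {𝔖 : FramingTheory.{u}} {ι : Type} [Fintype ι] [DecidableEq ι] {n : ℕ}
    {i : 𝔖.Idx} {X : Sch k} {Y : (Sch k)ᵒᵖ ⥤ Type u} (L : LinAct ι n (𝔖.space n i))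
    (τ : Equiv.Perm ι) (hL : ∀ (R : Type u) [CommRing R] g, L.mat R g = 1)
    (c : ExplicitCorr n (𝔖.space n i) X Y) :
    H0.mk 𝔖 (c.lin L (permGL τ)) = H0.mk 𝔖 (c.reframe (L.permHom τ)) :=
  (H0.mk_rel (reindex_lin_rel L τ (Equiv.refl _) (L.permHom τ)
    (fun R _ => (hL R _).trans permGL_one.symm) (fun _ _ => rfl) c)).symm.trans
      (H0.mk_rel (reindex_refl_rel c _))

/-- Permutations of auxiliary coordinates act trivially on classes. -/
lemma H0.mk_lin_perm_of_incl {𝔖 : FramingTheory.{u}} {n N : ℕ} {i : 𝔖.Idx} {X : Sch k}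
    {Y : (Sch k)ᵒᵖ ⥤ Type u} (L : LinAct (Fin N) n (𝔖.space n i))
    (L' : LinAct (Fin (N + 1)) n (𝔖.space n (𝔖.next i)))
    (hL : ∀ (R : Type u) [CommRing R] g, L.mat R g = 1)
    (hL' : ∀ (R : Type u) [CommRing R] g, L'.mat R g = 1)
    (H : ∀ (W : Scheme.{u}) φ (σ : Equiv.Perm (Fin N)),
      (𝔖.incl n i).hom.app (op W) (L.act W (permGL σ) φ) =
        L'.act W (permGL (permOne σ)) ((𝔖.incl n i).hom.app (op W) φ))
    (H' : ∀ (W : Scheme.{u}) φ, L'.act W (signGL (Fin.natAdd N 0))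
      ((𝔖.incl n i).hom.app (op W) φ) = (𝔖.incl n i).hom.app (op W) φ)
    (σ : Equiv.Perm (Fin N)) (c : ExplicitCorr n (𝔖.space n i) X Y) :
    H0.mk 𝔖 (c.lin L (permGL σ)) = H0.mk 𝔖 c := by
  refine mk_lin_perm L (fun a b hab c => ?_) σ c
  have e : (c.reframe (L.permHom (Equiv.swap a b))).reframe (𝔖.incl n i) =
      (c.reframe (𝔖.incl n i)).reframe (L'.permHom (permOne (Equiv.swap a b))) :=
    ext_φ ((c.reframe (𝔖.incl n i)).reframe (L'.permHom (permOne (Equiv.swap a b))))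
      (H _ _ _) _ _
  -- The same device as for coordinates: the spare index `z` is the one added at the end by `incl`,
  -- and `H'` says that its sign change leaves the framing alone.
  rw [mk_lin_perm_eq L _ hL, ← mk_incl, e, ← mk_lin_perm_eq L' _ hL', permOne_swap]
  refine (mk_lin_swap L' (z := Fin.natAdd N 0) ?_ ?_ ?_ _ ?_).trans (mk_incl c)
  · exact fun h => hab (Fin.castAdd_injective _ 1 h)
  · intro h
    have := congrArg Fin.val h
    simp at this
    omega
  · intro h
    have := congrArg Fin.val h
    simp at this
    omega
  · refine mk_rel (lin_rel_self L' _ _ (hL' _ _) ?_)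
    rw [map_signGL]
    exact H' _ _

lemma isSum_incl_cols {n N : ℕ} (σ : Equiv.Perm (Fin N)) :
    IsSum (inclCols n N) (inclCols n N) (Equiv.sumCongr (Equiv.refl _) σ) (Equiv.refl _)
      (Equiv.sumCongr (Equiv.refl _) (permOne σ)) where
  left x := by
    rcases x with x | x
    · rfl
    · exact congrArg Sum.inr (permOne_castAdd σ x)
  right x := congrArg Sum.inr (permOne_natAdd σ x)

lemma tauZeroCols_act_perm {n N : ℕ} (W : Scheme.{u}) (φ : (tau.{u} n N).sec.obj (op W))
    (σ : Equiv.Perm (Fin N)) :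
    (cobordism.incl n N).hom.app (op W) ((tauActRight n N).act W (permGL σ) φ) =
      (tauActRight n (N + 1)).act W (permGL (permOne σ))
        ((cobordism.incl n N).hom.app (op W) φ) := by
  change (cobordism.incl n N).hom.app (op W) (tauAct (inrGL (permGL σ)) φ) =
    tauAct (inrGL (permGL (permOne σ))) ((cobordism.incl n N).hom.app (op W) φ)
  rw [inrGL_permGL, inrGL_permGL, tauAct_perm]
  refine Eq.trans ?_ (tauAct_perm (c := Fin n ⊕ Fin (N + 1)) _ _).symm
  exact tauZeroCols_reindex (isSum_incl_cols σ) W φ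

lemma mk_lin_tauActRight {n N : ℕ} {X : Sch k} {Y : (Sch k)ᵒᵖ ⥤ Type u} (σ : Equiv.Perm (Fin N))
    (c : ExplicitCorr n (cobordism.{u}.space n N) X Y) :
    H0.mk cobordism (c.lin (tauActRight n N) (permGL σ)) = H0.mk cobordism (i := N) c := by
  refine H0.mk_lin_perm_of_incl (𝔖 := cobordism) (i := N) (tauActRight n N) (tauActRight n (N + 1))
    (fun _ _ _ => rfl) (fun _ _ _ => rfl) tauZeroCols_act_perm (fun W φ => ?_) σ c
  change tauAct (inrGL (signGL (Fin.natAdd N 0))) _ = _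
  rw [inrGL_signGL]
  exact tauAct_sign_zeroCols (ec := inclCols n N) 0 W φ

/-- The reindexing is split in two: `σ` moves the coordinates together with the first columns, `τ`
only the auxiliary columns. Permuting the rows costs nothing, by `tauReindex_perm`. -/
lemma invariant_cobordism {n n' N N' : ℕ} (σ : Fin n ≃ Fin n') (τ : Fin N ≃ Fin N') :
    Invariant cobordism.{u} k (i := N) (i' := N') σ (tauReindex σ (Equiv.sumCongr σ τ)) := by
  obtain rfl : n = n' := by simpa using Fintype.card_congr σ
  obtain rfl : N = N' := by simpa using Fintype.card_congr τ
  intro X Y c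
  have e : tauReindex.{u} σ (Equiv.sumCongr σ τ) =
      (tauReindex σ (Equiv.sumCongr σ (Equiv.refl _))).comp
        (tauReindex (Equiv.refl _) (Equiv.sumCongr (Equiv.refl _) τ)) := by
    rw [← tauReindex_comp, Equiv.sumCongr_trans]
    rfl
  have h1 := H0.mk_rel (𝔖 := cobordism) (i := N) (reindex_reindex_rel c σ
    (tauReindex σ (Equiv.sumCongr σ (Equiv.refl _))) (Equiv.refl _)
      (tauReindex (Equiv.refl _) (Equiv.sumCongr (Equiv.refl _) τ)))
  have h2 := fun c : ExplicitCorr n (cobordism.{u}.space n N) X Y =>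
    H0.mk_rel (𝔖 := cobordism) (i := N) (reindex_lin_rel (tauActRight n N) τ (Equiv.refl _)
    (tauReindex (Equiv.refl _) (Equiv.sumCongr (Equiv.refl _) τ)) (fun _ _ => permGL_one.symm)
    (fun W φ => (congrArg (tauAct · φ) (inrGL_permGL τ)).trans (tauAct_perm _ φ)) c)
  have h3 := H0.mk_rel (𝔖 := cobordism) (i := N) (reindex_lin_rel (tauActLeft n N) σ σ
    (tauReindex σ (Equiv.sumCongr σ (Equiv.refl _))) (fun _ _ => rfl)
    (fun W φ => (congrArg (tauAct · φ) (inlGL_permGL σ)).trans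
      ((tauAct_perm _ φ).trans (tauReindex_perm σ _ φ).symm)) c)
  rw [e]
  exact h1.trans ((h2 _).trans ((mk_lin_tauActRight _ _).trans (h3.trans (mk_lin_tauActLeft _ _))))

end

section

variable {k : Type u} [Field k]

open ExplicitCorr

/-! ### The products -/

lemma isAssoc_fin (a b c : ℕ) : IsAssoc (finSumFinEquiv (m := a + b) (n := c)) finSumFinEquiv
    finSumFinEquiv finSumFinEquiv (finAssoc a b c) where
  left := finAssoc_left a b c
  mid := finAssoc_mid a b c
  right := finAssoc_right a b c

lemma isLeftComm_fin (a b c : ℕ) : IsLeftComm (finSumFinEquiv (m := b) (n := a + c)) finSumFinEquiv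
    finSumFinEquiv finSumFinEquiv (finLeftComm a b c) where
  left := finLeftComm_left a b c
  mid := finLeftComm_mid a b c
  right := finLeftComm_right a b c

lemma vecSum_empty_left {r₁ r₂ s : Type} [IsEmpty r₁] {er : r₁ ⊕ r₂ ≃ s} {σ : r₂ ≃ s}
    (h : ∀ x, σ x = er (.inr x)) {R : Type u} (v : r₁ → R) (w : r₂ → R) :
    vecSum er v w = w ∘ σ.symm :=
  eq_comp_symm fun i => by rw [h]; simp

lemma vecSum_empty_right {r₁ r₂ s : Type} [IsEmpty r₂] {er : r₁ ⊕ r₂ ≃ s} {σ : r₁ ≃ s}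
    (h : ∀ x, σ x = er (.inl x)) {R : Type u} (v : r₁ → R) (w : r₂ → R) :
    vecSum er v w = v ∘ σ.symm :=
  eq_comp_symm fun i => by rw [h]; simp

lemma finCongr_zero_add (n : ℕ) (x : Fin n) :
    finCongr (Nat.zero_add n).symm x = finSumFinEquiv (.inr x) := by
  ext; simp

lemma finCongr_add_zero (n : ℕ) (x : Fin n) :
    finCongr (Nat.add_zero n).symm x = finSumFinEquiv (.inl x) := rfl

/-- Invariance holds for every bijection, so only identities between tuples of functions remain. The
auxiliary stabilisation is the identity here. -/
lemma stableProduct_framed : StableProduct framed.{u} k :=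
  StableProduct.of_invariant
    (fun n _ n' _ => ⟨affineReindex _, invariant_framed _, fun W x φ ψ =>
      vecSum_assoc (isAssoc_fin 1 n n') (R := Γ(W, ⊤)) x φ ψ⟩)
    (fun n _ n' _ => ⟨affineReindex _, invariant_framed _, fun W x φ ψ =>
      vecSum_leftComm (isLeftComm_fin 1 n n') (R := Γ(W, ⊤)) x φ ψ⟩)
    (fun _ _ _ _ => ⟨affineReindex _, invariant_framed _, fun _ _ _ => rfl⟩)
    (fun _ _ _ _ => ⟨affineReindex _, invariant_framed _, fun _ _ _ => rfl⟩)
    (fun n _ n' _ n'' _ => ⟨affineReindex _, invariant_framed _, fun W φ ψ χ =>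
      vecSum_assoc (isAssoc_fin n n' n'') (R := Γ(W, ⊤)) φ ψ χ⟩)
    (fun n _ => ⟨affineReindex _, invariant_framed _, fun _ W _ φ =>
      vecSum_empty_left (finCongr_zero_add n) (R := Γ(W, ⊤)) _ φ⟩)
    (fun n _ => ⟨affineReindex _, invariant_framed _, fun _ W _ φ =>
      vecSum_empty_right (finCongr_add_zero n) (R := Γ(W, ⊤)) φ _⟩)

/-- The columns of a direct sum. -/
abbrev sumCols (n N n' N' : ℕ) :
    (Fin n ⊕ Fin N) ⊕ (Fin n' ⊕ Fin N') ≃ Fin (n + n') ⊕ Fin (N + N') :=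
  (Equiv.sumSumSumComm (Fin n) (Fin N) (Fin n') (Fin N')).trans
    (Equiv.sumCongr finSumFinEquiv finSumFinEquiv)

/-- Rank stabilisation puts its column into the first block, so the auxiliary columns stay in place.
-/
lemma isAssoc_susp_cols (n N n' N' : ℕ) :
    IsAssoc (sumCols (1 + n) N n' N') (suspCols n N) (suspCols (n + n') (N + N'))
      (sumCols n N n' N') (Equiv.sumCongr (finAssoc 1 n n') (Equiv.refl _)) where
  left x := congrArg Sum.inl (finAssoc_left 1 n n' x)
  mid x := by
    rcases x with x | x
    · exact congrArg Sum.inl (finAssoc_mid 1 n n' x)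
    · rfl
  right x := by
    rcases x with x | x
    · exact congrArg Sum.inl (finAssoc_right 1 n n' x)
    · rfl

lemma isLeftComm_susp_cols (n N n' N' : ℕ) :
    IsLeftComm (sumCols n N (1 + n') N') (suspCols n' N') (suspCols (n + n') (N + N'))
      (sumCols n N n' N') (Equiv.sumCongr (finLeftComm 1 n n') (Equiv.refl _)) where
  left x := congrArg Sum.inl (finLeftComm_left 1 n n' x)
  mid x := by
    rcases x with x | x
    · exact congrArg Sum.inl (finLeftComm_mid 1 n n' x)
    · rfl
  right x := by
    rcases x with x | x
    · exact congrArg Sum.inl (finLeftComm_right 1 n n' x)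
    · rfl

lemma isAssoc_sum_cols (n N n' N' n'' N'' : ℕ) :
    IsAssoc (sumCols (n + n') (N + N') n'' N'') (sumCols n N n' N')
      (sumCols n N (n' + n'') (N' + N'')) (sumCols n' N' n'' N'')
      (Equiv.sumCongr (finAssoc n n' n'') (finAssoc N N' N'')) where
  left x := by
    rcases x with x | x
    · exact congrArg Sum.inl (finAssoc_left n n' n'' x)
    · exact congrArg Sum.inr (finAssoc_left N N' N'' x)
  mid x := by
    rcases x with x | x
    · exact congrArg Sum.inl (finAssoc_mid n n' n'' x)
    · exact congrArg Sum.inr (finAssoc_mid N N' N'' x)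
  right x := by
    rcases x with x | x
    · exact congrArg Sum.inl (finAssoc_right n n' n'' x)
    · exact congrArg Sum.inr (finAssoc_right N N' N'' x)

/-- The permutation that interchanges the last two summands. -/
def finRightComm (a b c : ℕ) : Fin (a + b + c) ≃ Fin (a + c + b) :=
  (finAssoc a b c).symm.trans ((finSumFinEquiv.symm.trans
    ((Equiv.sumCongr (Equiv.refl _) (finSumFinEquiv.symm.trans
      ((Equiv.sumComm _ _).trans finSumFinEquiv))).trans finSumFinEquiv)).trans (finAssoc a c b))

lemma isRightComm_fin (a b c : ℕ) : IsRightComm (finSumFinEquiv (m := a + c) (n := b))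
    finSumFinEquiv finSumFinEquiv finSumFinEquiv (finRightComm a b c) where
  left x := by simp [finRightComm, finAssoc_symm_left, finAssoc_left]
  mid x := by simp [finRightComm, finAssoc_symm_mid, finAssoc_right]
  right x := by simp [finRightComm, finAssoc_symm_right, finAssoc_mid]

/-- A zero column added to the first factor lands between the `N` and the `N'` auxiliary columns of
the product and has to pass the latter to reach the end. -/
lemma isRightComm_incl_cols (n N n' N' : ℕ) :
    IsRightComm (sumCols n (N + 1) n' N') (inclCols n N) (inclCols (n + n') (N + N'))
      (sumCols n N n' N') (Equiv.sumCongr (Equiv.refl _) (finRightComm N N' 1)) where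
  left x := by
    rcases x with x | x
    · rfl
    · exact congrArg Sum.inr ((isRightComm_fin N N' 1).left x)
  mid x := by
    rcases x with x | x
    · rfl
    · exact congrArg Sum.inr ((isRightComm_fin N N' 1).mid x)
  right x := congrArg Sum.inr ((isRightComm_fin N N' 1).right x)

/-- A zero column added to the second factor is already last, so only the bracketing changes. -/
lemma isAssoc_incl_cols (n N n' N' : ℕ) :
    IsAssoc (inclCols (n + n') (N + N')) (sumCols n N n' N') (sumCols n N n' (N' + 1))
      (inclCols n' N') (Equiv.sumCongr (Equiv.refl _) (finAssoc N N' 1)) where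
  left x := by
    rcases x with x | x
    · rfl
    · exact congrArg Sum.inr (finAssoc_left N N' 1 x)
  mid x := by
    rcases x with x | x
    · rfl
    · exact congrArg Sum.inr (finAssoc_mid N N' 1 x)
  right x := congrArg Sum.inr (finAssoc_right N N' 1 x)

/-- Reindexing of the coordinates and of the columns. -/
abbrev tauMove {n n' N N' : ℕ} (σ : Fin n ≃ Fin n') (τ : Fin N ≃ Fin N') :
    FramingSpace.Hom.{u} (tau n N) (tau n' N') := tauReindex σ (Equiv.sumCongr σ τ)

/-- Rank stabilisation is itself a direct sum, with the trivial quotient of rank one supplied by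
`tauTriv`. Its compatibility with products is therefore an instance of the associativity and
exchange identities for `tauSum`. -/
lemma stableProduct_cobordism : StableProduct cobordism.{u} k :=
  StableProduct.of_invariant
    (fun n (N : ℕ) n' (N' : ℕ) => ⟨tauMove (finAssoc 1 n n') (Equiv.refl (Fin (N + N'))),
      invariant_cobordism (finAssoc 1 n n') (Equiv.refl (Fin (N + N'))),
      fun W x φ ψ => tauSum_assoc (isAssoc_fin 1 n n') (isAssoc_susp_cols n N n' N') W
        ((tauTriv (Fin 1)).hom.app (op W) x) φ ψ⟩)
    (fun n (N : ℕ) n' (N' : ℕ) => ⟨tauMove (finLeftComm 1 n n') (Equiv.refl (Fin (N + N'))),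
      invariant_cobordism (finLeftComm 1 n n') (Equiv.refl (Fin (N + N'))),
      fun W x φ ψ => tauSum_leftComm (isLeftComm_fin 1 n n') (isLeftComm_susp_cols n N n' N') W
        ((tauTriv (Fin 1)).hom.app (op W) x) φ ψ⟩)
    (fun n (N : ℕ) n' (N' : ℕ) => ⟨tauMove (Equiv.refl (Fin (n + n'))) (finRightComm N N' 1),
      invariant_cobordism (Equiv.refl (Fin (n + n'))) (finRightComm N N' 1),
      fun W φ ψ => tauSum_zeroCols_left (isRightComm_incl_cols n N n' N') W φ ψ⟩)
    (fun n (N : ℕ) n' (N' : ℕ) => ⟨tauMove (Equiv.refl (Fin (n + n'))) (finAssoc N N' 1).symm,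
      invariant_cobordism (Equiv.refl (Fin (n + n'))) (finAssoc N N' 1).symm,
      fun W φ ψ => tauSum_zeroCols_right (c₂₃ := Fin n' ⊕ Fin (N' + 1))
        (t' := Fin (n + n') ⊕ Fin (N + N' + 1)) (t := Fin (n + n') ⊕ Fin (N + (N' + 1)))
        (c₁₂ := Fin (n + n') ⊕ Fin (N + N'))
        (isAssoc_incl_cols n N n' N') W φ ψ⟩)
    (fun n (N : ℕ) n' (N' : ℕ) n'' (N'' : ℕ) =>
      ⟨tauMove (finAssoc n n' n'') (finAssoc N N' N''),
      invariant_cobordism (finAssoc n n' n'') (finAssoc N N' N''),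
      fun W φ ψ χ => tauSum_assoc (isAssoc_fin n n' n'') (isAssoc_sum_cols n N n' N' n'' N'') W
        φ ψ χ⟩)
    (fun n (N : ℕ) =>
      ⟨tauMove (finCongr (Nat.zero_add n).symm) (finCongr (Nat.zero_add N).symm),
      invariant_cobordism (finCongr (Nat.zero_add n).symm) (finCongr (Nat.zero_add N).symm),
      -- The framing of level `0` has no rows and no columns, so its value is irrelevant.
      fun _ W _ φ => tauSum_empty_left (r₁ := Fin 0) (c₁ := Fin 0 ⊕ Fin 0) (finCongr_zero_add n)
        (ec := sumCols 0 0 n N) (fun x => by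
          rcases x with x | x
          · exact congrArg Sum.inl (finCongr_zero_add n x)
          · exact congrArg Sum.inr (finCongr_zero_add N x)) W _ φ⟩)
    (fun n (N : ℕ) =>
      ⟨tauMove (finCongr (Nat.add_zero n).symm) (finCongr (Nat.add_zero N).symm),
      invariant_cobordism (finCongr (Nat.add_zero n).symm) (finCongr (Nat.add_zero N).symm),
      fun _ W _ φ => tauSum_empty_right (r₂ := Fin 0) (c₂ := Fin 0 ⊕ Fin 0) (finCongr_add_zero n)
        (ec := sumCols n N 0 0) (fun x => by
          rcases x with x | x
          · exact congrArg Sum.inl (finCongr_add_zero n x)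
          · exact congrArg Sum.inr (finCongr_add_zero N x)) W φ _⟩)

end

end CobFr

end

theorem mainTheorem7 (k : Type u) [Field k] [CharZero k] :
    ∃ (μF : ∀ m m' : ℕ, CobFr.H0 CobFr.framed (CobFr.pt k) (CobFr.Gm k m) →+
          CobFr.H0 CobFr.framed (CobFr.pt k) (CobFr.Gm k m') →+
          CobFr.H0 CobFr.framed (CobFr.pt k) (CobFr.Gm k (m + m')))
      (μC : ∀ m m' : ℕ, CobFr.H0 CobFr.cobordism (CobFr.pt k) (CobFr.Gm k m) →+
          CobFr.H0 CobFr.cobordism (CobFr.pt k) (CobFr.Gm k m') →+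
          CobFr.H0 CobFr.cobordism (CobFr.pt k) (CobFr.Gm k (m + m'))),
      CobFr.IsExternalProduct CobFr.framed k μF ∧ CobFr.IsExternalProduct CobFr.cobordism k μC ∧
      ∃ (_ : DirectSum.GRing (fun m : ℕ => CobFr.WedgeH0 CobFr.framed k m))
        (_ : DirectSum.GRing (fun m : ℕ => CobFr.WedgeH0 CobFr.cobordism k m)),
        CobFr.IsProductRing CobFr.framed k μF ∧ CobFr.IsProductRing CobFr.cobordism k μC ∧
        ∃ f : DirectSum ℕ (fun m => CobFr.WedgeH0 CobFr.framed k m) →+*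
            DirectSum ℕ (fun m => CobFr.WedgeH0 CobFr.cobordism k m),
          ∀ (m : ℕ) (x : CobFr.WedgeH0 CobFr.framed k m),
            f (DirectSum.of (fun m => CobFr.WedgeH0 CobFr.framed k m) m x) =
              DirectSum.of (fun m => CobFr.WedgeH0 CobFr.cobordism k m) m (CobFr.wedgeHcob k m x) := by
  have P := CobFr.stableProduct_framed.{u} (k := k)
  have Q := CobFr.stableProduct_cobordism.{u} (k := k)
  exact ⟨P.extMul, Q.extMul, P.isExternalProduct, Q.isExternalProduct, P.gRing, Q.gRing,
    P.isProductRing, Q.isProductRing, CobFr.exists_graded_ring_hom P Q⟩
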